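/- Let $n\ge 2$, let $b\in GL(n,\mathbb C)$ with inverse $\bar b=b^{-1}$, and let $q\in\mathbb C^*$ satisfy $\operatorname{tr}(b^t\bar b)=-(q+q^{-1})$, where $q$ is not a root of unity. Let $X=|b\rangle\langle\bar b|$ be the operator on $\mathbb C^n\otimes\mathbb C^n$ with matrix $X_{cd,xy}=b_{cd}\bar b_{xy}$, and put $\check R=qI+X$; it is invertible, with $\check R^{-1}=q^{-1}I+X$. Let $\mathcal P$ be the permutation of the two factors. Let $TL_N(q)$ be the algebra with generators $X_1,\dots,X_{N-1}$ and relations $X_j^2=-(q+q^{-1})X_j$, $X_jX_kX_j=X_j$ for $|j-k|=1$, $X_jX_k=X_kX_j$ for $|j-k|>1$. It acts on $\mathcal H=(\mathbb C^n)^{\otimes N}$, $N\ge 0$, by letting $X_j$ act as $X$ on the factors $j,j+1$. Let $\mathcal U_q(n)$ be the algebra generated by the entries of two $n\times n$ matrices $L^+,L^-$ with the relations $$\check R_{12}L^{\pm}_1L^{\pm}_2=L^{\pm}_1L^{\pm}_2\check R_{12},\qquad \check R_{12}L^+_1L^-_2=L^-_1L^+_2\check R_{12}.$$ Fix a normalization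 $z\in\mathbb C^*$ (for instance $z=1$). On $\mathbb C^n$ the algebra acts through $L^+=z\,\mathcal P\check R$, $L^-=z^{-1}\mathcal P\check R^{-1}$ (matrices over the first, auxiliary factor, whose entries are operators on the second factor), and on $\mathcal H$ it acts through the iterated coproduct: the generators $L^\pm_{ij}$ act as the entries of $L^\pm_{aq_N}\cdots L^\pm_{aq_2}L^\pm_{aq_1}$, where $L^\pm_{aq_l}$ acts on the $l$-th factor of $\mathcal H$. Then: 1. For every $N\ge0$ the images of $\mathcal U_q(n)$ and $TL_N(q)$ in $\operatorname{End}(\mathcal H)$ are each other's centralizers. 2. There are pairwise non-isomorphic irreducible $\mathcal U_q(n)$-modules $V_k(n)$, $k=0,1,2,\dots$, and, for every $N$, pairwise non-isomorphic irreducible $TL_N(q)$-modules $W_k(N)$, indexed by the Young diagrams $\lambda=(\lambda_1\ge\lambda_2\ge 0)$, $\lambda_1+\lambda_2=N$, with $k=\lambda_1-\lambda_2$, such that for every $N$, with respect to both actions, $$\mathcal H\;\cong\;\bigoplus_{\lambda}W_k(N)\otimes V_k(n)^{(\lambda_2)} .$$ Here $V^{(j)}$ is $V$ tensored with the $j$-th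 power of the one-dimensional module on which $L^{\pm}$ acts as $(z^2q)^{\pm1}I$ (the twist is trivial when $z^2=q^{-1}$). Thus $\mathcal H\cong\bigoplus_k p_k(n)W_k(N)$ as a $TL_N(q)$-module and $\mathcal H\cong\bigoplus_k\nu_k(N)V_k(n)$ (up to these twists) as a $\mathcal U_q(n)$-module, where $p_k(n)=\dim V_k(n)$ and $\nu_k(N)=\dim W_k(N)$. 3. The dimensions satisfy $p_0(n)=1$, $p_1(n)=n$, $n\,p_k(n)=p_{k+1}(n)+p_{k-1}(n)$ for $k\ge1$; and, with $\nu_k(0)=\delta_{k,0}$ and $\nu_{-1}(N)=0$, they satisfy the Bratteli recurrence $\nu_k(N)=\nu_{k+1}(N-1)+\nu_{k-1}(N-1)$ for $N\ge1$, $k\ge0$ (so $\nu_k(N)=0$ when no two-row diagram with $N$ boxes has $\lambda_1-\lambda_2=k$). -/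

import Mathlib

open scoped TensorProduct Kronecker DirectSum

noncomputable section

namespace TLDuality

/-- The data of the construction: an invertible matrix `b` and a nonzero complex number `q`
with `tr (bᵗ b⁻¹) = -(q + q⁻¹)`. -/
structure Datum (n : ℕ) where
  b : GL (Fin n) ℂ
  q : ℂˣ
  trace_eq : Matrix.trace ((b : Matrix (Fin n) (Fin n) ℂ).transpose *
    ((b⁻¹ : GL (Fin n) ℂ) : Matrix (Fin n) (Fin n) ℂ)) = -((q : ℂ) + (q : ℂ)⁻¹)

namespace Datum

variable {n : ℕ} (D : Datum n)

/-- The matrix `b`. -/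
abbrev B : Matrix (Fin n) (Fin n) ℂ := (D.b : Matrix (Fin n) (Fin n) ℂ)

/-- The matrix `b̄ = b⁻¹`. -/
abbrev Bi : Matrix (Fin n) (Fin n) ℂ := ((D.b⁻¹ : GL (Fin n) ℂ) : Matrix (Fin n) (Fin n) ℂ)

/-- The operator `X = |b⟩⟨b̄|` on `ℂⁿ ⊗ ℂⁿ`. -/
def X : Matrix (Fin n × Fin n) (Fin n × Fin n) ℂ :=
  Matrix.of fun r s => D.B r.1 r.2 * D.Bi s.1 s.2

/-- The constant R-matrix `Ř = q I + X`. -/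
def R : Matrix (Fin n × Fin n) (Fin n × Fin n) ℂ := (D.q : ℂ) • 1 + D.X

end Datum

/-- The two signs labelling the two L-operators `L⁺`, `L⁻`. -/
inductive Sgn
  | plus
  | minus

open Sgn

/-! ### The exchange relations -/

/-- The exchange relation `Ř₁₂ A₁ A'₂ = A'₁ A₂ Ř₁₂` for matrices `A`, `A'` with entries in an
algebra; here `A₁ A'₂` is the matrix with entries `A_{ax} A'_{cy}`. -/
def Exchange {n : ℕ} {S : Type*} [Semiring S] [Algebra ℂ S]
    (R : Matrix (Fin n × Fin n) (Fin n × Fin n) ℂ) (A A' : Matrix (Fin n) (Fin n) S) : Prop :=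
  R.map (algebraMap ℂ S) * (A ⊗ₖ A') = (A' ⊗ₖ A) * R.map (algebraMap ℂ S)

section Exchange

variable {n : ℕ} {S S' : Type*} [Semiring S] [Algebra ℂ S] [Semiring S'] [Algebra ℂ S']
  {R : Matrix (Fin n × Fin n) (Fin n × Fin n) ℂ}

theorem exchange_apply (A A' : Matrix (Fin n) (Fin n) S) (r s : Fin n × Fin n) :
    (R.map (algebraMap ℂ S) * (A ⊗ₖ A')) r s
      = ∑ e, ∑ f, R r (e, f) • (A e s.1 * A' f s.2) := by
  simp [Matrix.mul_apply, Fintype.sum_prod_type, Algebra.smul_def]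

theorem exchange_apply' (A A' : Matrix (Fin n) (Fin n) S) (r s : Fin n × Fin n) :
    ((A' ⊗ₖ A) * R.map (algebraMap ℂ S)) r s
      = ∑ e, ∑ f, R (e, f) s • (A' r.1 e * A r.2 f) := by
  simp [Matrix.mul_apply, Fintype.sum_prod_type, Algebra.smul_def, Algebra.commutes]

theorem Exchange.map (f : S →ₐ[ℂ] S') {A A' : Matrix (Fin n) (Fin n) S}
    (h : Exchange R A A') : Exchange R (A.map f) (A'.map f) := by
  ext r s
  have := congrArg f (congrFun (congrFun h r) s)
  rw [exchange_apply, exchange_apply'] at this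
  rw [exchange_apply, exchange_apply']
  simpa using this

theorem kronecker_mul_mul {S : Type*} [Semiring S] {P P' Q Q' : Matrix (Fin n) (Fin n) S}
    (h : ∀ i j k l, Commute (P i j) (Q' k l)) :
    (Q * P) ⊗ₖ (Q' * P') = (Q ⊗ₖ Q') * (P ⊗ₖ P') := by
  ext r s
  simp only [Matrix.mul_apply, Matrix.kroneckerMap_apply,
    Fintype.sum_prod_type, Finset.sum_mul_sum]
  refine Finset.sum_congr rfl fun e _ => Finset.sum_congr rfl fun f _ => ?_
  rw [mul_assoc, ← mul_assoc (P e s.1), (h _ _ _ _).eq]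
  simp only [mul_assoc]

/-- Exchange relations are multiplicative in commuting families. -/
theorem Exchange.mul {P P' Q Q' : Matrix (Fin n) (Fin n) S}
    (hP : Exchange R P P') (hQ : Exchange R Q Q')
    (h : ∀ i j k l, Commute (P i j) (Q' k l)) (h' : ∀ i j k l, Commute (P' i j) (Q k l)) :
    Exchange R (Q * P) (Q' * P') := by
  unfold Exchange at *
  rw [kronecker_mul_mul h, kronecker_mul_mul h', ← mul_assoc, hQ, mul_assoc, hP, mul_assoc]

theorem Exchange.one : Exchange R (1 : Matrix (Fin n) (Fin n) S) 1 := by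
  unfold Exchange
  rw [Matrix.kroneckerMap_one_one _ (by simp) (by simp) (by simp), one_mul, mul_one]

theorem Exchange.smul (c d : ℂ) {A A' : Matrix (Fin n) (Fin n) S}
    (h : Exchange R A A') : Exchange R (c • A) (d • A') := by
  unfold Exchange at *
  rw [Matrix.smul_kronecker, Matrix.kronecker_smul, Matrix.smul_kronecker,
    Matrix.kronecker_smul, Matrix.mul_smul, Matrix.mul_smul, Matrix.smul_mul, Matrix.smul_mul, h,
    smul_comm]

end Exchange

/-! ### The quantum algebra -/

section Uq

variable {n : ℕ} (D : Datum n)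

/-- The free algebra on the entries of `L⁺` and `L⁻`. -/
abbrev UqFree (n : ℕ) : Type := FreeAlgebra ℂ (Sgn × Fin n × Fin n)

/-- The generic L-matrices. -/
def genL (n : ℕ) (ε : Sgn) : Matrix (Fin n) (Fin n) (UqFree n) :=
  Matrix.of fun i j => FreeAlgebra.ι ℂ (ε, i, j)

/-- The defining relations, entry by entry: `Ř L⁺₁ L⁺₂ = L⁺₁ L⁺₂ Ř`, `Ř L⁻₁ L⁻₂ = L⁻₁ L⁻₂ Ř` and
`Ř L⁺₁ L⁻₂ = L⁻₁ L⁺₂ Ř`. -/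
inductive UqRel : UqFree n → UqFree n → Prop
  | same (ε : Sgn) (r s : Fin n × Fin n) :
      UqRel ((D.R.map (algebraMap ℂ (UqFree n)) * (genL n ε ⊗ₖ genL n ε)) r s)
        (((genL n ε ⊗ₖ genL n ε) * D.R.map (algebraMap ℂ (UqFree n))) r s)
  | mixed (r s : Fin n × Fin n) :
      UqRel ((D.R.map (algebraMap ℂ (UqFree n)) * (genL n plus ⊗ₖ genL n minus)) r s)
        (((genL n minus ⊗ₖ genL n plus) * D.R.map (algebraMap ℂ (UqFree n))) r s)

/-- The quantum algebra `U_q(n)` of the R-matrix `Ř`. -/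
abbrev Uq : Type := RingQuot (UqRel D)

/-- The L-operators of `U_q(n)`. -/
def Uq.L (ε : Sgn) : Matrix (Fin n) (Fin n) (Uq D) :=
  (genL n ε).map (RingQuot.mkAlgHom ℂ (UqRel D))

theorem Uq.exchange_same (ε : Sgn) : Exchange D.R (Uq.L D ε) (Uq.L D ε) := by
  ext r s
  have := RingQuot.mkAlgHom_rel ℂ (UqRel.same (D := D) ε r s)
  rw [exchange_apply, exchange_apply'] at this
  rw [exchange_apply, exchange_apply']
  simpa [Uq.L] using this

theorem Uq.exchange_mixed : Exchange D.R (Uq.L D plus) (Uq.L D minus) := by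
  ext r s
  have := RingQuot.mkAlgHom_rel ℂ (UqRel.mixed (D := D) r s)
  rw [exchange_apply, exchange_apply'] at this
  rw [exchange_apply, exchange_apply']
  simpa [Uq.L] using this

variable {D} {S : Type*} [Semiring S] [Algebra ℂ S]

/-- The homomorphism out of `U_q(n)` given by a pair of matrices with the exchange relations. -/
def Uq.lift (A : Sgn → Matrix (Fin n) (Fin n) S) (hs : ∀ ε, Exchange D.R (A ε) (A ε))
    (hm : Exchange D.R (A plus) (A minus)) : Uq D →ₐ[ℂ] S :=
  RingQuot.liftAlgHom ℂ ⟨FreeAlgebra.lift ℂ fun g => A g.1 g.2.1 g.2.2, by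
    intro x y h
    cases h with
    | same ε r s =>
      have := congrFun (congrFun (hs ε) r) s
      rw [exchange_apply, exchange_apply'] at this ⊢
      simpa [genL] using this
    | mixed r s =>
      have := congrFun (congrFun hm r) s
      rw [exchange_apply, exchange_apply'] at this ⊢
      simpa [genL] using this⟩

theorem Uq.lift_L (A : Sgn → Matrix (Fin n) (Fin n) S) (hs : ∀ ε, Exchange D.R (A ε) (A ε))
    (hm : Exchange D.R (A plus) (A minus)) (ε : Sgn) (i j : Fin n) :
    Uq.lift A hs hm (Uq.L D ε i j) = A ε i j := by
  simp [Uq.lift, Uq.L, genL]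

/-- `c` for `L⁺` and `c⁻¹` for `L⁻`. -/
def Sgn.pow (c : ℂˣ) : Sgn → ℂ
  | plus => (c : ℂ)
  | minus => ((c⁻¹ : ℂˣ) : ℂ)

variable (D) in
/-- The endomorphism `L⁺ ↦ c L⁺`, `L⁻ ↦ c⁻¹ L⁻` of `U_q(n)`. A module pulled back along it is
its tensor product with the one-dimensional module on which `L^±` acts as `c^±¹ I`. -/
def Uq.twist (c : ℂˣ) : Uq D →ₐ[ℂ] Uq D :=
  Uq.lift (fun ε => Sgn.pow c ε • Uq.L D ε)
    (fun ε => (Uq.exchange_same D ε).smul _ _) ((Uq.exchange_mixed D).smul _ _)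

end Uq

/-! ### The L-operators in the fundamental representation -/

section Fundamental

variable {n : ℕ} (D : Datum n)

theorem Datum.X_mul_X : D.X * D.X = (-((D.q : ℂ) + (D.q : ℂ)⁻¹)) • D.X := by
  ext r s
  have h : ∑ e, ∑ f, D.Bi e f * D.B e f = -((D.q : ℂ) + (D.q : ℂ)⁻¹) := by
    rw [← D.trace_eq, Matrix.trace, Finset.sum_comm]
    simp [Matrix.mul_apply, Matrix.transpose_apply, mul_comm]
  simp only [Matrix.mul_apply, Datum.X, Matrix.of_apply, Fintype.sum_prod_type,
    Matrix.smul_apply, smul_eq_mul]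
  rw [← h, Finset.sum_mul]
  refine Finset.sum_congr rfl fun e _ => ?_
  rw [Finset.sum_mul]
  exact Finset.sum_congr rfl fun f _ => by ring

theorem Datum.R_inv : D.R⁻¹ = (D.q : ℂ)⁻¹ • 1 + D.X := by
  refine Matrix.inv_eq_right_inv ?_
  have hq : (D.q : ℂ) ≠ 0 := D.q.ne_zero
  rw [Datum.R, add_mul, mul_add, mul_add, D.X_mul_X]
  simp only [Matrix.smul_mul, Matrix.mul_smul, one_mul, mul_one, smul_smul]
  rw [inv_mul_cancel₀ hq, one_smul, add_assoc, ← add_smul, ← add_smul]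
  simp

/-- The matrix `P M` on `V_a ⊗ V_q = ℂⁿ ⊗ ℂⁿ`, `P` the permutation matrix, written as a matrix
over `V_a` whose entries are operators on `V_q`: its entry at `(a, c), (x, y)` is
`M_{(c, a), (x, y)}`. -/
def permBlocks (M : Matrix (Fin n × Fin n) (Fin n × Fin n) ℂ) :
    Matrix (Fin n) (Fin n) (Matrix (Fin n) (Fin n) ℂ) :=
  Matrix.of fun a x => Matrix.of fun c y => M (c, a) (x, y)

/-- The L-operators in the fundamental representation `ℂⁿ`: `L⁺ = z P Ř` and `L⁻ = z⁻¹ P Ř⁻¹`,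
with `z` a choice of normalization. -/
def Datum.fundL (z : ℂˣ) : Sgn → Matrix (Fin n) (Fin n) (Matrix (Fin n) (Fin n) ℂ)
  | plus => (z : ℂ) • permBlocks D.R
  | minus => ((z⁻¹ : ℂˣ) : ℂ) • permBlocks D.R⁻¹

theorem Datum.B_Bi (i j : Fin n) : ∑ k, D.B i k * D.Bi k j = if i = j then 1 else 0 := by
  have h : D.B * D.Bi = 1 := by simp [Datum.B, Datum.Bi]
  have := congrFun (congrFun h i) j
  rwa [Matrix.mul_apply, Matrix.one_apply] at this

theorem Datum.Bi_B (i j : Fin n) : ∑ k, D.Bi i k * D.B k j = if i = j then 1 else 0 := by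
  have h : D.Bi * D.B = 1 := by simp [Datum.B, Datum.Bi]
  have := congrFun (congrFun h i) j
  rwa [Matrix.mul_apply, Matrix.one_apply] at this

theorem Datum.sum_Bi_B : ∑ e, ∑ f, D.Bi e f * D.B e f = -((D.q : ℂ) + (D.q : ℂ)⁻¹) := by
  rw [← D.trace_eq, Matrix.trace, Finset.sum_comm]
  simp [Matrix.mul_apply, Matrix.transpose_apply, mul_comm]

/-- Entry form of the L-operators of the fundamental representation, with a parameter. -/
def Datum.M (t : ℂ) : Matrix (Fin n) (Fin n) (Matrix (Fin n) (Fin n) ℂ) :=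
  Matrix.of fun a x => Matrix.of fun c y =>
    t * (if c = x then 1 else 0) * (if a = y then 1 else 0) + D.B c a * D.Bi x y

theorem Datum.permBlocks_eq (t : ℂ) : permBlocks (t • 1 + D.X) = D.M t := by
  ext a x c y
  by_cases h1 : c = x <;> by_cases h2 : a = y <;>
    simp [permBlocks, Datum.M, Datum.X, Matrix.one_apply, h1, h2]

theorem Datum.M_mul (s t : ℂ) (e x f y i k : Fin n) :
    (D.M s e x * D.M t f y) i k =
      s * t * (if i = x then 1 else 0) * (if e = y then 1 else 0) * (if f = k then 1 else 0)
      + s * (if i = x then 1 else 0) * D.B e f * D.Bi y k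
      + t * D.B i e * D.Bi x y * (if f = k then 1 else 0)
      + D.B i e * D.Bi y k * (if x = f then 1 else 0) := by
  have h := D.Bi_B x f
  rw [Matrix.mul_apply, ← h, Finset.mul_sum]
  have h1 : ∀ m, D.M s e x i m * D.M t f y m k =
      (if e = m then s * t * (if i = x then 1 else 0) * (if m = y then 1 else 0) *
        (if f = k then 1 else 0) else 0)
      + (if e = m then s * (if i = x then 1 else 0) * D.B m f * D.Bi y k else 0)
      + (if m = y then t * D.B i e * D.Bi x m * (if f = k then 1 else 0) else 0)
      + D.B i e * D.Bi y k * (D.Bi x m * D.B m f) := by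
    intro m
    simp only [Datum.M, Matrix.of_apply]
    split_ifs <;> ring
  simp only [h1, Finset.sum_add_distrib, Finset.sum_ite_eq, Finset.sum_ite_eq', Finset.mem_univ,
    if_true]

theorem Datum.sum_Bi_M (s t : ℂ) (x y i k : Fin n) :
    ∑ e, ∑ f, D.Bi e f * (D.M s e x * D.M t f y) i k =
      (s * t - s * ((D.q : ℂ) + (D.q : ℂ)⁻¹) + 1) * (if i = x then 1 else 0) * D.Bi y k
      + t * D.Bi x y * (if i = k then 1 else 0) := by
  have h1 : ∀ e f, D.Bi e f * (D.M s e x * D.M t f y) i k =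
      (if e = y then (if f = k then s * t * (if i = x then 1 else 0) * D.Bi e f else 0) else 0)
      + s * (if i = x then 1 else 0) * D.Bi y k * (D.Bi e f * D.B e f)
      + (if f = k then t * D.Bi x y * (D.B i e * D.Bi e f) else 0)
      + (if x = f then D.Bi y k * (D.B i e * D.Bi e f) else 0) := by
    intro e f
    rw [D.M_mul]
    split_ifs <;> ring
  have h2 : ∀ e, ∑ f, (if e = y then (if f = k then s * t * (if i = x then 1 else 0) * D.Bi e f
      else 0) else 0) = if e = y then s * t * (if i = x then 1 else 0) * D.Bi e k else 0 := by
    intro e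
    split_ifs <;> simp
  simp only [h1, Finset.sum_add_distrib, h2]
  simp only [Finset.sum_ite_eq, Finset.sum_ite_eq', Finset.mem_univ, if_true,
    ← Finset.mul_sum, D.sum_Bi_B, D.B_Bi]
  ring

theorem Datum.sum_B_M (s t : ℂ) (a c i k : Fin n) :
    ∑ e, ∑ f, D.B e f * (D.M s a e * D.M t c f) i k =
      (s * t - t * ((D.q : ℂ) + (D.q : ℂ)⁻¹) + 1) * D.B i a * (if c = k then 1 else 0)
      + s * D.B a c * (if i = k then 1 else 0) := by
  have h1 : ∀ e f, D.B e f * (D.M s a e * D.M t c f) i k =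
      (if i = e then (if a = f then s * t * (if c = k then 1 else 0) * D.B e f else 0) else 0)
      + (if i = e then s * D.B a c * (D.B e f * D.Bi f k) else 0)
      + t * D.B i a * (if c = k then 1 else 0) * (D.Bi e f * D.B e f)
      + (if e = c then D.B i a * (D.B e f * D.Bi f k) else 0) := by
    intro e f
    rw [D.M_mul]
    split_ifs <;> ring
  have h2 : ∀ e, ∑ f, (if i = e then (if a = f then s * t * (if c = k then 1 else 0) * D.B e f
      else 0) else 0) = if i = e then s * t * (if c = k then 1 else 0) * D.B e a else 0 := by
    intro e
    split_ifs <;> simp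
  have h3 : ∀ e, ∑ f, (if i = e then s * D.B a c * (D.B e f * D.Bi f k) else 0) =
      if i = e then s * D.B a c * (if e = k then 1 else 0) else 0 := by
    intro e
    by_cases h : i = e
    · simp only [if_pos h, ← Finset.mul_sum, D.B_Bi]
    · simp [h]
  have h4 : ∀ e, ∑ f, (if e = c then D.B i a * (D.B e f * D.Bi f k) else 0) =
      if e = c then D.B i a * (if e = k then 1 else 0) else 0 := by
    intro e
    by_cases h : e = c
    · simp only [if_pos h, ← Finset.mul_sum, D.B_Bi]
    · simp [h]
  simp only [h1, Finset.sum_add_distrib, h2, h3, h4]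
  simp only [Finset.sum_ite_eq, Finset.sum_ite_eq', Finset.mem_univ, if_true,
    ← Finset.mul_sum, D.sum_Bi_B]
  ring

theorem Datum.M_exchange {s t : ℂ}
    (h : s * t - (D.q : ℂ) * t - (D.q : ℂ)⁻¹ * s + 1 = 0) :
    Exchange D.R (D.M s) (D.M t) := by
  ext ⟨a, c⟩ ⟨x, y⟩ i k
  rw [exchange_apply, exchange_apply']
  simp only [Matrix.sum_apply, Matrix.smul_apply, smul_eq_mul]
  have hl : ∀ e f, D.R (a, c) (e, f) * (D.M s e x * D.M t f y) i k =
      (if a = e then (if c = f then (D.q : ℂ) * (D.M s e x * D.M t f y) i k else 0) else 0)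
      + D.B a c * (D.Bi e f * (D.M s e x * D.M t f y) i k) := by
    intro e f
    simp only [Datum.R, Datum.X, Matrix.add_apply, Matrix.smul_apply, Matrix.one_apply,
      Matrix.of_apply, Prod.mk.injEq, smul_eq_mul]
    by_cases h1 : a = e <;> by_cases h2 : c = f <;> simp [h1, h2] <;> ring
  have hr : ∀ e f, D.R (e, f) (x, y) * (D.M t a e * D.M s c f) i k =
      (if e = x then (if f = y then (D.q : ℂ) * (D.M t a e * D.M s c f) i k else 0) else 0)
      + D.Bi x y * (D.B e f * (D.M t a e * D.M s c f) i k) := by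
    intro e f
    simp only [Datum.R, Datum.X, Matrix.add_apply, Matrix.smul_apply, Matrix.one_apply,
      Matrix.of_apply, Prod.mk.injEq, smul_eq_mul]
    by_cases h1 : e = x <;> by_cases h2 : f = y <;> simp [h1, h2] <;> ring
  have hl' : ∑ e, ∑ f, (if a = e then (if c = f then (D.q : ℂ) * (D.M s e x * D.M t f y) i k
      else 0) else 0) = (D.q : ℂ) * (D.M s a x * D.M t c y) i k := by
    rw [Finset.sum_eq_single a, Finset.sum_eq_single c] <;> simp +contextual [eq_comm]
  have hr' : ∑ e, ∑ f, (if e = x then (if f = y then (D.q : ℂ) * (D.M t a e * D.M s c f) i k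
      else 0) else 0) = (D.q : ℂ) * (D.M t a x * D.M s c y) i k := by
    rw [Finset.sum_eq_single x, Finset.sum_eq_single y] <;> simp +contextual
  simp only [hl, hr, Finset.sum_add_distrib, ← Finset.mul_sum, hl', hr']
  rw [D.sum_Bi_M, D.sum_B_M, D.M_mul, D.M_mul]
  linear_combination (D.B a c * (if i = x then 1 else 0) * D.Bi y k
    - D.Bi x y * D.B i a * (if c = k then 1 else 0)) * h

theorem Datum.fundL_plus (z : ℂˣ) : D.fundL z plus = (z : ℂ) • D.M (D.q : ℂ) := by
  rw [← D.permBlocks_eq]; rfl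

theorem Datum.fundL_minus (z : ℂˣ) :
    D.fundL z minus = ((z⁻¹ : ℂˣ) : ℂ) • D.M (D.q : ℂ)⁻¹ := by
  rw [← D.permBlocks_eq, ← D.R_inv]; rfl

theorem Datum.fundL_same (z : ℂˣ) (ε : Sgn) : Exchange D.R (D.fundL z ε) (D.fundL z ε) := by
  have hq : (D.q : ℂ) ≠ 0 := D.q.ne_zero
  cases ε with
  | plus =>
    rw [D.fundL_plus]
    exact Exchange.smul _ _ (D.M_exchange (by field_simp; ring))
  | minus =>
    rw [D.fundL_minus]
    exact Exchange.smul _ _ (D.M_exchange (by field_simp; ring))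

theorem Datum.fundL_mixed (z : ℂˣ) : Exchange D.R (D.fundL z plus) (D.fundL z minus) := by
  have hq : (D.q : ℂ) ≠ 0 := D.q.ne_zero
  rw [D.fundL_plus, D.fundL_minus]
  exact Exchange.smul _ _ (D.M_exchange (by field_simp; ring))

end Fundamental

/-! ### The space `H = (ℂⁿ)^{⊗N}` and operators acting on some of its factors -/

section Space

variable (n N : ℕ)

/-- `H = (ℂⁿ)^{⊗N}`. -/
abbrev H : Type := ⨂[ℂ] _ : Fin N, (Fin n → ℂ)

variable {n N}

/-- The operator acting as `f` on the `l`-th factor and trivially on the others. -/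
def factorOp (l : Fin N) (f : Module.End ℂ (Fin n → ℂ)) : Module.End ℂ (H n N) :=
  PiTensorProduct.map (Function.update (fun _ => (1 : Module.End ℂ (Fin n → ℂ))) l f)

theorem factorOp_one (l : Fin N) : factorOp (n := n) l 1 = 1 := by
  rw [factorOp, Function.update_eq_self l (fun _ => (1 : Module.End ℂ (Fin n → ℂ)))]
  exact PiTensorProduct.map_one

theorem factorOp_mul (l : Fin N) (f g : Module.End ℂ (Fin n → ℂ)) :
    factorOp l (f * g) = factorOp l f * factorOp l g := by
  rw [factorOp, factorOp, factorOp, ← PiTensorProduct.map_mul]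
  congr 1
  funext i
  by_cases h : i = l
  · subst h; simp
  · simp [Function.update_of_ne h]

theorem factorOp_commute {l m : Fin N} (h : l ≠ m) (f g : Module.End ℂ (Fin n → ℂ)) :
    Commute (factorOp l f) (factorOp m g) := by
  rw [commute_iff_eq, factorOp, factorOp, ← PiTensorProduct.map_mul, ← PiTensorProduct.map_mul]
  congr 1
  funext i
  by_cases h1 : i = l
  · subst h1; simp [Function.update_of_ne h]
  · by_cases h2 : i = m
    · subst h2; simp [Function.update_of_ne h1]
    · simp [Function.update_of_ne h1, Function.update_of_ne h2]

theorem factorOp_add (l : Fin N) (f g : Module.End ℂ (Fin n → ℂ)) :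
    factorOp l (f + g) = factorOp l f + factorOp l g := by
  unfold factorOp
  rw [PiTensorProduct.map_update_add]

theorem factorOp_smul (l : Fin N) (c : ℂ) (f : Module.End ℂ (Fin n → ℂ)) :
    factorOp l (c • f) = c • factorOp l f := by
  unfold factorOp
  rw [PiTensorProduct.map_update_smul]

/-- `factorOp` as a linear map. -/
def factorLin (l : Fin N) : Module.End ℂ (Fin n → ℂ) →ₗ[ℂ] Module.End ℂ (H n N) where
  toFun := factorOp l
  map_add' := factorOp_add l
  map_smul' := factorOp_smul l

/-- The operator acting as the matrix `A` on the `l`-th factor and trivially on the others. -/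
def site (l : Fin N) : Matrix (Fin n) (Fin n) ℂ →ₐ[ℂ] Module.End ℂ (H n N) :=
  (AlgHom.ofLinearMap (factorLin l) (factorOp_one l) (factorOp_mul l)).comp
    (Matrix.toLinAlgEquiv' : Matrix (Fin n) (Fin n) ℂ ≃ₐ[ℂ] _).toAlgHom

theorem site_commute {l m : Fin N} (h : l ≠ m) (A A' : Matrix (Fin n) (Fin n) ℂ) :
    Commute (site l A) (site m A') :=
  factorOp_commute h _ _

/-- The operator acting as the matrix `M` on the tensor product of the `l`-th and the `m`-th
factor and trivially on the others. -/
def twoSite (l m : Fin N) (M : Matrix (Fin n × Fin n) (Fin n × Fin n) ℂ) :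
    Module.End ℂ (H n N) :=
  ∑ c, ∑ d, ∑ x, ∑ y, M (c, d) (x, y) •
    (site l (Matrix.single c x 1) * site m (Matrix.single d y 1))

end Space

/-! ### The action of the quantum algebra on `H` -/

section Action

variable {n : ℕ} (D : Datum n) (z : ℂˣ) (N : ℕ)

/-- The L-operator acting in the `l`-th factor of `H`. -/
def Datum.siteL (ε : Sgn) (l : Fin N) : Matrix (Fin n) (Fin n) (Module.End ℂ (H n N)) :=
  (D.fundL z ε).map (site l)

/-- The product `T = L_{aq_N} ⋯ L_{aq_2} L_{aq_1}`, a matrix with entries in `End H`. -/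
def Datum.T (ε : Sgn) : Matrix (Fin n) (Fin n) (Module.End ℂ (H n N)) :=
  (List.ofFn fun l : Fin N => D.siteL z N ε l).reverse.prod

theorem Datum.siteL_commute {ε δ : Sgn} {l m : Fin N} (h : l ≠ m) (i j k p : Fin n) :
    Commute (D.siteL z N ε l i j) (D.siteL z N δ m k p) :=
  site_commute h _ _

theorem commute_list_prod {n : ℕ} {ι S : Type*} [Semiring S]
    (A : ι → Matrix (Fin n) (Fin n) S) (s : S) (t : List ι)
    (h : ∀ l ∈ t, ∀ i j, Commute s (A l i j)) (i j : Fin n) :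
    Commute s ((t.map A).prod i j) := by
  induction t generalizing i j with
  | nil =>
    by_cases hij : i = j
    · subst hij; simp
    · simp [hij]
  | cons l t ih =>
    rw [List.map_cons, List.prod_cons, Matrix.mul_apply]
    refine Commute.sum_right _ _ _ fun k _ => ?_
    exact (h l (by simp) i k).mul_right (ih (fun m hm => h m (by simp [hm])) k j)

theorem exchange_list_prod {n : ℕ} {ι S : Type*} [Semiring S] [Algebra ℂ S]
    {R : Matrix (Fin n × Fin n) (Fin n × Fin n) ℂ} (A A' : ι → Matrix (Fin n) (Fin n) S)
    (hA : ∀ l, Exchange R (A l) (A' l))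
    (hc : ∀ l m, l ≠ m → ∀ i j k p, Commute (A l i j) (A' m k p))
    (t : List ι) (ht : t.Nodup) : Exchange R (t.map A).prod (t.map A').prod := by
  induction t with
  | nil => simpa using Exchange.one
  | cons l t ih =>
    rw [List.nodup_cons] at ht
    rw [List.map_cons, List.prod_cons, List.map_cons, List.prod_cons]
    have hne : ∀ m ∈ t, m ≠ l := fun m hm h => ht.1 (h ▸ hm)
    refine Exchange.mul (ih ht.2) (hA l) (fun i j k p => ?_) (fun i j k p => ?_)
    · exact (commute_list_prod A _ t (fun m hm a c => (hc m l (hne m hm) a c k p).symm) i j).symm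
    · exact (commute_list_prod A' _ t
        (fun m hm a c => hc l m (hne m hm).symm k p a c) i j).symm

theorem Datum.T_eq (ε : Sgn) :
    D.T z N ε = ((List.finRange N).reverse.map (D.siteL z N ε)).prod := by
  rw [Datum.T, List.ofFn_eq_map, List.map_reverse]

theorem Datum.siteL_same (ε : Sgn) (l : Fin N) :
    Exchange D.R (D.siteL z N ε l) (D.siteL z N ε l) :=
  (D.fundL_same z ε).map (site l)

theorem Datum.siteL_mixed (l : Fin N) :
    Exchange D.R (D.siteL z N plus l) (D.siteL z N minus l) :=
  (D.fundL_mixed z).map (site l)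

theorem Datum.T_same (ε : Sgn) : Exchange D.R (D.T z N ε) (D.T z N ε) := by
  rw [D.T_eq]
  exact exchange_list_prod _ _ (D.siteL_same z N ε)
    (fun l m h i j k p => D.siteL_commute z N h i j k p) _
    (List.nodup_reverse.2 (List.nodup_finRange N))

theorem Datum.T_mixed : Exchange D.R (D.T z N plus) (D.T z N minus) := by
  rw [D.T_eq, D.T_eq]
  exact exchange_list_prod _ _ (D.siteL_mixed z N)
    (fun l m h i j k p => D.siteL_commute z N h i j k p) _
    (List.nodup_reverse.2 (List.nodup_finRange N))

/-- The diagonal action of `U_q(n)` on `H`, through the iterated coproduct: the generators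
`L^±_{ij}` act as the entries of `T = L_{aq_N} ⋯ L_{aq_1}`. -/
def rho : Uq D →ₐ[ℂ] Module.End ℂ (H n N) :=
  Uq.lift (D.T z N) (D.T_same z N) (D.T_mixed z N)

end Action

/-! ### The Temperley–Lieb algebra and its action on `H` -/

section TL

/-- The defining relations of `TL_N(q)` on the generators `X_1, …, X_{N-1}`. -/
inductive TLRel (N : ℕ) (q : ℂˣ) :
    FreeAlgebra ℂ (Fin (N - 1)) → FreeAlgebra ℂ (Fin (N - 1)) → Prop
  | sq (j : Fin (N - 1)) : TLRel N q (FreeAlgebra.ι ℂ j * FreeAlgebra.ι ℂ j)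
      ((-((q : ℂ) + (q : ℂ)⁻¹)) • FreeAlgebra.ι ℂ j)
  | adj (j k : Fin (N - 1)) (h : (j : ℕ) + 1 = k ∨ (k : ℕ) + 1 = j) :
      TLRel N q (FreeAlgebra.ι ℂ j * FreeAlgebra.ι ℂ k * FreeAlgebra.ι ℂ j) (FreeAlgebra.ι ℂ j)
  | far (j k : Fin (N - 1)) (h : (j : ℕ) + 1 < k ∨ (k : ℕ) + 1 < j) :
      TLRel N q (FreeAlgebra.ι ℂ j * FreeAlgebra.ι ℂ k) (FreeAlgebra.ι ℂ k * FreeAlgebra.ι ℂ j)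

/-- The Temperley–Lieb algebra `TL_N(q)`. -/
abbrev TL (N : ℕ) (q : ℂˣ) : Type := RingQuot (TLRel N q)

/-- The generators of `TL_N(q)`. -/
def TL.gen {N : ℕ} {q : ℂˣ} (j : Fin (N - 1)) : TL N q :=
  RingQuot.mkAlgHom ℂ (TLRel N q) (FreeAlgebra.ι ℂ j)

variable {n : ℕ} (D : Datum n) (N : ℕ)

/-- The operator `X_j = |b⟩⟨b̄|` on the factors `j`, `j + 1` of `H`. -/
def Datum.tlX (j : Fin (N - 1)) : Module.End ℂ (H n N) :=
  twoSite ⟨j, by omega⟩ ⟨j + 1, by omega⟩ D.X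

variable {N}

theorem single_mul (i j k l : Fin n) : Matrix.single i j (1 : ℂ) * Matrix.single k l (1 : ℂ) =
    if j = k then Matrix.single i l 1 else 0 := by
  split_ifs with h
  · subst h; simp
  · exact Matrix.single_mul_single_of_ne _ _ _ _ h _

/-- The two expansions of `X` used to check the Temperley–Lieb relations. -/
theorem Datum.twoSite_X (l m : Fin N) : twoSite l m D.X =
    ∑ c, ∑ x, site l (Matrix.single c x 1) *
      site m (D.B.transpose * Matrix.single c x 1 * D.Bi) := by
  unfold twoSite
  have key : ∀ c x, D.B.transpose * Matrix.single c x 1 * D.Bi =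
      ∑ d, ∑ y, (D.B c d * D.Bi x y) • Matrix.single d y (1 : ℂ) := by
    intro c x
    ext i k
    simp [Matrix.sum_apply, Matrix.mul_apply, Matrix.single_apply, Matrix.transpose_apply,
      Finset.sum_ite_eq, ite_and]
  simp only [key, map_sum, map_smul, Finset.mul_sum, mul_smul_comm]
  refine Finset.sum_congr rfl fun c _ => ?_
  rw [Finset.sum_comm]
  rfl

theorem Datum.twoSite_X' (l m : Fin N) : twoSite l m D.X =
    ∑ d, ∑ y, site l (D.B * Matrix.single d y 1 * D.Bi.transpose) *
      site m (Matrix.single d y 1) := by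
  unfold twoSite
  have key : ∀ d y, D.B * Matrix.single d y 1 * D.Bi.transpose =
      ∑ c, ∑ x, (D.B c d * D.Bi x y) • Matrix.single c x (1 : ℂ) := by
    intro d y
    ext i k
    simp [Matrix.sum_apply, Matrix.mul_apply, Matrix.single_apply, Matrix.transpose_apply,
      Finset.sum_ite_eq, ite_and]
  simp only [key, map_sum, map_smul, Finset.sum_mul, smul_mul_assoc]
  rw [Finset.sum_comm]
  refine Finset.sum_congr rfl fun d _ => ?_
  rw [Finset.sum_congr rfl fun c _ => Finset.sum_comm, Finset.sum_comm]
  rfl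

theorem Datum.twoSite_sq (l m : Fin N) (h : l ≠ m) :
    twoSite l m D.X * twoSite l m D.X =
      (-((D.q : ℂ) + (D.q : ℂ)⁻¹)) • twoSite l m D.X := by
  obtain ⟨g, hg⟩ : ∃ g : Fin n → ℂ, ∀ x, g x = (D.Bi * D.B.transpose) x x := ⟨_, fun _ => rfl⟩
  have ht : ∑ x, g x = -((D.q : ℂ) + (D.q : ℂ)⁻¹) := by
    rw [← D.trace_eq, Matrix.trace_mul_comm]; exact Finset.sum_congr rfl fun x _ => hg x
  have key : ∀ c x c' x' : Fin n,
      (site l (Matrix.single c x 1) * site m (D.B.transpose * Matrix.single c x 1 * D.Bi)) *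
      (site l (Matrix.single c' x' 1) * site m (D.B.transpose * Matrix.single c' x' 1 * D.Bi)) =
      if x = c' then g x • (site l (Matrix.single c x' 1) *
        site m (D.B.transpose * Matrix.single c x' 1 * D.Bi)) else 0 := by
    intro c x c' x'
    rw [(site_commute h.symm _ _).mul_mul_mul_comm, ← map_mul, ← map_mul]
    split_ifs with hx
    · subst hx
      have e : D.B.transpose * Matrix.single c x 1 * D.Bi *
          (D.B.transpose * Matrix.single x x' 1 * D.Bi) =
          g x • (D.B.transpose * Matrix.single c x' 1 * D.Bi) := by
        have e1 : Matrix.single c x 1 * (D.Bi * D.B.transpose) * Matrix.single x x' 1 =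
            g x • Matrix.single c x' (1 : ℂ) := by
          rw [Matrix.single_mul_mul_single, hg]; simp
        rw [← Matrix.smul_mul, ← Matrix.mul_smul, ← e1]
        simp only [Matrix.mul_assoc]
      rw [e, map_smul, mul_smul_comm, Matrix.single_mul_single_same, one_mul]
    · rw [single_mul, if_neg hx, map_zero, zero_mul]
  rw [D.twoSite_X]
  simp only [Finset.sum_mul]
  simp only [Finset.mul_sum, key]
  rw [Finset.smul_sum]
  refine Finset.sum_congr rfl fun c _ => ?_
  have h3 : ∀ x, ∑ c', ∑ x', (if x = c' then g x •
      (site l (Matrix.single c x' 1) * site m (D.B.transpose * Matrix.single c x' 1 * D.Bi))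
      else 0) = g x • ∑ x', (site l (Matrix.single c x' 1) *
        site m (D.B.transpose * Matrix.single c x' 1 * D.Bi)) := by
    intro x
    rw [Finset.sum_comm, Finset.smul_sum]
    refine Finset.sum_congr rfl fun x' _ => ?_
    rw [Finset.sum_ite_eq, if_pos (Finset.mem_univ _)]
  rw [Finset.sum_congr rfl fun x _ => h3 x, ← Finset.sum_smul, ht]

theorem Datum.adj_mid (c x d y c' x' : Fin n) :
    (D.B.transpose * Matrix.single c x 1 * D.Bi) *
      (D.B * Matrix.single d y 1 * D.Bi.transpose) *
      (D.B.transpose * Matrix.single c' x' 1 * D.Bi) =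
    if x = d then (if y = c' then D.B.transpose * Matrix.single c x' 1 * D.Bi else 0) else 0 := by
  have h1 : D.Bi * D.B = 1 := by simp [Datum.B, Datum.Bi]
  have h2 : D.Bi.transpose * D.B.transpose = 1 := by
    rw [← Matrix.transpose_mul]; simp [Datum.B, Datum.Bi]
  have e : (D.B.transpose * Matrix.single c x 1 * D.Bi) *
      (D.B * Matrix.single d y 1 * D.Bi.transpose) *
      (D.B.transpose * Matrix.single c' x' 1 * D.Bi) =
      D.B.transpose * (Matrix.single c x 1 * (D.Bi * D.B) * Matrix.single d y 1 *
        (D.Bi.transpose * D.B.transpose) * Matrix.single c' x' 1) * D.Bi := by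
    simp only [Matrix.mul_assoc]
  rw [e, h1, h2, Matrix.mul_one, Matrix.mul_one]
  rw [single_mul]
  split_ifs with hx hy
  · rw [single_mul, if_pos hy]
  · rw [single_mul, if_neg hy]; simp
  · simp

theorem Datum.adj_mid' (c x d y c' x' : Fin n) :
    (D.B * Matrix.single c x 1 * D.Bi.transpose) *
      (D.B.transpose * Matrix.single d y 1 * D.Bi) *
      (D.B * Matrix.single c' x' 1 * D.Bi.transpose) =
    if x = d then (if y = c' then D.B * Matrix.single c x' 1 * D.Bi.transpose else 0) else 0 := by
  have h1 : D.Bi * D.B = 1 := by simp [Datum.B, Datum.Bi]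
  have h2 : D.Bi.transpose * D.B.transpose = 1 := by
    rw [← Matrix.transpose_mul]; simp [Datum.B, Datum.Bi]
  have e : (D.B * Matrix.single c x 1 * D.Bi.transpose) *
      (D.B.transpose * Matrix.single d y 1 * D.Bi) *
      (D.B * Matrix.single c' x' 1 * D.Bi.transpose) =
      D.B * (Matrix.single c x 1 * (D.Bi.transpose * D.B.transpose) * Matrix.single d y 1 *
        (D.Bi * D.B) * Matrix.single c' x' 1) * D.Bi.transpose := by
    simp only [Matrix.mul_assoc]
  rw [e, h1, h2, Matrix.mul_one, Matrix.mul_one]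
  rw [single_mul]
  split_ifs with hx hy
  · rw [single_mul, if_pos hy]
  · rw [single_mul, if_neg hy]; simp
  · simp

theorem sum_single_one : ∑ x : Fin n, Matrix.single x x (1 : ℂ) = 1 := by
  ext i k
  simp [Matrix.sum_apply, Matrix.single_apply, Matrix.one_apply, ite_and]

theorem Datum.twoSite_adj (l m k : Fin N) (h : l ≠ m) (h' : m ≠ k) (h'' : l ≠ k) :
    twoSite l m D.X * twoSite m k D.X * twoSite l m D.X = twoSite l m D.X := by
  have key : ∀ c x d y c' x' : Fin n,
      (site l (Matrix.single c x 1) * site m (D.B.transpose * Matrix.single c x 1 * D.Bi)) *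
      (site m (D.B * Matrix.single d y 1 * D.Bi.transpose) * site k (Matrix.single d y 1)) *
      (site l (Matrix.single c' x' 1) * site m (D.B.transpose * Matrix.single c' x' 1 * D.Bi)) =
      if y = c' then (if x = d then (if x = c' then (site l (Matrix.single c x' 1) *
        site m (D.B.transpose * Matrix.single c x' 1 * D.Bi)) * site k (Matrix.single x x 1)
        else 0) else 0) else 0 := by
    intro c x d y c' x'
    have e : ∀ A A' P P' P'' Q,
        (site l A * site m P) * (site m P' * site k Q) * (site l A' * site m P'') =
        (site l (A * A') * site m (P * P' * P'')) * (site k Q : Module.End ℂ (H n N)) := by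
      intro A A' P P' P'' Q
      simp only [map_mul]
      simp only [mul_assoc]
      rw [(site_commute h''.symm Q A').left_comm, (site_commute h'.symm Q P'').eq,
        (site_commute h.symm P' A').left_comm, (site_commute h.symm P A').left_comm]
    rw [e, D.adj_mid, single_mul]
    split_ifs <;> first | (subst_vars; rfl) | simp
  have hs : (site k (1 : Matrix (Fin n) (Fin n) ℂ) : Module.End ℂ (H n N)) = 1 := map_one _
  rw [D.twoSite_X l m, D.twoSite_X' m k]
  simp only [Finset.sum_mul]
  simp only [Finset.mul_sum, Finset.sum_mul, key]
  simp only [Finset.sum_ite_eq, Finset.sum_ite_eq', Finset.mem_univ, if_true]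
  refine Finset.sum_congr rfl fun c _ => ?_
  rw [Finset.sum_congr rfl fun x _ => Finset.sum_comm]
  simp only [Finset.sum_ite_eq, Finset.mem_univ, if_true]
  rw [Finset.sum_comm]
  refine Finset.sum_congr rfl fun x' _ => ?_
  rw [← Finset.mul_sum, ← map_sum, sum_single_one, hs, mul_one]

theorem Datum.twoSite_adj' (l m k : Fin N) (h : l ≠ m) (h' : m ≠ k) (h'' : l ≠ k) :
    twoSite m k D.X * twoSite l m D.X * twoSite m k D.X = twoSite m k D.X := by
  have key : ∀ c x d y c' x' : Fin n,
      (site m (D.B * Matrix.single c x 1 * D.Bi.transpose) * site k (Matrix.single c x 1)) *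
      (site l (Matrix.single d y 1) * site m (D.B.transpose * Matrix.single d y 1 * D.Bi)) *
      (site m (D.B * Matrix.single c' x' 1 * D.Bi.transpose) * site k (Matrix.single c' x' 1)) =
      if y = c' then (if x = d then (if x = c' then site l (Matrix.single x x 1) *
        (site m (D.B * Matrix.single c x' 1 * D.Bi.transpose) * site k (Matrix.single c x' 1))
        else 0) else 0) else 0 := by
    intro c x d y c' x'
    have e : ∀ A A' P P' P'' Q,
        (site m P * site k A) * (site l Q * site m P') * (site m P'' * site k A') =
        (site l Q : Module.End ℂ (H n N)) * (site m (P * P' * P'') * site k (A * A')) := by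
      intro A A' P P' P'' Q
      simp only [map_mul]
      simp only [mul_assoc]
      rw [(site_commute h''.symm A Q).left_comm, (site_commute h.symm P Q).left_comm,
        (site_commute h'.symm A P').left_comm, (site_commute h'.symm A P'').left_comm]
    rw [e, D.adj_mid', single_mul]
    split_ifs <;> first | (subst_vars; rfl) | simp
  have hs : (site l (1 : Matrix (Fin n) (Fin n) ℂ) : Module.End ℂ (H n N)) = 1 := map_one _
  rw [D.twoSite_X l m, D.twoSite_X' m k]
  simp only [Finset.sum_mul]
  simp only [Finset.mul_sum, Finset.sum_mul, key]
  simp only [Finset.sum_ite_eq, Finset.sum_ite_eq', Finset.mem_univ, if_true]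
  refine Finset.sum_congr rfl fun c _ => ?_
  rw [Finset.sum_congr rfl fun x _ => Finset.sum_comm]
  simp only [Finset.sum_ite_eq, Finset.mem_univ, if_true]
  rw [Finset.sum_comm]
  refine Finset.sum_congr rfl fun x' _ => ?_
  rw [← Finset.sum_mul, ← map_sum, sum_single_one, hs, one_mul]

theorem twoSite_commute {l m l' m' : Fin N} (h1 : l ≠ l') (h2 : l ≠ m') (h3 : m ≠ l')
    (h4 : m ≠ m') (M M' : Matrix (Fin n × Fin n) (Fin n × Fin n) ℂ) :
    Commute (twoSite l m M) (twoSite l' m' M') := by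
  unfold twoSite
  refine Commute.sum_left _ _ _ fun c _ => Commute.sum_left _ _ _ fun d _ =>
    Commute.sum_left _ _ _ fun x _ => Commute.sum_left _ _ _ fun y _ =>
    Commute.sum_right _ _ _ fun c' _ => Commute.sum_right _ _ _ fun d' _ =>
    Commute.sum_right _ _ _ fun x' _ => Commute.sum_right _ _ _ fun y' _ => ?_
  refine Commute.smul_left (Commute.smul_right ?_ _) _
  exact ((site_commute h1 _ _).mul_right (site_commute h2 _ _)).mul_left
    ((site_commute h3 _ _).mul_right (site_commute h4 _ _))

variable (N)

/-- The representation of `TL_N(q)` on `H`, `X_j ↦ |b⟩⟨b̄|` on the factors `j`, `j + 1`. -/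
def tlRep : TL N D.q →ₐ[ℂ] Module.End ℂ (H n N) :=
  RingQuot.liftAlgHom ℂ ⟨FreeAlgebra.lift ℂ (D.tlX N), by
    intro x y h
    cases h with
    | sq j =>
      simp only [map_mul, map_smul, FreeAlgebra.lift_ι_apply]
      exact D.twoSite_sq _ _ (by simp)
    | adj j k h =>
      simp only [map_mul, FreeAlgebra.lift_ι_apply]
      rcases h with h | h
      · have e : (⟨k, by omega⟩ : Fin N) = ⟨j + 1, by omega⟩ := Fin.ext h.symm
        unfold Datum.tlX
        rw [e]
        exact D.twoSite_adj _ _ _ (by simp) (by simp; omega) (by simp; omega)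
      · have e : (⟨j, by omega⟩ : Fin N) = ⟨k + 1, by omega⟩ := Fin.ext h.symm
        unfold Datum.tlX
        rw [e]
        exact D.twoSite_adj' _ _ _ (by simp) (by simp; omega) (by simp; omega)
    | far j k h =>
      simp only [map_mul, FreeAlgebra.lift_ι_apply]
      refine twoSite_commute ?_ ?_ ?_ ?_ _ _ <;> simp [Fin.ext_iff] <;> omega⟩

end TL

/-! ### Representations, two-row diagrams -/

section Reps

/-- A representation of an algebra on `M` is irreducible when `M ≠ 0` and the only invariant
subspaces are `0` and `M`. -/
def IsIrrep {A M : Type*} [Semiring A] [Algebra ℂ A] [AddCommMonoid M] [Module ℂ M]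
    (σ : A →ₐ[ℂ] Module.End ℂ M) : Prop :=
  Nontrivial M ∧
    ∀ S : Submodule ℂ M, (∀ a : A, ∀ m ∈ S, σ a m ∈ S) → S = ⊥ ∨ S = ⊤

/-- Isomorphism of two representations of the same algebra. -/
def RepIso {A M M' : Type*} [Semiring A] [Algebra ℂ A] [AddCommMonoid M] [Module ℂ M]
    [AddCommMonoid M'] [Module ℂ M'] (σ : A →ₐ[ℂ] Module.End ℂ M)
    (τ : A →ₐ[ℂ] Module.End ℂ M') : Prop :=
  ∃ e : M ≃ₗ[ℂ] M', ∀ (a : A) (m : M), e (σ a m) = τ a (e m)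

/-- A Young diagram with `N` boxes and at most two rows, of lengths `row1 ≥ row2`. -/
@[ext] structure TwoRow (N : ℕ) where
  row1 : ℕ
  row2 : ℕ
  le : row2 ≤ row1
  sum_eq : row1 + row2 = N

/-- The index `k = row1 - row2` of a two-row diagram. -/
def TwoRow.k {N : ℕ} (l : TwoRow N) : ℕ := l.row1 - l.row2

end Reps

end TLDuality

end

noncomputable section

namespace TLDuality
open Sgn

/-! ### Operators on spaces of `M`-valued tuples -/

section Amp

variable {M M' M'' : Type*} [AddCommGroup M] [Module ℂ M] [AddCommGroup M'] [Module ℂ M']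
  [AddCommGroup M''] [Module ℂ M'']

/-- The operator `f ⊗ 1` on `M ⊗ ℂⁿ`, realised as `Fin n → M`. -/
def amp (n : ℕ) (f : M →ₗ[ℂ] M') : (Fin n → M) →ₗ[ℂ] (Fin n → M') := f.compLeft (Fin n)

variable {n : ℕ}

@[simp] theorem amp_apply (f : M →ₗ[ℂ] M') (v : Fin n → M) (c : Fin n) :
    amp n f v c = f (v c) := rfl

theorem amp_sum {ι : Type*} (s : Finset ι) (f : ι → (M →ₗ[ℂ] M')) :
    amp n (∑ i ∈ s, f i) = ∑ i ∈ s, amp n (f i) := by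
  ext v c
  simp [LinearMap.sum_apply]

/-- Ampliation as an algebra homomorphism. -/
def ampHom (n : ℕ) (M : Type*) [AddCommGroup M] [Module ℂ M] :
    Module.End ℂ M →ₐ[ℂ] Module.End ℂ (Fin n → M) :=
  AlgHom.ofLinearMap { toFun := amp n, map_add' := fun _ _ => rfl, map_smul' := fun _ _ => rfl }
    rfl (fun _ _ => rfl)

theorem trace_amp [Module.Finite ℂ M] (f : M →ₗ[ℂ] M) :
    LinearMap.trace ℂ (Fin n → M) (amp n f) = n * LinearMap.trace ℂ M f := by
  have h : amp n f = ∑ c : Fin n, (LinearMap.single ℂ (fun _ : Fin n => M) c) ∘ₗ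
      (f ∘ₗ LinearMap.proj c) := by
    refine LinearMap.ext fun v => ?_
    funext d
    simp [LinearMap.sum_apply, Finset.sum_apply, Pi.single_apply]
  rw [h, map_sum, Finset.sum_congr rfl fun c _ => LinearMap.trace_comp_comm' _ _]
  have h2 : ∀ c : Fin n, (f ∘ₗ LinearMap.proj c) ∘ₗ
      (LinearMap.single ℂ (fun _ : Fin n => M) c) = f := by
    intro c; ext v; simp
  simp [h2]

end Amp

/-! ### Cups, caps and the coproduct step -/

section CupCap

variable {n : ℕ} (D : Datum n)
variable {M M' : Type*} [AddCommGroup M] [Module ℂ M] [AddCommGroup M'] [Module ℂ M']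

/-- The loop value `-(q + q⁻¹)`. -/
def Datum.loop : ℂ := -((D.q : ℂ) + (D.q : ℂ)⁻¹)

variable (M) in
/-- Insertion of `b` in two new last factors. -/
def Datum.cup : M →ₗ[ℂ] (Fin n → Fin n → M) :=
  LinearMap.pi fun d => LinearMap.pi fun c => D.B c d • LinearMap.id

variable (M) in
/-- Contraction of the last two factors with `b̄`. -/
def Datum.cap : (Fin n → Fin n → M) →ₗ[ℂ] M :=
  ∑ x, ∑ y, D.Bi x y •
    ((LinearMap.proj x : (Fin n → M) →ₗ[ℂ] M) ∘ₗ
      (LinearMap.proj y : (Fin n → Fin n → M) →ₗ[ℂ] (Fin n → M)))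

@[simp] theorem Datum.cup_apply (m : M) (d c : Fin n) : D.cup M m d c = D.B c d • m := rfl

theorem Datum.cap_apply (v : Fin n → Fin n → M) :
    D.cap M v = ∑ x, ∑ y, D.Bi x y • v y x := by
  simp [Datum.cap, LinearMap.sum_apply]

theorem Datum.cup_amp (f : M →ₗ[ℂ] M') :
    D.cup M' ∘ₗ f = amp n (amp n f) ∘ₗ D.cup M := by
  ext m d c; simp

theorem Datum.cap_amp (f : M →ₗ[ℂ] M') :
    D.cap M' ∘ₗ amp n (amp n f) = f ∘ₗ D.cap M := by
  refine LinearMap.ext fun v => ?_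
  simp [Datum.cap_apply]

theorem Datum.cap_cup : D.cap M ∘ₗ D.cup M = D.loop • LinearMap.id := by
  refine LinearMap.ext fun m => ?_
  simp only [LinearMap.comp_apply, D.cap_apply, D.cup_apply, smul_smul, ← Finset.sum_smul,
    D.sum_Bi_B]
  rfl

theorem Datum.cap_amp_cup : D.cap (Fin n → M) ∘ₗ amp n (D.cup M) = LinearMap.id := by
  refine LinearMap.ext fun v => ?_
  funext e
  have h : ∀ y, ∑ x, (D.Bi x y * D.B e x) • v y = (if e = y then 1 else 0 : ℂ) • v y := by
    intro y
    rw [← Finset.sum_smul, ← D.B_Bi e y]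
    simp only [mul_comm]
  simp only [LinearMap.comp_apply, D.cap_apply, Finset.sum_apply, Pi.smul_apply, amp_apply,
    D.cup_apply, smul_smul]
  rw [Finset.sum_comm, Finset.sum_congr rfl fun y _ => h y]
  simp

theorem Datum.amp_cap_cup : amp n (D.cap M) ∘ₗ D.cup (Fin n → M) = LinearMap.id := by
  refine LinearMap.ext fun v => ?_
  funext c
  have h : ∀ x, ∑ y, (D.Bi x y * D.B y c) • v x = (if x = c then 1 else 0 : ℂ) • v x := by
    intro y
    rw [← Finset.sum_smul, ← D.Bi_B y c]
  simp only [LinearMap.comp_apply, D.cap_apply, Pi.smul_apply, amp_apply,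
    D.cup_apply, smul_smul, h]
  simp

/-- A pair of matrices of operators on `M`, as given by an action of `L^±`. -/
abbrev LMat (n : ℕ) (M : Type*) [AddCommGroup M] [Module ℂ M] : Type _ :=
  Sgn → Fin n → Fin n → Module.End ℂ M

/-- `f` carries the operators `c^±¹ A` to the operators `A'`. -/
def Intertw (c : ℂˣ) (A : LMat n M) (A' : LMat n M') (f : M →ₗ[ℂ] M') : Prop :=
  ∀ ε i j m, A' ε i j (f m) = Sgn.pow c ε • f (A ε i j m)

theorem Sgn.pow_ne_zero (c : ℂˣ) (ε : Sgn) : Sgn.pow c ε ≠ 0 := by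
  cases ε <;> exact Units.ne_zero _

theorem Sgn.pow_mul (c d : ℂˣ) (ε : Sgn) : Sgn.pow (c * d) ε = Sgn.pow c ε * Sgn.pow d ε := by
  cases ε <;> simp [Sgn.pow, mul_comm]

@[simp] theorem Sgn.pow_one (ε : Sgn) : Sgn.pow 1 ε = 1 := by
  cases ε <;> simp [Sgn.pow]

theorem Sgn.pow_inv_mul (c : ℂˣ) (ε : Sgn) : Sgn.pow c⁻¹ ε * Sgn.pow c ε = 1 := by
  rw [← Sgn.pow_mul]; simp

theorem Intertw.comp {M'' : Type*} [AddCommGroup M''] [Module ℂ M''] {c c' : ℂˣ} {A : LMat n M}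
    {A' : LMat n M'} {A'' : LMat n M''} {f : M →ₗ[ℂ] M'} {g : M' →ₗ[ℂ] M''}
    (hg : Intertw c' A' A'' g) (hf : Intertw c A A' f) : Intertw (c' * c) A A'' (g ∘ₗ f) := by
  intro ε i j m
  rw [LinearMap.comp_apply, hg, hf, map_smul, smul_smul, Sgn.pow_mul]; rfl

theorem Intertw.id {A : LMat n M} : Intertw 1 A A LinearMap.id := by
  intro ε i j m; simp

theorem Intertw.zero {c : ℂˣ} {A : LMat n M} {A' : LMat n M'} :
    Intertw c A A' (0 : M →ₗ[ℂ] M') := by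
  intro ε i j m; simp

theorem Intertw.add {c : ℂˣ} {A : LMat n M} {A' : LMat n M'} {f g : M →ₗ[ℂ] M'}
    (hf : Intertw c A A' f) (hg : Intertw c A A' g) : Intertw c A A' (f + g) := by
  intro ε i j m; simp [hf ε i j m, hg ε i j m]

theorem Intertw.smul {c : ℂˣ} {A : LMat n M} {A' : LMat n M'} {f : M →ₗ[ℂ] M'} (a : ℂ)
    (hf : Intertw c A A' f) : Intertw c A A' (a • f) := by
  intro ε i j m; simp [hf ε i j m, smul_comm a]

theorem Intertw.sub {c : ℂˣ} {A : LMat n M} {A' : LMat n M'} {f g : M →ₗ[ℂ] M'}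
    (hf : Intertw c A A' f) (hg : Intertw c A A' g) : Intertw c A A' (f - g) := by
  intro ε i j m; simp [hf ε i j m, hg ε i j m, smul_sub]

variable (z : ℂˣ)

/-- Contraction of the auxiliary index of a matrix of operators with the last factor. -/
def Datum.contr (A : Fin n → Fin n → Module.End ℂ M) (j : Fin n) : (Fin n → M) →ₗ[ℂ] M :=
  ∑ x, ∑ y, D.Bi x y • (A x j ∘ₗ LinearMap.proj y)

theorem Datum.contr_apply (A : Fin n → Fin n → Module.End ℂ M) (j : Fin n) (v : Fin n → M) :
    D.contr A j v = ∑ x, ∑ y, D.Bi x y • A x j (v y) := by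
  simp [Datum.contr, LinearMap.sum_apply]

/-- The action of `L^±` on `M ⊗ ℂⁿ`, given its action on `M`. -/
def Datum.step (A : LMat n M) : LMat n (Fin n → M) := fun ε i j =>
  LinearMap.pi fun c => Sgn.pow z ε •
    (Sgn.pow D.q ε • (A ε c j ∘ₗ LinearMap.proj i) + D.B c i • D.contr (A ε) j)

theorem Datum.step_apply (A : LMat n M) (ε : Sgn) (i j : Fin n) (v : Fin n → M) (c : Fin n) :
    D.step z A ε i j v c = Sgn.pow z ε •
      (Sgn.pow D.q ε • A ε c j (v i) + D.B c i • D.contr (A ε) j v) := rfl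

theorem Datum.pow_q_loop (ε : Sgn) :
    Sgn.pow D.q ε * Sgn.pow D.q ε + Sgn.pow D.q ε * D.loop + 1 = 0 := by
  have hq : (D.q : ℂ) ≠ 0 := D.q.ne_zero
  cases ε <;> simp only [Sgn.pow, Datum.loop, Units.val_inv_eq_inv_val] <;> field_simp <;> ring

theorem Intertw.amp {c : ℂˣ} {A : LMat n M} {A' : LMat n M'} {f : M →ₗ[ℂ] M'}
    (hf : Intertw c A A' f) : Intertw c (D.step z A) (D.step z A') (amp n f) := by
  intro ε i j v
  funext x
  simp only [D.step_apply, amp_apply, Pi.smul_apply, D.contr_apply, hf ε _ _ _, map_smul, map_add,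
    map_sum, smul_add, Finset.smul_sum, smul_smul]
  congr 1
  · congr 1; ring
  · refine Finset.sum_congr rfl fun a _ => Finset.sum_congr rfl fun b _ => ?_
    congr 1; ring

theorem Datum.contr_step (A : LMat n M) (ε : Sgn) (j : Fin n) (v : Fin n → Fin n → M)
    (x : Fin n) : D.contr (D.step z A ε) j v x = Sgn.pow z ε •
      (Sgn.pow D.q ε • A ε x j (D.cap M v) + D.contr (A ε) j (v x)) := by
  have h : ∑ m, ∑ y, (D.B x m * D.Bi m y) • D.contr (A ε) j (v y) = D.contr (A ε) j (v x) := by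
    rw [Finset.sum_comm]
    simp only [← Finset.sum_smul, D.B_Bi]
    simp
  rw [← h, D.contr_apply, D.cap_apply]
  simp only [Finset.sum_apply, Pi.smul_apply, D.step_apply, map_sum, map_smul, Finset.smul_sum,
    smul_add, Finset.sum_add_distrib, smul_smul]
  congr 1 <;> refine Finset.sum_congr rfl fun a _ => Finset.sum_congr rfl fun b _ => ?_ <;>
    congr 1 <;> ring

theorem Datum.intertw_cap (A : LMat n M) :
    Intertw ((z ^ 2 * D.q)⁻¹) (D.step z (D.step z A)) A (D.cap M) := by
  intro ε i j v
  have h1 : ∑ x, ∑ y, (D.Bi x y * D.B x y) • D.contr (A ε) j (v i) =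
      D.loop • D.contr (A ε) j (v i) := by
    simp only [← Finset.sum_smul, D.sum_Bi_B]; rfl
  have h2 : ∀ w : Fin n → M, ∑ x, ∑ y, (D.Bi x y * D.B y i) • w x = w i := by
    intro w
    simp only [← Finset.sum_smul, D.Bi_B]
    simp
  have h3 := D.contr_apply (A ε) j (v i)
  have key : D.cap M (D.step z (D.step z A) ε i j v) =
      (Sgn.pow z ε * Sgn.pow z ε * Sgn.pow D.q ε) • A ε i j (D.cap M v) := by
    have h5 := h2 fun x => A ε x j (D.cap M v)
    have h6 := h2 fun x => D.contr (A ε) j (v x)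
    have e : D.cap M (D.step z (D.step z A) ε i j v) =
        (Sgn.pow z ε * Sgn.pow z ε) •
          ((Sgn.pow D.q ε * Sgn.pow D.q ε) • ∑ x, ∑ y, D.Bi x y • A ε x j (v i y) +
          Sgn.pow D.q ε • ∑ x, ∑ y, (D.Bi x y * D.B x y) • D.contr (A ε) j (v i) +
          Sgn.pow D.q ε • ∑ x, ∑ y, (D.Bi x y * D.B y i) • A ε x j (D.cap M v) +
          ∑ x, ∑ y, (D.Bi x y * D.B y i) • D.contr (A ε) j (v x)) := by
      rw [D.cap_apply]
      simp only [D.step_apply, Pi.smul_apply, Pi.add_apply, D.contr_step]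
      simp only [Finset.smul_sum, ← Finset.sum_add_distrib]
      exact Finset.sum_congr rfl fun x _ => Finset.sum_congr rfl fun y _ => by module
    rw [← h3, h1, h5, h6] at e
    rw [e]
    linear_combination (norm := skip)
      (Sgn.pow z ε * Sgn.pow z ε * D.pow_q_loop ε) • D.contr (A ε) j (v i)
    module
  have h4 : Sgn.pow (z ^ 2 * D.q) ε = Sgn.pow z ε * Sgn.pow z ε * Sgn.pow D.q ε := by
    rw [Sgn.pow_mul, pow_two, Sgn.pow_mul]
  rw [key, smul_smul, ← h4, Sgn.pow_inv_mul, one_smul]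

theorem Datum.intertw_cup (A : LMat n M) :
    Intertw (z ^ 2 * D.q) A (D.step z (D.step z A)) (D.cup M) := by
  intro ε i j m
  have h1 : ∀ y, D.contr (A ε) j (D.cup M m y) = A ε y j m := by
    intro y
    rw [D.contr_apply]
    simp only [D.cup_apply, map_smul, smul_smul, ← Finset.sum_smul, D.Bi_B]
    simp
  have h2 : D.cap M (D.cup M m) = D.loop • m := LinearMap.congr_fun D.cap_cup m
  funext y x
  have h3 : Sgn.pow (z ^ 2 * D.q) ε = Sgn.pow z ε * Sgn.pow z ε * Sgn.pow D.q ε := by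
    rw [Sgn.pow_mul, pow_two, Sgn.pow_mul]
  have h := D.pow_q_loop ε
  rw [h3]
  simp only [D.step_apply, Pi.smul_apply, Pi.add_apply, D.contr_step, h1, h2, D.cup_apply,
    map_smul]
  linear_combination (norm := skip) (Sgn.pow z ε * Sgn.pow z ε * D.B y i * h) • (A ε x j m)
  module

end CupCap

/-! ### The Jones–Wenzl recursion -/

section JonesWenzl

variable {n : ℕ} (D : Datum n)
variable {M M' : Type*} [AddCommGroup M] [Module ℂ M] [AddCommGroup M'] [Module ℂ M']

/-- The coefficients of the Jones–Wenzl recursion. -/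
def Datum.coef (k : ℕ) : ℂ :=
  -(D.q : ℂ) * ((D.q : ℂ) ^ (2 * k) - 1) / ((D.q : ℂ) ^ (2 * k + 2) - 1)

/-- The parameter `q` is not a root of unity. -/
def Datum.Generic : Prop := ∀ m : ℕ, 0 < m → (D.q : ℂ) ^ m ≠ 1

variable {D} in
theorem Datum.Generic.coef_succ (hD : D.Generic) (k : ℕ) :
    (D.loop - D.coef k) * D.coef (k + 1) = 1 := by
  have hq : (D.q : ℂ) ≠ 0 := D.q.ne_zero
  have h1 : (D.q : ℂ) ^ (2 * k + 2) - 1 ≠ 0 := sub_ne_zero.2 (hD _ (by omega))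
  have h2 : (D.q : ℂ) ^ (2 * k + 2 + 2) - 1 ≠ 0 := sub_ne_zero.2 (hD _ (by omega))
  rw [Datum.coef, Datum.coef, Datum.loop, show 2 * (k + 1) = 2 * k + 2 by ring]
  rw [pow_add _ (2 * k) 2] at h1
  rw [pow_add _ (2 * k + 2) 2, pow_add _ (2 * k) 2] at h2
  rw [pow_add _ (2 * k + 2) 2, pow_add _ (2 * k) 2]
  generalize (D.q : ℂ) ^ (2 * k) = x at *
  generalize (D.q : ℂ) = q at *
  obtain ⟨u, hu⟩ : ∃ u, u = x * q ^ 2 - 1 := ⟨_, rfl⟩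
  obtain ⟨v, hv⟩ : ∃ v, v = x * q ^ 2 * q ^ 2 - 1 := ⟨_, rfl⟩
  rw [← hv] at h2 ⊢
  rw [← hu] at h1 ⊢
  field_simp
  rw [hu, hv]
  ring

theorem Datum.coef_zero : D.coef 0 = 0 := by simp [Datum.coef]

/-- One step of the Jones–Wenzl recursion. -/
def Datum.jwStep (c : ℂ) (P : Module.End ℂ (Fin n → M)) : Module.End ℂ (Fin n → Fin n → M) :=
  amp n P - c • (amp n P ∘ₗ D.cup M ∘ₗ D.cap M ∘ₗ amp n P)

/-- The properties of two consecutive Jones–Wenzl projectors that are carried along the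
recursion. -/
structure Datum.JWPair (c : ℂ) (p : Module.End ℂ M) (P : Module.End ℂ (Fin n → M)) : Prop where
  idem : ∀ v, P (P v) = P v
  amp_right : ∀ v, P (amp n p v) = P v
  amp_left : ∀ v, amp n p (P v) = P v
  ptrace : ∀ m, D.cap M (amp n P (D.cup M m)) = (D.loop - c) • p m

variable {D} {c c' : ℂ} {p : Module.End ℂ M} {P : Module.End ℂ (Fin n → M)}

theorem Datum.jwStep_apply (v : Fin n → Fin n → M) : D.jwStep c P v =
    amp n P v - c • amp n P (D.cup M (D.cap M (amp n P v))) := rfl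

namespace Datum.JWPair

theorem amp_amp (h : D.JWPair c p P) (v : Fin n → Fin n → M) :
    amp n (amp n p) (amp n P v) = amp n P v := funext fun x => h.amp_left (v x)

theorem p_cap (h : D.JWPair c p P) (v : Fin n → Fin n → M) :
    p (D.cap M (amp n P v)) = D.cap M (amp n P v) := by
  have := LinearMap.congr_fun (D.cap_amp p) (amp n P v)
  simp only [LinearMap.comp_apply] at this
  rw [← this, h.amp_amp]

theorem cap_step (h : D.JWPair c p P) (hc : (D.loop - c) * c' = 1) (v : Fin n → Fin n → M) :
    D.cap M (D.jwStep c' P v) = 0 := by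
  rw [D.jwStep_apply, map_sub, map_smul, h.ptrace, h.p_cap, smul_smul, mul_comm, hc, one_smul,
    sub_self]

theorem amp_cup (h : D.JWPair c p P) (m : M) :
    amp n P (D.cup M (p m)) = amp n P (D.cup M m) := by
  have := LinearMap.congr_fun (D.cup_amp p) m
  simp only [LinearMap.comp_apply] at this
  rw [this]
  exact funext fun x => h.amp_right _

theorem amp_idem (h : D.JWPair c p P) (v : Fin n → Fin n → M) :
    amp n P (amp n P v) = amp n P v := funext fun x => h.idem (v x)

theorem step_amp (h : D.JWPair c p P) (v : Fin n → Fin n → M) :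
    D.jwStep c' P (amp n P v) = D.jwStep c' P v := by
  simp only [D.jwStep_apply, h.amp_idem]

theorem amp_step (h : D.JWPair c p P) (v : Fin n → Fin n → M) :
    amp n P (D.jwStep c' P v) = D.jwStep c' P v := by
  simp only [D.jwStep_apply, map_sub, map_smul, h.amp_idem]

theorem step_cup (h : D.JWPair c p P) (hc : (D.loop - c) * c' = 1) (m : M) :
    D.jwStep c' P (D.cup M m) = 0 := by
  rw [D.jwStep_apply, h.ptrace, map_smul, map_smul, h.amp_cup, smul_smul, mul_comm, hc, one_smul,
    sub_self]

theorem step (h : D.JWPair c p P) (hc : (D.loop - c) * c' = 1) :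
    D.JWPair c' P (D.jwStep c' P) where
  idem v := by
    nth_rewrite 1 [D.jwStep_apply]
    rw [h.amp_step, h.cap_step hc]
    simp
  amp_right := h.step_amp
  amp_left := h.amp_step
  ptrace m := by
    have e1 : amp n (D.jwStep c' P) (D.cup (Fin n → M) m) =
        amp n (amp n P) (D.cup (Fin n → M) m) - c' • amp n (amp n P) (amp n (D.cup M)
          (amp n (D.cap M) (amp n (amp n P) (D.cup (Fin n → M) m)))) := rfl
    have e2 := LinearMap.congr_fun (D.cup_amp P) m
    have e3 := fun w => LinearMap.congr_fun (D.cap_amp P) w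
    have e4 := fun w => LinearMap.congr_fun (D.amp_cap_cup (M := M)) w
    have e5 := fun w => LinearMap.congr_fun (D.cap_amp_cup (M := M)) w
    have e6 := LinearMap.congr_fun (D.cap_cup (M := Fin n → M)) m
    simp only [LinearMap.comp_apply, LinearMap.id_apply, LinearMap.smul_apply] at e2 e3 e4 e5 e6
    rw [e1, map_sub, map_smul, e3, e3, e5, ← e2, e4, h.idem, e6, map_smul, sub_smul]

end Datum.JWPair

end JonesWenzl

/-! ### Iterated tuples as a model of tensor powers -/

section Model

/-- The model `Fin n → ⋯ → Fin n → ℂ` of `(ℂⁿ)^{⊗N}`; the outermost index belongs to the last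
factor. -/
def HH (n : ℕ) : ℕ → Type
  | 0 => ℂ
  | N + 1 => Fin n → HH n N

instance HH.addCommGroup (n : ℕ) : ∀ N, AddCommGroup (HH n N)
  | 0 => inferInstanceAs (AddCommGroup ℂ)
  | N + 1 =>
    letI := HH.addCommGroup n N
    inferInstanceAs (AddCommGroup (Fin n → HH n N))

instance HH.module (n : ℕ) : ∀ N, Module ℂ (HH n N)
  | 0 => inferInstanceAs (Module ℂ ℂ)
  | N + 1 =>
    letI := HH.module n N
    inferInstanceAs (Module ℂ (Fin n → HH n N))

instance HH.finite (n : ℕ) : ∀ N, Module.Finite ℂ (HH n N)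
  | 0 => inferInstanceAs (Module.Finite ℂ ℂ)
  | N + 1 =>
    letI := HH.finite n N
    inferInstanceAs (Module.Finite ℂ (Fin n → HH n N))

theorem HH.finrank (n : ℕ) : ∀ N, Module.finrank ℂ (HH n N) = n ^ N
  | 0 => Module.finrank_self ℂ
  | N + 1 => by
    have h : Module.finrank ℂ (Fin n → HH n N) = n ^ (N + 1) := by
      rw [Module.finrank_pi_fintype]
      simp [HH.finrank n N, pow_succ, mul_comm]
    exact h

variable {n : ℕ} (D : Datum n) (z : ℂˣ)

/-- The operators `L^±` on the model. -/
def Datum.TT : ∀ N, LMat n (HH n N)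
  | 0 => fun _ i j => if i = j then 1 else 0
  | N + 1 => D.step z (Datum.TT N)

/-- The Jones–Wenzl projectors. -/
def Datum.jw : ∀ k, Module.End ℂ (HH n k)
  | 0 => LinearMap.id
  | 1 => LinearMap.id
  | k + 2 => D.jwStep (M := HH n k) (D.coef (k + 1)) (Datum.jw (k + 1))

variable {D}

theorem Datum.Generic.jwPair (hD : D.Generic) :
    ∀ k, D.JWPair (M := HH n k) (D.coef k) (D.jw k) (D.jw (k + 1))
  | 0 =>
    { idem := fun _ => rfl
      amp_right := fun _ => rfl
      amp_left := fun _ => rfl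
      ptrace := fun m => by
        rw [D.coef_zero, sub_zero]
        exact LinearMap.congr_fun (D.cap_cup (M := HH n 0)) m }
  | k + 1 => (hD.jwPair k).step (hD.coef_succ k)

theorem Datum.Generic.jw_idem (hD : D.Generic) (k : ℕ) (v : HH n k) :
    D.jw k (D.jw k v) = D.jw k v := by
  cases k with
  | zero => rfl
  | succ k => exact (hD.jwPair k).idem v

variable {M : Type*} [AddCommGroup M] [Module ℂ M]

theorem Datum.intertw_cup_cap (A : LMat n M) :
    Intertw 1 (D.step z (D.step z A)) (D.step z (D.step z A)) (D.cup M ∘ₗ D.cap M) := by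
  have := (D.intertw_cup z A).comp (D.intertw_cap z A)
  rwa [mul_inv_cancel] at this

theorem Datum.intertw_jw : ∀ k, Intertw 1 (D.TT z k) (D.TT z k) (D.jw k)
  | 0 => Intertw.id
  | 1 => Intertw.id
  | k + 2 => by
    have h : Intertw 1 (D.step z (D.step z (D.TT z k))) (D.step z (D.step z (D.TT z k)))
      (amp n (M := HH n (k + 1)) (D.jw (k + 1))) := Intertw.amp D z (Datum.intertw_jw (k + 1))
    have h2 := h.comp ((D.intertw_cup_cap z (D.TT z k)).comp h)
    rw [one_mul, one_mul] at h2
    exact h.sub (h2.smul (D.coef (k + 1)))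

end Model

/-! ### Irreducibility of the images of the Jones–Wenzl projectors -/

section Irreducible

variable {n : ℕ} {D : Datum n} (z : ℂˣ)
variable {M : Type*} [AddCommGroup M] [Module ℂ M]

/-- Invariance of a subspace under a pair of matrices of operators. -/
def Inv (A : LMat n M) (S : Submodule ℂ M) : Prop := ∀ ε i j, ∀ m ∈ S, A ε i j m ∈ S

/-- The subspace of `M` spanned by the components of the elements of `S`. -/
def slices (S : Submodule ℂ (Fin n → M)) : Submodule ℂ M :=
  ⨆ c : Fin n, S.map (LinearMap.proj c)

theorem mem_slices {S : Submodule ℂ (Fin n → M)} {s : Fin n → M} (hs : s ∈ S) (c : Fin n) :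
    s c ∈ slices S :=
  Submodule.mem_iSup_of_mem c ⟨s, hs, rfl⟩

theorem slices_le {S : Submodule ℂ (Fin n → M)} {S' : Submodule ℂ M}
    (h : ∀ s ∈ S, ∀ c, s c ∈ S') : slices S ≤ S' := by
  refine iSup_le fun c => ?_
  rintro _ ⟨s, hs, rfl⟩
  exact h s hs c

theorem Inv.slices {A : LMat n M} {S : Submodule ℂ (Fin n → M)} (hS : Inv (D.step z A) S) :
    Inv A (slices S) := by
  intro ε c j
  suffices h : TLDuality.slices S ≤ (TLDuality.slices S).comap (A ε c j) from fun m hm => h hm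
  refine slices_le fun s hs i => ?_
  have hu : ∀ c i, Sgn.pow D.q ε • A ε c j (s i) + D.B c i • D.contr (A ε) j s ∈
      TLDuality.slices S := by
    intro c i
    have := mem_slices (hS ε i j s hs) c
    rw [D.step_apply] at this
    exact (Submodule.smul_mem_iff _ (Sgn.pow_ne_zero z ε)).1 this
  have ht : Sgn.pow D.q ε + D.loop ≠ 0 := by
    intro h
    have := D.pow_q_loop ε
    rw [← mul_add, h] at this
    simp at this
  have hc : D.contr (A ε) j s ∈ TLDuality.slices S := by
    refine (Submodule.smul_mem_iff _ ht).1 ?_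
    have e : (Sgn.pow D.q ε + D.loop) • D.contr (A ε) j s = ∑ c, ∑ i, D.Bi c i •
        (Sgn.pow D.q ε • A ε c j (s i) + D.B c i • D.contr (A ε) j s) := by
      simp only [smul_add, smul_smul, Finset.sum_add_distrib, ← Finset.sum_smul, D.sum_Bi_B]
      rw [add_smul]
      congr 1
      rw [D.contr_apply]
      simp only [Finset.smul_sum, smul_smul]
      exact Finset.sum_congr rfl fun c _ => Finset.sum_congr rfl fun i _ => by rw [mul_comm]
    rw [e]
    exact Submodule.sum_mem _ fun c _ => Submodule.sum_mem _ fun i _ =>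
      Submodule.smul_mem _ _ (hu c i)
  have := Submodule.sub_mem _ (hu c i) (Submodule.smul_mem _ (D.B c i) hc)
  rw [add_sub_cancel_right] at this
  exact (Submodule.smul_mem_iff (TLDuality.slices S) (Sgn.pow_ne_zero D.q ε)).1 this

theorem Datum.JWPair.fixed {c c' : ℂ} {p : Module.End ℂ M} {P : Module.End ℂ (Fin n → M)}
    (h : D.JWPair c p P) (hc : (D.loop - c) * c' = 1) (v : Fin n → Fin n → M) :
    D.jwStep c' P v = v ↔ amp n P v = v ∧ D.cap M v = 0 := by
  constructor
  · intro hv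
    exact ⟨by rw [← hv, h.amp_step], by rw [← hv, h.cap_step hc]⟩
  · rintro ⟨h1, h2⟩
    rw [D.jwStep_apply, h1, h2]
    simp

theorem Datum.JWPair.step_step {c c' : ℂ} {p : Module.End ℂ M} {P : Module.End ℂ (Fin n → M)}
    (h : D.JWPair c p P) (hc : (D.loop - c) * c' = 1) {A : LMat n (Fin n → M)}
    {e : M →ₗ[ℂ] (Fin n → M)} {K : (Fin n → M) →ₗ[ℂ] M} {a b : ℂ} {ε : Sgn} {j : Fin n}
    (hA : ∀ i w, P w = w →
      P (A ε i j w) = a • (b • P (e (w i)) + P (fun x => D.B x i • K w)))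
    (i : Fin n) {v : Fin n → Fin n → M} (hv : D.jwStep c' P v = v) :
    D.jwStep c' P (D.step z A ε i j v) = (Sgn.pow z ε * a) •
      ((Sgn.pow D.q ε * b) • D.jwStep c' P (amp n e (v i)) +
        D.jwStep c' P (fun x => D.B x i • amp n K v)) := by
  obtain ⟨hv1, hv2⟩ := (h.fixed hc v).1 hv
  have hv3 : ∀ y, P (v y) = v y := fun y => congrFun hv1 y
  have h1 : ∑ x, ∑ y, D.Bi x y • P (e (v y x)) = 0 := by
    have : P (e (D.cap M v)) = ∑ x, ∑ y, D.Bi x y • P (e (v y x)) := by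
      rw [D.cap_apply]; simp only [map_sum, map_smul]
    rw [← this, hv2, map_zero, map_zero]
  have h2 : ∑ x, ∑ y, D.Bi x y • P (fun u => D.B u x • K (v y)) = P (amp n K v) := by
    have : amp n K v = ∑ x, ∑ y, D.Bi x y • (fun u => D.B u x • K (v y)) := by
      funext u
      simp only [Finset.sum_apply, Pi.smul_apply, smul_smul, amp_apply]
      rw [Finset.sum_comm]
      simp only [mul_comm _ (D.B u _), ← Finset.sum_smul, D.B_Bi]
      simp
    rw [this]
    simp only [map_sum, map_smul]
  have h3 : P (D.contr (A ε) j v) = a • P (amp n K v) := by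
    rw [D.contr_apply, ← h2]
    simp only [map_sum, map_smul, hA _ _ (hv3 _)]
    have : a • b • (∑ x, ∑ y, D.Bi x y • P (e (v y x))) = 0 := by
      rw [h1, smul_zero, smul_zero]
    rw [← zero_add (a • _), ← this]
    simp only [Finset.smul_sum, ← Finset.sum_add_distrib]
    exact Finset.sum_congr rfl fun x _ => Finset.sum_congr rfl fun y _ => by module
  have key : amp n P (D.step z A ε i j v) = (Sgn.pow z ε * a) •
      ((Sgn.pow D.q ε * b) • amp n P (amp n e (v i)) +
        Sgn.pow D.q ε • amp n P (D.cup M (K (v i))) +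
        amp n P (fun x => D.B x i • amp n K v)) := by
    funext x
    simp only [amp_apply, D.step_apply, map_smul, map_add, hA _ _ (hv3 _), h3, Pi.smul_apply,
      Pi.add_apply]
    have : (fun u => D.B u x • K (v i)) = D.cup M (K (v i)) x := rfl
    rw [this]
    module
  rw [← h.step_amp, key]
  simp only [map_smul, map_add, h.step_amp, h.step_cup hc, smul_zero, add_zero]

/-- Insertion of a basis vector in front. -/
def pre (n : ℕ) (j : Fin n) : ∀ k, HH n k →ₗ[ℂ] HH n (k + 1)
  | 0 => LinearMap.single ℂ (fun _ : Fin n => HH n 0) j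
  | k + 1 => amp n (M := HH n k) (M' := HH n (k + 1)) (pre n j k)

/-- Coordinates with respect to the first factor. -/
def del (n : ℕ) (j : Fin n) : ∀ k, HH n (k + 1) →ₗ[ℂ] HH n k
  | 0 => LinearMap.proj (φ := fun _ : Fin n => HH n 0) j
  | k + 1 => amp n (M := HH n (k + 1)) (M' := HH n k) (del n j k)

theorem sum_pre_del : ∀ k (v : HH n (k + 1)), ∑ j, pre n j k (del n j k v) = v
  | 0, v => by
    have : ∀ w : Fin n → HH n 0, ∑ j, Pi.single (M := fun _ => HH n 0) j (w j) = w :=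
      fun w => Finset.univ_sum_single w
    exact this v
  | k + 1, v => by
    have : ∀ w : Fin n → HH n (k + 1), ∑ j, amp n (pre n j k) (amp n (del n j k) w) = w := by
      intro w
      funext c
      rw [Finset.sum_apply]
      exact sum_pre_del k (w c)
    exact this v

theorem Datum.Generic.jw_fixed (hD : D.Generic) (k : ℕ) (v : HH n (k + 2)) :
    D.jw (k + 2) v = v ↔
      amp n (D.jw (k + 1)) v = v ∧ D.cap (HH n k) v = 0 :=
  (hD.jwPair k).fixed (hD.coef_succ k) v

theorem Datum.Generic.jw_del (hD : D.Generic) (j : Fin n) : ∀ k (v : HH n (k + 1)),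
    D.jw (k + 1) v = v → D.jw k (del n j k v) = del n j k v
  | 0, _, _ => rfl
  | 1, _, _ => rfl
  | k + 2, v, hv => by
    obtain ⟨h1, h2⟩ := (hD.jw_fixed (k + 1) v).1 hv
    refine (hD.jw_fixed k _).2 ⟨funext fun c => hD.jw_del j (k + 1) (v c) (congrFun h1 c), ?_⟩
    exact (LinearMap.congr_fun (D.cap_amp (del n j k)) v).trans
      ((congrArg (del n j k) h2).trans (map_zero _))

theorem Datum.step_one (ε : Sgn) (i j : Fin n) (v : Fin n → M) :
    D.step z (fun _ x y => if x = y then (1 : Module.End ℂ M) else 0) ε i j v =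
      Sgn.pow z ε ^ (0 + 1) • (Sgn.pow D.q ε ^ (0 + 1) • LinearMap.single ℂ (fun _ => M) j (v i) +
        fun c => D.B c i • D.contr (fun x y => if x = y then (1 : Module.End ℂ M) else 0) j v) := by
  funext c
  rw [D.step_apply, zero_add, _root_.pow_one, _root_.pow_one]
  by_cases hcj : c = j
  · subst hcj; simp
  · simp [hcj]

theorem Datum.Generic.exists_TT_formula (hD : D.Generic) (j : Fin n) : ∀ k,
    ∃ K : HH n (k + 1) →ₗ[ℂ] HH n k, ∀ ε i v, D.jw (k + 1) v = v →
      D.jw (k + 1) (D.TT z (k + 1) ε i j v) = (Sgn.pow z ε) ^ (k + 1) •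
        ((Sgn.pow D.q ε) ^ (k + 1) • D.jw (k + 1) (pre n j k (v i)) +
          D.jw (k + 1) (fun c => D.B c i • K v))
  | 0 => ⟨D.contr (M := HH n 0) (fun x y => if x = y then 1 else 0) j,
      fun ε i v _ => D.step_one (M := HH n 0) z ε i j v⟩
  | k + 1 => by
    obtain ⟨K, hK⟩ := hD.exists_TT_formula j k
    refine ⟨amp n K, fun ε i v hv => ?_⟩
    have := (hD.jwPair k).step_step z (hD.coef_succ k) (fun i w => hK ε i w) i hv
    rw [pow_succ', pow_succ' _ (k + 1)]
    exact this

theorem Datum.Generic.pow_sub_ne_zero (hD : D.Generic) (k : ℕ) :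
    Sgn.pow D.q plus ^ (k + 1) - Sgn.pow D.q minus ^ (k + 1) ≠ 0 := by
  intro h
  apply hD (2 * (k + 1)) (by omega)
  have hq : (D.q : ℂ) ≠ 0 := D.q.ne_zero
  simp only [Sgn.pow, Units.val_inv_eq_inv_val, inv_pow] at h
  rw [sub_eq_zero] at h
  rw [two_mul, pow_add]
  nth_rewrite 1 [h]
  exact inv_mul_cancel₀ (pow_ne_zero _ hq)

theorem Datum.Generic.pre_mem (hD : D.Generic) (k : ℕ) {S : Submodule ℂ (HH n (k + 1))}
    (hS : Inv (D.TT z (k + 1)) S) (hf : ∀ v ∈ S, D.jw (k + 1) v = v) (j : Fin n)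
    {v : HH n (k + 1)} (hv : v ∈ S) (i : Fin n) : D.jw (k + 1) (pre n j k (v i)) ∈ S := by
  obtain ⟨K, hK⟩ := hD.exists_TT_formula z j k
  have h : ∀ ε, (Sgn.pow D.q ε) ^ (k + 1) • D.jw (k + 1) (pre n j k (v i)) +
          D.jw (k + 1) (fun c => D.B c i • K v) ∈ S := by
    intro ε
    have h1 := hS ε i j v hv
    rw [← hf _ h1, hK ε i v (hf v hv)] at h1
    exact (Submodule.smul_mem_iff _ (pow_ne_zero _ (Sgn.pow_ne_zero z ε))).1 h1
  have := Submodule.sub_mem _ (h plus) (h minus)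
  rw [add_sub_add_right_eq_sub, ← sub_smul] at this
  exact (Submodule.smul_mem_iff _ (hD.pow_sub_ne_zero k)).1 this

/-- The image of a Jones–Wenzl projector is irreducible. -/
theorem Datum.Generic.jw_irreducible (hD : D.Generic) : ∀ k (S : Submodule ℂ (HH n k)),
    Inv (D.TT z k) S → (∀ v ∈ S, D.jw k v = v) → S ≠ ⊥ → ∀ v, D.jw k v = v → v ∈ S
  | 0, S, _, _, h0, v, _ => by
    obtain ⟨s, hs, hs0⟩ := S.exists_mem_ne_zero_of_ne_bot h0
    have : ∀ (S : Submodule ℂ ℂ) (s v : ℂ), s ∈ S → s ≠ 0 → v ∈ S := by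
      intro S s v hs hs0
      have := S.smul_mem (v / s) hs
      rwa [smul_eq_mul, div_mul_cancel₀ _ hs0] at this
    exact this S s v hs hs0
  | k + 1, S, hS, hf, h0, v, hv => by
    have hS' : Inv (D.TT z k) (slices (M := HH n k) S) := Inv.slices z hS
    have hfix : ∀ w ∈ slices (M := HH n k) S, D.jw k w = w := by
      suffices h : slices (M := HH n k) S ≤ LinearMap.eqLocus (D.jw k) LinearMap.id from
        fun w hw => h hw
      refine slices_le fun s hs c => ?_
      have h1 : amp n (D.jw k) (D.jw (k + 1) s) = D.jw (k + 1) s := (hD.jwPair k).amp_left s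
      have h2 : D.jw (k + 1) s = s := hf s hs
      have h3 : amp n (D.jw k) s = s := (congrArg (amp n (D.jw k)) h2).symm.trans (h1.trans h2)
      exact congrFun h3 c
    have hne : slices (M := HH n k) S ≠ ⊥ := by
      obtain ⟨s, hs, hs0⟩ := S.exists_mem_ne_zero_of_ne_bot h0
      intro h
      refine hs0 (funext fun c => ?_)
      have := mem_slices (M := HH n k) hs c
      rw [h] at this
      exact (Submodule.mem_bot ℂ).1 this
    have hall := hD.jw_irreducible k _ hS' hfix hne
    have hpre : ∀ j, slices (M := HH n k) S ≤ S.comap (D.jw (k + 1) ∘ₗ pre n j k) :=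
      fun j => slices_le fun s hs c => hD.pre_mem z k hS hf j hs c
    rw [← hv, ← sum_pre_del k v, map_sum]
    exact Submodule.sum_mem _ fun j _ => hpre j (hall _ (hD.jw_del j k v hv))

end Irreducible

/-! ### The splitting of `V_{k+1} ⊗ ℂⁿ` and dimensions -/

section Split

variable {n : ℕ} {D : Datum n}
variable {M : Type*} [AddCommGroup M] [Module ℂ M]
  {c c' : ℂ} {p : Module.End ℂ M} {P : Module.End ℂ (Fin n → M)}

variable (D p P) in
/-- The embedding of the smaller summand. -/
def Datum.cupMap : M →ₗ[ℂ] (Fin n → Fin n → M) := amp n P ∘ₗ D.cup M ∘ₗ p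

variable (D c' p P) in
/-- The projection to the smaller summand. -/
def Datum.capMap : (Fin n → Fin n → M) →ₗ[ℂ] M := c' • (p ∘ₗ D.cap M ∘ₗ amp n P)

namespace Datum.JWPair

theorem cupMap_capMap (h : D.JWPair c p P) (v : Fin n → Fin n → M) :
    D.cupMap p P (D.capMap c' p P v) = amp n P v - D.jwStep c' P v := by
  simp only [Datum.cupMap, Datum.capMap, LinearMap.comp_apply, LinearMap.smul_apply, map_smul,
    h.p_cap, D.jwStep_apply]
  abel

theorem capMap_cupMap (h : D.JWPair c p P) (hp : ∀ m, p (p m) = p m)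
    (hc : (D.loop - c) * c' = 1) (m : M) :
    D.capMap c' p P (D.cupMap p P m) = p m := by
  simp only [Datum.cupMap, Datum.capMap, LinearMap.comp_apply, LinearMap.smul_apply, h.amp_idem,
    h.ptrace, map_smul, hp, smul_smul, mul_comm c', hc, one_smul]

end Datum.JWPair

end Split

section Dimension

variable {n : ℕ} (D : Datum n) (z : ℂˣ)

/-- The embedding `V_k → V_{k+1} ⊗ ℂⁿ`. -/
def Datum.dn (k : ℕ) : HH n k →ₗ[ℂ] HH n (k + 2) :=
  D.cupMap (M := HH n k) (D.jw k) (D.jw (k + 1))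

/-- The projection `V_{k+1} ⊗ ℂⁿ → V_k`. -/
def Datum.en (k : ℕ) : HH n (k + 2) →ₗ[ℂ] HH n k :=
  D.capMap (M := HH n k) (D.coef (k + 1)) (D.jw k) (D.jw (k + 1))

/-- The operator `p_{k+1} ⊗ 1`. -/
def Datum.ampJw (k : ℕ) : Module.End ℂ (HH n (k + 1)) := amp n (D.jw k)

variable {D} (hD : D.Generic)
include hD

theorem Datum.Generic.dn_en (k : ℕ) : D.dn k ∘ₗ D.en k = D.ampJw (k + 1) - D.jw (k + 2) :=
  LinearMap.ext (hD.jwPair k).cupMap_capMap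

theorem Datum.Generic.en_dn (k : ℕ) : D.en k ∘ₗ D.dn k = D.jw k :=
  LinearMap.ext ((hD.jwPair k).capMap_cupMap (hD.jw_idem k) (hD.coef_succ k))

theorem Datum.Generic.dn_jw (k : ℕ) (v : HH n k) : D.dn k (D.jw k v) = D.dn k v :=
  congrArg (fun w => amp n (D.jw (k + 1)) (D.cup (HH n k) w)) (hD.jw_idem k v)

theorem Datum.Generic.jw_en (k : ℕ) (v : HH n (k + 2)) : D.jw k (D.en k v) = D.en k v := by
  have : ∀ x : HH n k, D.jw k (D.coef (k + 1) • D.jw k x) = D.coef (k + 1) • D.jw k x := by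
    intro x; rw [map_smul, hD.jw_idem]
  exact this _

omit hD in
theorem Datum.intertw_dn (k : ℕ) : Intertw (z ^ 2 * D.q) (D.TT z k) (D.TT z (k + 2)) (D.dn k) := by
  have h := (Intertw.amp D z (D.intertw_jw z (k + 1))).comp
    ((D.intertw_cup z (D.TT z k)).comp (D.intertw_jw z k))
  rw [one_mul, mul_one] at h
  exact h

omit hD in
theorem Datum.intertw_en (k : ℕ) :
    Intertw ((z ^ 2 * D.q)⁻¹) (D.TT z (k + 2)) (D.TT z k) (D.en k) := by
  have h := (D.intertw_jw z k).comp ((D.intertw_cap z (D.TT z k)).comp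
    (Intertw.amp D z (D.intertw_jw z (k + 1))))
  rw [one_mul, mul_one] at h
  exact h.smul (D.coef (k + 1))

omit hD in
variable (D) in
/-- The space `V_k`, as a subspace of `(ℂⁿ)^{⊗k}`. -/
def Datum.VV (k : ℕ) : Submodule ℂ (HH n k) := LinearMap.range (D.jw k)

omit hD in
variable (D) in
/-- The dimension of `V_k`. -/
def Datum.vdim (k : ℕ) : ℕ := Module.finrank ℂ (D.VV k)

theorem Datum.Generic.mem_VV {k : ℕ} {v : HH n k} : v ∈ D.VV k ↔ D.jw k v = v :=
  ⟨by rintro ⟨w, rfl⟩; exact hD.jw_idem k w, fun h => ⟨v, h⟩⟩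

theorem Datum.Generic.trace_jw (k : ℕ) :
    LinearMap.trace ℂ (HH n k) (D.jw k) = D.vdim k := by
  have h : LinearMap.IsProj (D.VV k) (D.jw k) :=
    ⟨fun v => ⟨v, rfl⟩, fun v hv => hD.mem_VV.1 hv⟩
  exact h.trace

omit hD in
theorem Datum.vdim_zero : D.vdim 0 = 1 := by
  have : D.VV 0 = ⊤ := LinearMap.range_id
  rw [Datum.vdim, this, finrank_top, HH.finrank, pow_zero]

omit hD in
theorem Datum.vdim_one : D.vdim 1 = n := by
  have : D.VV 1 = ⊤ := LinearMap.range_id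
  rw [Datum.vdim, this, finrank_top, HH.finrank, _root_.pow_one]

theorem Datum.Generic.vdim_rec (k : ℕ) : n * D.vdim (k + 1) = D.vdim (k + 2) + D.vdim k := by
  have h1 : LinearMap.trace ℂ (HH n (k + 2)) (D.ampJw (k + 1)) =
      n * LinearMap.trace ℂ (HH n (k + 1)) (D.jw (k + 1)) := trace_amp (M := HH n (k + 1)) _
  have h2 : D.ampJw (k + 1) = D.jw (k + 2) + D.dn k ∘ₗ D.en k := by
    rw [hD.dn_en]; abel
  rw [h2, map_add, LinearMap.trace_comp_comm', hD.en_dn, hD.trace_jw, hD.trace_jw,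
    hD.trace_jw] at h1
  exact_mod_cast h1.symm

theorem Datum.Generic.vdim_lt (hn : 2 ≤ n) : ∀ k, D.vdim k < D.vdim (k + 1)
  | 0 => by rw [D.vdim_zero, D.vdim_one]; omega
  | k + 1 => by
    have h1 := Datum.Generic.vdim_lt hn k
    have h2 : n * D.vdim (k + 1) = D.vdim (k + 1 + 1) + D.vdim k := hD.vdim_rec k
    have h3 := Nat.mul_le_mul_right (D.vdim (k + 1)) hn
    omega

theorem Datum.Generic.vdim_strictMono (hn : 2 ≤ n) : StrictMono D.vdim :=
  strictMono_nat_of_lt_succ (hD.vdim_lt hn)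

theorem Datum.Generic.vdim_pos (hn : 2 ≤ n) (k : ℕ) : 0 < D.vdim k := by
  have := (hD.vdim_strictMono hn).monotone (Nat.zero_le k)
  rw [D.vdim_zero] at this
  omega

/-! ### Schur's lemma -/

variable {z}

theorem Datum.Generic.eq_top_of_inv {k : ℕ} {S : Submodule ℂ (HH n k)} (hS : Inv (D.TT z k) S)
    (hle : S ≤ D.VV k) (h0 : S ≠ ⊥) : S = D.VV k :=
  le_antisymm hle fun v hv => hD.jw_irreducible z k S hS (fun _ hw => hD.mem_VV.1 (hle hw)) h0 v
    (hD.mem_VV.1 hv)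

theorem Datum.Generic.inv_VV (k : ℕ) : Inv (D.TT z k) (D.VV k) := by
  intro ε i j m hm
  rw [hD.mem_VV] at hm ⊢
  have := D.intertw_jw z k ε i j m
  rw [hm, Sgn.pow_one, one_smul] at this
  exact this.symm

theorem Datum.Generic.VV_ne_bot (hn : 2 ≤ n) (k : ℕ) : D.VV k ≠ ⊥ := by
  intro h
  have := hD.vdim_pos hn k
  rw [Datum.vdim, h, finrank_bot] at this
  exact lt_irrefl _ this

theorem Datum.Generic.schur_zero (hn : 2 ≤ n) {k l : ℕ} (hkl : k ≠ l) {c : ℂˣ}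
    {g : HH n k →ₗ[ℂ] HH n l} (hg : Intertw c (D.TT z k) (D.TT z l) g)
    (hl : ∀ v, D.jw l (g v) = g v) (v : HH n k) : g (D.jw k v) = 0 := by
  have hv : D.jw k v ∈ D.VV k := ⟨v, rfl⟩
  by_cases hS : LinearMap.ker g ⊓ D.VV k = ⊥
  · exfalso
    have hinj : Function.Injective (g.domRestrict (D.VV k)) := by
      rw [injective_iff_map_eq_zero]
      intro w hw
      have : (w : HH n k) ∈ LinearMap.ker g ⊓ D.VV k := ⟨hw, w.2⟩
      rw [hS, Submodule.mem_bot] at this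
      exact Subtype.ext this
    have hR : (D.VV k).map g = D.VV l := by
      refine hD.eq_top_of_inv (z := z) ?_ ?_ ?_
      · rintro ε i j _ ⟨w, hw, rfl⟩
        rw [hg]
        exact Submodule.smul_mem _ _ ⟨_, hD.inv_VV k ε i j w hw, rfl⟩
      · rintro _ ⟨w, _, rfl⟩
        exact hD.mem_VV.2 (hl _)
      · intro h
        apply hD.VV_ne_bot hn k
        rw [eq_bot_iff]
        intro w hw
        have hw' : g w ∈ (D.VV k).map g := ⟨w, hw, rfl⟩
        rw [h, Submodule.mem_bot] at hw'
        rw [← hS]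
        exact ⟨hw', hw⟩
    have h1 : Module.finrank ℂ (LinearMap.range (g.domRestrict (D.VV k))) = D.vdim k :=
      LinearMap.finrank_range_of_inj hinj
    rw [LinearMap.range_domRestrict, hR] at h1
    exact hkl ((hD.vdim_strictMono hn).injective h1.symm)
  · have := hD.eq_top_of_inv (z := z) (S := LinearMap.ker g ⊓ D.VV k) ?_ inf_le_right hS
    · rw [← this] at hv
      exact hv.1
    · intro ε i j w hw
      refine ⟨?_, hD.inv_VV k ε i j w hw.2⟩
      have h1 := hg ε i j w
      rw [LinearMap.mem_ker.1 hw.1, map_zero] at h1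
      exact (smul_eq_zero.1 h1.symm).resolve_left (Sgn.pow_ne_zero c ε)

theorem Datum.Generic.schur_scalar (hn : 2 ≤ n) {k : ℕ}
    {g : Module.End ℂ (HH n k)} (hg : Intertw 1 (D.TT z k) (D.TT z k) g)
    (hk : ∀ v, D.jw k (g v) = g v) : ∃ a : ℂ, ∀ v, g (D.jw k v) = a • D.jw k v := by
  have hmaps : ∀ v ∈ D.VV k, g v ∈ D.VV k := fun v _ => hD.mem_VV.2 (hk v)
  have : Nontrivial (D.VV k) := (Submodule.nontrivial_iff_ne_bot).2 (hD.VV_ne_bot hn k)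
  obtain ⟨a, ha⟩ := Module.End.exists_eigenvalue (g.restrict hmaps)
  obtain ⟨w, hw, hw0⟩ := ha.exists_hasEigenvector
  refine ⟨a, fun v => ?_⟩
  have hv : D.jw k v ∈ D.VV k := ⟨v, rfl⟩
  have := hD.eq_top_of_inv (z := z) (S := LinearMap.eqLocus g (a • LinearMap.id) ⊓ D.VV k) ?_
    inf_le_right ?_
  · rw [← this] at hv
    exact hv.1
  · intro ε i j u hu
    refine ⟨?_, hD.inv_VV k ε i j u hu.2⟩
    have h1 : g u = a • u := hu.1
    show g (D.TT z k ε i j u) = a • D.TT z k ε i j u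
    have h2 := hg ε i j u
    rw [Sgn.pow_one, one_smul, h1] at h2
    rw [← h2]
    simp
  · intro h
    have : (w : HH n k) ∈ LinearMap.eqLocus g (a • LinearMap.id) ⊓ D.VV k := by
      refine ⟨?_, w.2⟩
      exact congrArg Subtype.val (Module.End.mem_eigenspace_iff.1 hw)
    rw [h, Submodule.mem_bot] at this
    exact hw0 (Subtype.ext this)

end Dimension

/-! ### Decomposition along paths in the Bratteli diagram -/

section Paths

/-- The number of paths from `0` to `k` of length `N` in the Bratteli diagram. -/
def mult : ℕ → ℕ → ℕ
  | 0, 0 => 1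
  | 0, _ + 1 => 0
  | N + 1, 0 => mult N 1
  | N + 1, k + 1 => mult N (k + 2) + mult N k

theorem exists_of_mult_ne_zero : ∀ {N k : ℕ}, mult N k ≠ 0 → ∃ j, N = k + 2 * j
  | 0, 0, _ => ⟨0, rfl⟩
  | 0, _ + 1, h => absurd rfl h
  | N + 1, 0, h => by
    obtain ⟨j, hj⟩ := exists_of_mult_ne_zero (N := N) (k := 1) h
    exact ⟨j + 1, by omega⟩
  | N + 1, k + 1, h => by
    by_cases h1 : mult N k = 0
    · have h2 : mult N (k + 2) ≠ 0 := by
        intro h2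
        apply h
        rw [mult, h1, h2]
      obtain ⟨j, hj⟩ := exists_of_mult_ne_zero h2
      exact ⟨j + 1, by omega⟩
    · obtain ⟨j, hj⟩ := exists_of_mult_ne_zero h1
      exact ⟨j, by omega⟩

theorem mult_eq_zero {N k : ℕ} (h : N < k) : mult N k = 0 := by
  by_contra h1
  obtain ⟨j, hj⟩ := exists_of_mult_ne_zero h1
  omega

theorem mult_pos : ∀ (N k j : ℕ), N = k + 2 * j → 0 < mult N k
  | 0, 0, _, _ => Nat.one_pos
  | 0, _ + 1, _, h => by omega
  | N + 1, 0, j, h => mult_pos N 1 (j - 1) (by omega)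
  | N + 1, k + 1, j, h => by
    have := mult_pos N k j (by omega)
    rw [mult]
    omega

theorem Fin.exists_of_mult {N k : ℕ} (i : Fin (mult N k)) : ∃ j, N = k + 2 * j :=
  exists_of_mult_ne_zero (Fin.pos i).ne'

theorem sum_range_shift {G : Type*} [AddCommMonoid G] (a b : ℕ → G) {N : ℕ} (h : a N = 0)
    (h' : a (N + 1) = 0) :
    ∑ k ∈ Finset.range (N + 1), (a (k + 1) + b k) + a 0 =
      ∑ k ∈ Finset.range N, (b (k + 1) + a k) + b 0 := by
  rw [Finset.sum_add_distrib, add_right_comm, ← Finset.sum_range_succ' a,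
    Finset.sum_range_succ a, Finset.sum_range_succ a, h, h', Finset.sum_add_distrib,
    add_right_comm (∑ k ∈ Finset.range N, b (k + 1)), ← Finset.sum_range_succ' b]
  abel

variable {n : ℕ}

/-- The operator `f ⊗ 1` between tensor powers. -/
def up {k N : ℕ} (f : HH n k →ₗ[ℂ] HH n N) : HH n (k + 1) →ₗ[ℂ] HH n (N + 1) := amp n f

theorem up_apply {k N : ℕ} (f : HH n k →ₗ[ℂ] HH n N) (v : HH n (k + 1)) (c : Fin n) :
    up f v c = f (v c) := rfl

theorem up_id {k : ℕ} : up (LinearMap.id : HH n k →ₗ[ℂ] HH n k) = LinearMap.id := rfl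

theorem up_sum {k N : ℕ} {ι : Type*} (s : Finset ι) (f : ι → (HH n k →ₗ[ℂ] HH n N)) :
    up (∑ i ∈ s, f i) = ∑ i ∈ s, up (f i) := amp_sum s f

variable (D : Datum n) (z : ℂˣ)

/-- The embeddings of `V_k` in `(ℂⁿ)^{⊗N}` along paths, as operators on `(ℂⁿ)^{⊗k}`. -/
def Datum.inc : ∀ N k, Fin (mult N k) → (HH n k →ₗ[ℂ] HH n N)
  | 0, 0, _ => LinearMap.id
  | 0, _ + 1, i => Fin.elim0 i
  | N + 1, 0, i => up (Datum.inc N 1 i) ∘ₗ D.dn 0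
  | N + 1, k + 1, i => Fin.addCases (motive := fun _ => HH n (k + 1) →ₗ[ℂ] HH n (N + 1))
      (fun i => up (Datum.inc N (k + 2) i) ∘ₗ D.dn (k + 1))
      (fun i => up (Datum.inc N k i) ∘ₗ D.jw (k + 1)) i

/-- The projections to `V_k` along paths. -/
def Datum.prj : ∀ N k, Fin (mult N k) → (HH n N →ₗ[ℂ] HH n k)
  | 0, 0, _ => LinearMap.id
  | 0, _ + 1, i => Fin.elim0 i
  | N + 1, 0, i => D.en 0 ∘ₗ up (Datum.prj N 1 i)
  | N + 1, k + 1, i => Fin.addCases (motive := fun _ => HH n (N + 1) →ₗ[ℂ] HH n (k + 1))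
      (fun i => D.en (k + 1) ∘ₗ up (Datum.prj N (k + 2) i))
      (fun i => D.jw (k + 1) ∘ₗ up (Datum.prj N k i)) i

variable {D}

theorem Datum.Generic.inc_jw (hD : D.Generic) :
    ∀ N k i v, D.inc N k i (D.jw k v) = D.inc N k i v
  | 0, 0, _, _ => rfl
  | 0, _ + 1, i, _ => Fin.elim0 i
  | N + 1, 0, i, v => congrArg (up (D.inc N 1 i)) (hD.dn_jw 0 v)
  | N + 1, k + 1, i, v => by
    refine Fin.addCases (fun i => ?_) (fun i => ?_) i
    · simp only [Datum.inc, Fin.addCases_left]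
      exact congrArg (up (D.inc N (k + 2) i)) (hD.dn_jw (k + 1) v)
    · simp only [Datum.inc, Fin.addCases_right]
      exact congrArg (up (D.inc N k i)) (hD.jw_idem (k + 1) v)

theorem Datum.Generic.jw_prj (hD : D.Generic) :
    ∀ N k i v, D.jw k (D.prj N k i v) = D.prj N k i v
  | 0, 0, _, _ => rfl
  | 0, _ + 1, i, _ => Fin.elim0 i
  | N + 1, 0, i, v => hD.jw_en 0 _
  | N + 1, k + 1, i, v => by
    refine Fin.addCases (fun i => ?_) (fun i => ?_) i
    · simp only [Datum.prj, Fin.addCases_left]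
      exact hD.jw_en (k + 1) _
    · simp only [Datum.prj, Fin.addCases_right]
      exact hD.jw_idem (k + 1) _

theorem Datum.intertw_inc : ∀ N k i j, N = k + 2 * j →
    Intertw ((z ^ 2 * D.q) ^ j) (D.TT z k) (D.TT z N) (D.inc N k i)
  | 0, 0, _, 0, _ => by rw [pow_zero]; exact Intertw.id
  | 0, 0, _, _ + 1, h => by omega
  | 0, _ + 1, i, _, _ => Fin.elim0 i
  | N + 1, 0, i, j, h => by
    obtain ⟨l, rfl⟩ : ∃ l, j = l + 1 := ⟨j - 1, by omega⟩
    rw [pow_succ]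
    exact (Intertw.amp D z (Datum.intertw_inc N 1 i l (by omega))).comp (D.intertw_dn z 0)
  | N + 1, k + 1, i, j, h => by
    refine Fin.addCases (fun i => ?_) (fun i => ?_) i
    · obtain ⟨l, hl⟩ := Fin.exists_of_mult i
      obtain rfl : j = l + 1 := by omega
      rw [pow_succ]
      simp only [Datum.inc, Fin.addCases_left]
      exact (Intertw.amp D z (Datum.intertw_inc N (k + 2) i l (by omega))).comp
        (D.intertw_dn z (k + 1))
    · rw [← mul_one ((z ^ 2 * D.q) ^ j)]
      simp only [Datum.inc, Fin.addCases_right]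
      exact (Intertw.amp D z (Datum.intertw_inc N k i j (by omega))).comp
        (D.intertw_jw z (k + 1))

theorem Datum.intertw_prj : ∀ N k i j, N = k + 2 * j →
    Intertw (((z ^ 2 * D.q)⁻¹) ^ j) (D.TT z N) (D.TT z k) (D.prj N k i)
  | 0, 0, _, 0, _ => by rw [pow_zero]; exact Intertw.id
  | 0, 0, _, _ + 1, h => by omega
  | 0, _ + 1, i, _, _ => Fin.elim0 i
  | N + 1, 0, i, j, h => by
    obtain ⟨l, rfl⟩ : ∃ l, j = l + 1 := ⟨j - 1, by omega⟩
    rw [pow_succ']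
    exact (D.intertw_en z 0).comp (Intertw.amp D z (Datum.intertw_prj N 1 i l (by omega)))
  | N + 1, k + 1, i, j, h => by
    refine Fin.addCases (fun i => ?_) (fun i => ?_) i
    · obtain ⟨l, hl⟩ := Fin.exists_of_mult i
      obtain rfl : j = l + 1 := by omega
      rw [pow_succ']
      simp only [Datum.prj, Fin.addCases_left]
      exact (D.intertw_en z (k + 1)).comp
        (Intertw.amp D z (Datum.intertw_prj N (k + 2) i l (by omega)))
    · rw [← one_mul (((z ^ 2 * D.q)⁻¹) ^ j)]
      simp only [Datum.prj, Fin.addCases_right]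
      exact (D.intertw_jw z (k + 1)).comp
        (Intertw.amp D z (Datum.intertw_prj N k i j (by omega)))

theorem Datum.Generic.sum_inc_prj (hD : D.Generic) : ∀ N,
    ∑ k ∈ Finset.range (N + 1), ∑ i, D.inc N k i ∘ₗ D.prj N k i = LinearMap.id
  | 0 => by
    rw [zero_add, Finset.sum_range_one]
    exact Fintype.sum_unique (ι := Fin 1) _
  | N + 1 => by
    obtain ⟨a, ha⟩ : ∃ a : ℕ → Module.End ℂ (HH n (N + 1)), ∀ k, a k =
      ∑ i, up (D.inc N (k + 1) i) ∘ₗ (D.dn k ∘ₗ D.en k) ∘ₗ up (D.prj N (k + 1) i) :=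
      ⟨_, fun _ => rfl⟩
    obtain ⟨b, hb⟩ : ∃ b : ℕ → Module.End ℂ (HH n (N + 1)), ∀ k, b k =
      ∑ i, up (D.inc N k i) ∘ₗ D.jw (k + 1) ∘ₗ up (D.prj N k i) := ⟨_, fun _ => rfl⟩
    have h0 : ∑ i, D.inc (N + 1) 0 i ∘ₗ D.prj (N + 1) 0 i = a 0 := by rw [ha]; rfl
    have h1 : ∀ k, ∑ i, D.inc (N + 1) (k + 1) i ∘ₗ D.prj (N + 1) (k + 1) i =
        a (k + 1) + b k := by
      intro k
      rw [ha, hb]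
      refine (Fin.sum_univ_add (M := Module.End ℂ (HH n (N + 1))) (a := mult N (k + 2))
        (b := mult N k) _).trans ?_
      simp only [Datum.inc, Datum.prj, Fin.addCases_left, Fin.addCases_right]
      congr 1
      refine Finset.sum_congr rfl fun i _ => LinearMap.ext fun v => ?_
      exact congrArg (up (D.inc N k i)) (hD.jw_idem (k + 1) _)
    have h2 : a N = 0 := by
      rw [ha]
      have : IsEmpty (Fin (mult N (N + 1))) := by rw [mult_eq_zero (by omega)]; infer_instance
      exact Fintype.sum_empty _
    have h3 : a (N + 1) = 0 := by
      rw [ha]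
      have : IsEmpty (Fin (mult N (N + 1 + 1))) := by rw [mult_eq_zero (by omega)]; infer_instance
      exact Fintype.sum_empty _
    have h4 : (LinearMap.id : Module.End ℂ (HH n (N + 1))) = ∑ k ∈ Finset.range (N + 1), ∑ i,
        up (D.inc N k i) ∘ₗ D.ampJw k ∘ₗ up (D.prj N k i) := by
      rw [← up_id, ← hD.sum_inc_prj N, up_sum]
      refine Finset.sum_congr rfl fun k _ => ?_
      rw [up_sum]
      refine Finset.sum_congr rfl fun i _ => ?_
      have : D.inc N k i ∘ₗ D.prj N k i = D.inc N k i ∘ₗ D.jw k ∘ₗ D.prj N k i :=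
        LinearMap.ext fun v => (hD.inc_jw N k i _).symm
      rw [this]
      rfl
    have h5 : ∑ i, up (D.inc N 0 i) ∘ₗ D.ampJw 0 ∘ₗ up (D.prj N 0 i) = b 0 := by rw [hb]; rfl
    have h6 : ∀ k, ∑ i, up (D.inc N (k + 1) i) ∘ₗ D.ampJw (k + 1) ∘ₗ up (D.prj N (k + 1) i) =
        b (k + 1) + a k := by
      intro k
      have : D.ampJw (k + 1) = D.jw (k + 2) + D.dn k ∘ₗ D.en k := by rw [hD.dn_en]; abel
      rw [ha, hb, this, ← Finset.sum_add_distrib]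
      refine Finset.sum_congr rfl fun i _ => ?_
      rw [LinearMap.add_comp, LinearMap.comp_add]
    rw [Finset.sum_range_succ', h0, Finset.sum_congr rfl fun k _ => h1 k, sum_range_shift a b h2 h3,
      h4, Finset.sum_range_succ' _ N, h5, Finset.sum_congr rfl fun k _ => h6 k]

theorem Datum.Generic.sum_mult_vdim (hD : D.Generic) :
    ∀ N, ∑ k ∈ Finset.range (N + 1), mult N k * D.vdim k = n ^ N
  | 0 => by simp [mult, D.vdim_zero]
  | N + 1 => by
    have h1 : ∀ k, mult (N + 1) (k + 1) * D.vdim (k + 1) =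
        mult N (k + 1 + 1) * D.vdim (k + 1) + mult N k * D.vdim (k + 1) := fun k => by
      rw [mult, add_mul]
    have h2 : ∀ k, n * (mult N (k + 1) * D.vdim (k + 1)) =
        mult N (k + 1) * D.vdim (k + 1 + 1) + mult N (k + 1) * D.vdim k := fun k => by
      rw [← mul_add, ← hD.vdim_rec]; ring
    have h3 : n * (mult N 0 * D.vdim 0) = mult N 0 * D.vdim (0 + 1) := by
      rw [D.vdim_zero, D.vdim_one]; ring
    have h4 : mult (N + 1) 0 * D.vdim 0 = mult N (0 + 1) * D.vdim 0 := rfl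
    rw [Finset.sum_range_succ' _ (N + 1), Finset.sum_congr rfl fun k _ => h1 k, h4, pow_succ',
      ← hD.sum_mult_vdim N, Finset.mul_sum,
      Finset.sum_range_succ' (fun k => n * (mult N k * D.vdim k)) N, h3,
      Finset.sum_congr rfl fun k _ => h2 k]
    refine sum_range_shift (fun k => mult N (k + 1) * D.vdim k)
      (fun k => mult N k * D.vdim (k + 1)) ?_ ?_
    · simp [mult_eq_zero (show N < N + 1 by omega)]
    · simp [mult_eq_zero (show N < N + 1 + 1 by omega)]

end Paths

/-! ### The commutant of the quantum algebra -/

section Commutant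

variable {n : ℕ} (D : Datum n) (z : ℂˣ)

/-- The cup, as an operator between tensor powers. -/
def Datum.cupH (N : ℕ) : HH n N →ₗ[ℂ] HH n (N + 2) := D.cup (HH n N)

/-- The cap, as an operator between tensor powers. -/
def Datum.capH (N : ℕ) : HH n (N + 2) →ₗ[ℂ] HH n N := D.cap (HH n N)

/-- The operator `|b⟩⟨b̄|` on the last two factors. -/
def Datum.lastX (N : ℕ) : Module.End ℂ (HH n (N + 2)) := D.cupH N ∘ₗ D.capH N

/-- The operators `X_j` on the model, extended by zero. -/
def Datum.XX : ∀ N, ℕ → Module.End ℂ (HH n N)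
  | 0, _ => 0
  | 1, _ => 0
  | N + 2, j => if j = N then D.lastX N else up (Datum.XX (N + 1) j)

/-- The algebra generated by the operators `X_j` on the model. -/
def Datum.TLA (N : ℕ) : Subalgebra ℂ (Module.End ℂ (HH n N)) :=
  Algebra.adjoin ℂ (Set.range (D.XX N))

theorem Datum.XX_eq_zero : ∀ {N j : ℕ}, N ≤ j + 1 → D.XX N j = 0
  | 0, _, _ => rfl
  | 1, _, _ => rfl
  | N + 2, j, h => by
    rw [Datum.XX, if_neg (by omega), Datum.XX_eq_zero (by omega)]; rfl

theorem Datum.lastX_mem (N : ℕ) : D.lastX N ∈ D.TLA (N + 2) :=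
  Algebra.subset_adjoin ⟨N, by rw [Datum.XX, if_pos rfl]⟩

theorem Datum.up_mem {N : ℕ} {x : Module.End ℂ (HH n N)} (hx : x ∈ D.TLA N) :
    up x ∈ D.TLA (N + 1) := by
  suffices h : D.TLA N ≤ (D.TLA (N + 1)).comap (ampHom n (HH n N)) from h hx
  refine Algebra.adjoin_le ?_
  rintro _ ⟨j, rfl⟩
  by_cases hj : N ≤ j + 1
  · rw [D.XX_eq_zero hj]
    exact zero_mem _
  · obtain ⟨M, rfl⟩ : ∃ M, N = M + 1 := ⟨N - 1, by omega⟩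
    refine Algebra.subset_adjoin ⟨j, ?_⟩
    rw [Datum.XX, if_neg (by omega)]
    rfl

theorem Datum.jw_mem : ∀ k, D.jw k ∈ D.TLA k
  | 0 => one_mem _
  | 1 => one_mem _
  | k + 2 => by
    have h : up (D.jw (k + 1)) ∈ D.TLA (k + 2) := D.up_mem (Datum.jw_mem (k + 1))
    exact sub_mem h (Subalgebra.smul_mem _ (mul_mem h (mul_mem (D.lastX_mem k) h)) _)

theorem Datum.intertw_lastX (N : ℕ) : Intertw 1 (D.TT z (N + 2)) (D.TT z (N + 2)) (D.lastX N) :=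
  D.intertw_cup_cap z (D.TT z N)

theorem Datum.intertw_XX : ∀ N j, Intertw 1 (D.TT z N) (D.TT z N) (D.XX N j)
  | 0, _ => Intertw.zero
  | 1, _ => Intertw.zero
  | N + 2, j => by
    rw [Datum.XX]
    split_ifs
    · exact D.intertw_lastX z N
    · exact Intertw.amp D z (Datum.intertw_XX (N + 1) j)

variable {D} in
theorem Datum.intertw_of_mem {N : ℕ} {x : Module.End ℂ (HH n N)} (hx : x ∈ D.TLA N) :
    Intertw 1 (D.TT z N) (D.TT z N) x := by
  induction hx using Algebra.adjoin_induction with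
  | mem x hx => obtain ⟨j, rfl⟩ := hx; exact D.intertw_XX z N j
  | algebraMap r => exact (Intertw.id).smul r
  | add x y _ _ hx hy => exact hx.add hy
  | mul x y _ _ hx hy => have := hx.comp hy; rwa [one_mul] at this

/-- The span of the operators `x X_{N+1} y`. -/
def Datum.capIdeal (N : ℕ) : Submodule ℂ (Module.End ℂ (HH n (N + 2))) :=
  Submodule.span ℂ {a | ∃ x ∈ D.TLA (N + 2), ∃ y ∈ D.TLA (N + 2), a = x * D.lastX N * y}

theorem Datum.up_lastX (N : ℕ) :
    up (D.lastX N) * D.lastX (N + 1) * up (D.lastX N) = up (D.lastX N) := by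
  refine LinearMap.ext fun v => ?_
  have e4 := fun w => LinearMap.congr_fun (D.amp_cap_cup (M := HH n N)) w
  have e5 := fun w => LinearMap.congr_fun (D.cap_amp_cup (M := HH n N)) w
  have h : ∀ w : Fin n → HH n N, amp n (D.cap (HH n N)) (D.cup (Fin n → HH n N)
      (D.cap (Fin n → HH n N) (amp n (D.cup (HH n N)) w))) = w := fun w => by
    rw [show D.cap (Fin n → HH n N) (amp n (D.cup (HH n N)) w) = w from e5 w]
    exact e4 w
  exact congrArg (amp n (D.cup (HH n N))) (h (amp n (D.cap (HH n N)) v))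

theorem Datum.up_capIdeal {N : ℕ} {a : Module.End ℂ (HH n (N + 2))} (ha : a ∈ D.capIdeal N) :
    up a ∈ D.capIdeal (N + 1) := by
  suffices h : D.capIdeal N ≤
      (D.capIdeal (N + 1)).comap (ampHom n (HH n (N + 2))).toLinearMap from h ha
  refine Submodule.span_le.2 ?_
  rintro _ ⟨x, hx, y, hy, rfl⟩
  have hX := D.up_mem (D.lastX_mem N)
  refine Submodule.subset_span ⟨up x * up (D.lastX N), mul_mem (D.up_mem hx) hX,
    up (D.lastX N) * up y, mul_mem hX (D.up_mem hy), ?_⟩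
  have : up x * up (D.lastX N) * D.lastX (N + 1) * (up (D.lastX N) * up y) =
      up x * (up (D.lastX N) * D.lastX (N + 1) * up (D.lastX N)) * up y := by
    simp only [mul_assoc]
  rw [this, D.up_lastX]
  rfl

theorem Datum.one_sub_jw_mem : ∀ N, 1 - D.jw (N + 2) ∈ D.capIdeal N
  | 0 => by
    have : 1 - D.jw 2 = D.coef 1 • (1 * D.lastX 0 * 1) := sub_sub_cancel _ _
    rw [this]
    exact Submodule.smul_mem _ _ (Submodule.subset_span ⟨1, one_mem _, 1, one_mem _, rfl⟩)
  | N + 1 => by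
    have h : up (D.jw (N + 2)) ∈ D.TLA (N + 3) := D.up_mem (D.jw_mem (N + 2))
    have : 1 - D.jw (N + 1 + 2) = up (1 - D.jw (N + 2)) + D.coef (N + 2) •
        (up (D.jw (N + 2)) * D.lastX (N + 1) * up (D.jw (N + 2))) :=
      (sub_add _ _ _).symm
    rw [this]
    exact Submodule.add_mem _ (D.up_capIdeal (Datum.one_sub_jw_mem N))
      (Submodule.smul_mem _ _ (Submodule.subset_span ⟨_, h, _, h, rfl⟩))

variable {D} {z}

theorem Datum.Generic.eq_zero_of_intertw_right (hD : D.Generic) (hn : 2 ≤ n) {N L : ℕ}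
    (hNL : N < L) {c : ℂˣ} {g : HH n N →ₗ[ℂ] HH n L} (hg : Intertw c (D.TT z N) (D.TT z L) g)
    (hL : ∀ v, D.jw L (g v) = g v) (v : HH n N) : g v = 0 := by
  have h := LinearMap.congr_fun (hD.sum_inc_prj N) v
  rw [LinearMap.id_apply] at h
  rw [← h]
  simp only [LinearMap.sum_apply, map_sum, LinearMap.comp_apply]
  refine Finset.sum_eq_zero fun k hk => Finset.sum_eq_zero fun i _ => ?_
  rw [Finset.mem_range] at hk
  obtain ⟨j, hj⟩ := Fin.exists_of_mult i
  rw [← hD.jw_prj]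
  exact hD.schur_zero hn (show k ≠ L by omega) (hg.comp (D.intertw_inc z N k i j hj))
    (fun v => hL _) _

theorem Datum.Generic.eq_zero_of_intertw_left (hD : D.Generic) (hn : 2 ≤ n) {N L : ℕ}
    (hNL : N < L) {c : ℂˣ} {g : HH n L →ₗ[ℂ] HH n N} (hg : Intertw c (D.TT z L) (D.TT z N) g)
    (v : HH n L) : g (D.jw L v) = 0 := by
  have h := LinearMap.congr_fun (hD.sum_inc_prj N) (g (D.jw L v))
  rw [LinearMap.id_apply] at h
  rw [← h]
  simp only [LinearMap.sum_apply, LinearMap.comp_apply]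
  refine Finset.sum_eq_zero fun k hk => Finset.sum_eq_zero fun i _ => ?_
  rw [Finset.mem_range] at hk
  obtain ⟨j, hj⟩ := Fin.exists_of_mult i
  have := hD.schur_zero hn (show L ≠ k by omega) ((D.intertw_prj z N k i j hj).comp hg)
    (fun v => hD.jw_prj N k i _) v
  rw [LinearMap.comp_apply] at this
  rw [this, map_zero]

theorem Datum.lastX_mul (D : Datum n) {N : ℕ} (f : Module.End ℂ (HH n (N + 2))) :
    D.lastX N * f * D.lastX N =
      up (up (D.capH N ∘ₗ f ∘ₗ D.cupH N)) * D.lastX N := by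
  refine LinearMap.ext fun v => ?_
  exact LinearMap.congr_fun (D.cup_amp (D.capH N ∘ₗ f ∘ₗ D.cupH N)) (D.capH N v)

/-- Operators commuting with the quantum algebra belong to the Temperley–Lieb algebra. -/
theorem Datum.Generic.mem_TLA (hD : D.Generic) (hn : 2 ≤ n) : ∀ {N : ℕ}
    {f : Module.End ℂ (HH n N)}, Intertw 1 (D.TT z N) (D.TT z N) f → f ∈ D.TLA N
  | 0, f, hf => by
    obtain ⟨a, ha⟩ := hD.schur_scalar hn hf fun _ => rfl
    have : f = a • 1 := LinearMap.ext ha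
    rw [this]
    exact Subalgebra.smul_mem _ (one_mem _) a
  | 1, f, hf => by
    obtain ⟨a, ha⟩ := hD.schur_scalar hn hf fun _ => rfl
    have : f = a • 1 := LinearMap.ext ha
    rw [this]
    exact Subalgebra.smul_mem _ (one_mem _) a
  | N + 2, f, hf => by
    obtain ⟨e, he⟩ : ∃ e, e = D.jw (N + 2) := ⟨_, rfl⟩
    have hemem : e ∈ D.TLA (N + 2) := he ▸ D.jw_mem _
    have hee : ∀ v, D.jw (N + 2) (e v) = e v := by
      intro v; rw [he]; exact hD.jw_idem _ v
    have heint : Intertw 1 (D.TT z (N + 2)) (D.TT z (N + 2)) e := he ▸ D.intertw_jw z _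
    have hcap : Intertw (z ^ 2 * D.q)⁻¹ (D.TT z (N + 2)) (D.TT z N) (D.capH N) :=
      D.intertw_cap z (D.TT z N)
    have hcup : Intertw (z ^ 2 * D.q) (D.TT z N) (D.TT z (N + 2)) (D.cupH N) :=
      D.intertw_cup z (D.TT z N)
    have h1 : ∀ a ∈ D.capIdeal N, e * f * a = 0 := by
      intro a ha
      induction ha using Submodule.span_induction with
      | mem a ha =>
        obtain ⟨x, hx, y, hy, rfl⟩ := ha
        refine LinearMap.ext fun v => ?_
        exact hD.eq_zero_of_intertw_right (z := z) hn (show N < N + 2 by omega)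
          (heint.comp (hf.comp ((D.intertw_of_mem z hx).comp hcup))) (fun v => hee _)
          (D.capH N (y v))
      | zero => exact mul_zero _
      | add a b _ _ ha hb => rw [mul_add, ha, hb, add_zero]
      | smul r a _ ha => rw [mul_smul_comm, ha, smul_zero]
    have h2 : ∀ a ∈ D.capIdeal N, a * f * e = 0 := by
      intro a ha
      induction ha using Submodule.span_induction with
      | mem a ha =>
        obtain ⟨x, hx, y, hy, rfl⟩ := ha
        refine LinearMap.ext fun v => ?_
        rw [he]
        have := hD.eq_zero_of_intertw_left (z := z) hn (show N < N + 2 by omega)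
          (hcap.comp ((D.intertw_of_mem z hy).comp hf)) v
        exact (congrArg (fun w => x (D.cupH N w)) this).trans (by simp)
      | zero => rw [zero_mul, zero_mul]
      | add a b _ _ ha hb => rw [add_mul, add_mul, ha, hb, add_zero]
      | smul r a _ ha => rw [smul_mul_assoc, smul_mul_assoc, ha, smul_zero]
    have h3 : ∀ a ∈ D.capIdeal N, ∀ b ∈ D.capIdeal N, a * f * b ∈ D.TLA (N + 2) := by
      intro a ha b hb
      induction ha using Submodule.span_induction with
      | mem a ha =>
        induction hb using Submodule.span_induction with
        | mem b hb =>
          obtain ⟨x, hx, y, hy, rfl⟩ := ha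
          obtain ⟨x', hx', y', hy', rfl⟩ := hb
          have hg := hcap.comp (((D.intertw_of_mem z hy).comp
            (hf.comp (D.intertw_of_mem z hx'))).comp hcup)
          rw [one_mul, one_mul, one_mul, inv_mul_cancel] at hg
          have hmem := D.up_mem (D.up_mem (Datum.Generic.mem_TLA hD hn hg))
          have e1 : x * D.lastX N * y * f * (x' * D.lastX N * y') =
              x * (D.lastX N * (y * (f * x')) * D.lastX N) * y' := by
            simp only [mul_assoc]
          rw [e1, D.lastX_mul]
          exact mul_mem (mul_mem hx (mul_mem hmem (D.lastX_mem N))) hy'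
        | zero => rw [mul_zero]; exact zero_mem _
        | add b c _ _ hb hc => rw [mul_add]; exact add_mem hb hc
        | smul r b _ hb => rw [mul_smul_comm]; exact Subalgebra.smul_mem _ hb r
      | zero => rw [zero_mul, zero_mul]; exact zero_mem _
      | add a b _ _ ha hb => rw [add_mul, add_mul]; exact add_mem ha hb
      | smul r a _ ha => rw [smul_mul_assoc, smul_mul_assoc]; exact Subalgebra.smul_mem _ ha r
    have ha : 1 - e ∈ D.capIdeal N := he ▸ D.one_sub_jw_mem N
    have hef : Intertw 1 (D.TT z (N + 2)) (D.TT z (N + 2)) (e * f) := by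
      have := heint.comp hf
      rwa [one_mul] at this
    obtain ⟨r, hr⟩ := hD.schur_scalar hn hef (fun v => hee _)
    have h4 : e * f * e = r • e := by
      refine LinearMap.ext fun v => ?_
      have := hr v
      rw [← he] at this
      exact this
    have h5 : f = e * f * e + e * f * (1 - e) + (1 - e) * f * e + (1 - e) * f * (1 - e) := by
      noncomm_ring
    rw [h5, h4, h1 _ ha, h2 _ ha, add_zero, add_zero]
    exact add_mem (Subalgebra.smul_mem _ hemem r) (h3 _ ha _ ha)

end Commutant

/-! ### Comparison of the model with the tensor power -/

section Compare

variable {n : ℕ}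

/-- The image in the model of a pure tensor. -/
def pureTensor (n : ℕ) : ∀ N, (Fin N → Fin n → ℂ) → HH n N
  | 0, _ => (1 : ℂ)
  | N + 1, f => fun c => f (Fin.last N) c • pureTensor n N (Fin.init f)

theorem pureTensor_succ {N : ℕ} (f : Fin (N + 1) → Fin n → ℂ) (c : Fin n) :
    pureTensor n (N + 1) f c = f (Fin.last N) c • pureTensor n N (Fin.init f) := rfl

theorem pureTensor_update_last {N : ℕ} (f : Fin (N + 1) → Fin n → ℂ) (w : Fin n → ℂ) :
    pureTensor n (N + 1) (Function.update f (Fin.last N) w) =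
      fun c => w c • pureTensor n N (Fin.init f) := by
  funext c
  rw [pureTensor_succ, Fin.init_update_last, Function.update_self]

theorem pureTensor_update_castSucc {N : ℕ} (f : Fin (N + 1) → Fin n → ℂ) (l : Fin N)
    (w : Fin n → ℂ) :
    pureTensor n (N + 1) (Function.update f l.castSucc w) =
      fun c => f (Fin.last N) c • pureTensor n N (Function.update (Fin.init f) l w) := by
  funext c
  rw [pureTensor_succ, Fin.init_update_castSucc,
    Function.update_of_ne (Fin.castSucc_lt_last l).ne']

theorem pureTensor_add : ∀ N (f : Fin N → Fin n → ℂ) (l : Fin N) (x y : Fin n → ℂ),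
    pureTensor n N (Function.update f l (x + y)) =
      pureTensor n N (Function.update f l x) + pureTensor n N (Function.update f l y)
  | 0, _, l, _, _ => Fin.elim0 l
  | N + 1, f, l, x, y => by
    refine Fin.lastCases ?_ (fun l => ?_) l
    · simp only [pureTensor_update_last]
      exact funext fun c => add_smul _ _ _
    · simp only [pureTensor_update_castSucc, pureTensor_add N]
      exact funext fun c => smul_add _ _ _

theorem pureTensor_smul : ∀ N (f : Fin N → Fin n → ℂ) (l : Fin N) (a : ℂ) (x : Fin n → ℂ),
    pureTensor n N (Function.update f l (a • x)) = a • pureTensor n N (Function.update f l x)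
  | 0, _, l, _, _ => Fin.elim0 l
  | N + 1, f, l, a, x => by
    refine Fin.lastCases ?_ (fun l => ?_) l
    · simp only [pureTensor_update_last]
      exact funext fun c => mul_smul _ _ _
    · simp only [pureTensor_update_castSucc, pureTensor_smul N]
      exact funext fun c => smul_comm _ _ _

/-- The image in the model of a pure tensor, as a multilinear map. -/
def pureTensorM (n N : ℕ) : MultilinearMap ℂ (fun _ : Fin N => Fin n → ℂ) (HH n N) where
  toFun := pureTensor n N
  map_update_add' f l x y := by
    convert pureTensor_add N f l x y
  map_update_smul' f l a x := by
    convert pureTensor_smul N f l a x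

theorem span_pureTensor (n : ℕ) :
    ∀ N, Submodule.span ℂ (Set.range (pureTensor n N)) = ⊤
  | 0 => by
    rw [eq_top_iff]
    intro v _
    have h : v = (show ℂ from v) • pureTensor n 0 (Fin.elim0) := (mul_one (show ℂ from v)).symm
    rw [h]
    exact Submodule.smul_mem _ _ (Submodule.subset_span ⟨_, rfl⟩)
  | N + 1 => by
    rw [eq_top_iff]
    intro v _
    have h1 : v = ∑ c, LinearMap.single ℂ (fun _ : Fin n => HH n N) c (v c) :=
      (Finset.univ_sum_single (M := fun _ : Fin n => HH n N) v).symm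
    rw [h1]
    refine Submodule.sum_mem _ fun c _ => ?_
    suffices h : Submodule.span ℂ (Set.range (pureTensor n N)) ≤
        (Submodule.span ℂ (Set.range (pureTensor n (N + 1)))).comap
          (LinearMap.single ℂ (fun _ : Fin n => HH n N) c) from
      h (by rw [span_pureTensor n N]; trivial)
    refine Submodule.span_le.2 ?_
    rintro _ ⟨f, rfl⟩
    refine Submodule.subset_span ⟨Fin.snoc (α := fun _ => Fin n → ℂ) f (Pi.single c 1), ?_⟩
    refine funext fun d => ?_
    rw [pureTensor_succ, Fin.init_snoc, Fin.snoc_last]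
    by_cases hd : d = c
    · subst hd; simp
    · simp [hd]

theorem finrank_H (n N : ℕ) : Module.finrank ℂ (H n N) = n ^ N := by
  rw [Module.finrank_eq_card_basis
    (Basis.piTensorProduct fun _ : Fin N => Pi.basisFun ℂ (Fin n))]
  simp

instance (n N : ℕ) : Module.Finite ℂ (H n N) :=
  Module.Finite.of_basis (Basis.piTensorProduct fun _ : Fin N => Pi.basisFun ℂ (Fin n))

theorem lift_pureTensor_surjective (n N : ℕ) :
    Function.Surjective (PiTensorProduct.lift (pureTensorM n N)) := by
  rw [← LinearMap.range_eq_top, eq_top_iff, ← span_pureTensor n N, Submodule.span_le]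
  rintro _ ⟨f, rfl⟩
  exact ⟨PiTensorProduct.tprod ℂ f, PiTensorProduct.lift.tprod f⟩

/-- The identification of the tensor power with the model. -/
def toHH (n N : ℕ) : H n N ≃ₗ[ℂ] HH n N :=
  LinearEquiv.ofBijective (PiTensorProduct.lift (pureTensorM n N))
    ⟨(LinearMap.injective_iff_surjective_of_finrank_eq_finrank
      ((finrank_H n N).trans (HH.finrank n N).symm)).2 (lift_pureTensor_surjective n N),
      lift_pureTensor_surjective n N⟩

theorem toHH_tprod {N : ℕ} (f : Fin N → Fin n → ℂ) :
    toHH n N (PiTensorProduct.tprod ℂ f) = pureTensor n N f :=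
  PiTensorProduct.lift.tprod f

/-- The action of a matrix on the index of a tuple. -/
def matAct {M : Type*} [AddCommGroup M] [Module ℂ M] (A : Matrix (Fin n) (Fin n) ℂ) :
    Module.End ℂ (Fin n → M) :=
  LinearMap.pi fun c => ∑ x, A c x • LinearMap.proj x

theorem matAct_apply {M : Type*} [AddCommGroup M] [Module ℂ M] (A : Matrix (Fin n) (Fin n) ℂ)
    (v : Fin n → M) (c : Fin n) : matAct A v c = ∑ x, A c x • v x := by
  simp [matAct, LinearMap.sum_apply]

/-- The operator acting as `A` on the `l`-th factor, in the model. -/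
def siteH (A : Matrix (Fin n) (Fin n) ℂ) : ∀ N, Fin N → Module.End ℂ (HH n N)
  | 0, l => Fin.elim0 l
  | N + 1, l => Fin.lastCases (motive := fun _ => Module.End ℂ (HH n (N + 1)))
      (matAct (M := HH n N) A) (fun l => up (siteH A N l)) l

theorem siteH_last (A : Matrix (Fin n) (Fin n) ℂ) (N : ℕ) :
    siteH A (N + 1) (Fin.last N) = matAct (M := HH n N) A := by
  rw [siteH.eq_2]
  exact Fin.lastCases_last (motive := fun _ => Module.End ℂ (HH n (N + 1)))

theorem siteH_castSucc (A : Matrix (Fin n) (Fin n) ℂ) (N : ℕ) (l : Fin N) :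
    siteH A (N + 1) l.castSucc = up (siteH A N l) := by
  rw [siteH.eq_2]
  exact Fin.lastCases_castSucc (motive := fun _ => Module.End ℂ (HH n (N + 1))) l

theorem siteH_pureTensor (A : Matrix (Fin n) (Fin n) ℂ) :
    ∀ N (l : Fin N) (f : Fin N → Fin n → ℂ),
      siteH A N l (pureTensor n N f) = pureTensor n N (Function.update f l (A.mulVec (f l)))
  | 0, l, _ => Fin.elim0 l
  | N + 1, l, f => by
    refine Fin.lastCases ?_ (fun l => ?_) l
    · rw [siteH_last, pureTensor_update_last]
      refine funext fun c => (matAct_apply _ _ _).trans ?_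
      simp only [pureTensor_succ, smul_smul, ← Finset.sum_smul]
      rfl
    · rw [siteH_castSucc, pureTensor_update_castSucc]
      refine funext fun c => ?_
      rw [up_apply, pureTensor_succ, map_smul, siteH_pureTensor A N]
      rfl

theorem toHH_site {N : ℕ} (l : Fin N) (A : Matrix (Fin n) (Fin n) ℂ) (h : H n N) :
    toHH n N (site l A h) = siteH A N l (toHH n N h) := by
  suffices e : (toHH n N).toLinearMap ∘ₗ site l A = siteH A N l ∘ₗ (toHH n N).toLinearMap from
    LinearMap.congr_fun e h
  refine PiTensorProduct.ext (MultilinearMap.ext fun f => ?_)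
  simp only [LinearMap.compMultilinearMap_apply, LinearMap.comp_apply, LinearEquiv.coe_coe]
  rw [toHH_tprod, siteH_pureTensor, ← toHH_tprod]
  congr 1
  refine (PiTensorProduct.map_tprod _ _).trans ?_
  congr 1
  funext i
  by_cases hi : i = l
  · subst hi
    simp
  · simp [hi]

/-- The identification of operators on the tensor power with operators on the model. -/
def toEnd (n N : ℕ) : Module.End ℂ (H n N) ≃ₐ[ℂ] Module.End ℂ (HH n N) :=
  (toHH n N).conjAlgEquiv ℂ

theorem toEnd_apply {N : ℕ} (f : Module.End ℂ (H n N)) (h : H n N) :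
    toEnd n N f (toHH n N h) = toHH n N (f h) := by
  simp [toEnd, LinearEquiv.conjAlgEquiv_apply_apply]

theorem toEnd_site {N : ℕ} (l : Fin N) (A : Matrix (Fin n) (Fin n) ℂ) :
    toEnd n N (site l A) = siteH A N l := by
  refine LinearMap.ext fun v => ?_
  obtain ⟨h, rfl⟩ := (toHH n N).surjective v
  rw [toEnd_apply, toHH_site]

variable (D : Datum n) (z : ℂˣ)

/-- The matrix of operators on the model coming from the product of the L-operators. -/
def Datum.TH (ε : Sgn) (N : ℕ) : Matrix (Fin n) (Fin n) (Module.End ℂ (HH n N)) :=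
  (List.ofFn fun l : Fin N => (D.fundL z ε).map fun A => siteH A N l).reverse.prod

theorem Datum.T_map_toEnd (ε : Sgn) (N : ℕ) :
    (D.T z N ε).map (toEnd n N) = D.TH z ε N := by
  have : (D.T z N ε).map (toEnd n N) =
    (toEnd n N).toAlgHom.toRingHom.mapMatrix (D.T z N ε) := rfl
  rw [this, Datum.T, map_list_prod, List.map_reverse, List.map_ofFn, Datum.TH]
  congr 3
  exact funext fun l => Matrix.ext fun i j => toEnd_site l _

/-- The map `f ↦ f ⊗ 1` as an algebra homomorphism. -/
def upHom (n N : ℕ) : Module.End ℂ (HH n N) →ₐ[ℂ] Module.End ℂ (HH n (N + 1)) :=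
  ampHom n (HH n N)

theorem Datum.TH_succ (ε : Sgn) (N : ℕ) : D.TH z ε (N + 1) =
    ((D.fundL z ε).map fun A => siteH A (N + 1) (Fin.last N)) *
      (D.TH z ε N).map (upHom n N) := by
  have : (D.TH z ε N).map (upHom n N) =
    (upHom n N).toRingHom.mapMatrix (D.TH z ε N) := rfl
  rw [this, Datum.TH, Datum.TH, map_list_prod, List.map_reverse, List.map_ofFn,
    List.ofFn_succ', List.concat_eq_append, List.reverse_append, List.reverse_singleton,
    List.singleton_append, List.prod_cons]
  congr 4
  exact funext fun l => Matrix.ext fun i j => siteH_castSucc _ N l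

theorem Datum.fundL_apply (ε : Sgn) (i m c x : Fin n) : D.fundL z ε i m c x =
    Sgn.pow z ε * (Sgn.pow D.q ε * (if c = m then 1 else 0) * (if i = x then 1 else 0) +
      D.B c i * D.Bi m x) := by
  cases ε with
  | plus => rw [D.fundL_plus]; rfl
  | minus => rw [D.fundL_minus, ← Units.val_inv_eq_inv_val]; rfl

theorem Datum.TH_eq (ε : Sgn) : ∀ N i j, D.TH z ε N i j = D.TT z N ε i j
  | 0, i, j => by
    simp [Datum.TH, Datum.TT, Matrix.one_apply]
  | N + 1, i, j => by
    rw [D.TH_succ, Matrix.mul_apply]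
    have h : ∀ (A : Fin n → Fin n → Module.End ℂ (HH n N)), ∑ m,
        matAct (M := HH n N) (D.fundL z ε i m) * amp n (A m j) =
          D.step z (fun _ => A) ε i j := by
      intro A
      refine LinearMap.ext fun v => funext fun c => ?_
      rw [LinearMap.sum_apply, Finset.sum_apply, D.step_apply]
      simp only [Module.End.mul_apply, matAct_apply, amp_apply, D.fundL_apply]
      have h1 : ∀ m x, (Sgn.pow z ε * (Sgn.pow D.q ε * (if c = m then 1 else 0) *
          (if i = x then 1 else 0) + D.B c i * D.Bi m x)) • A m j (v x) =
          Sgn.pow z ε • ((if i = x then (if c = m then Sgn.pow D.q ε • A m j (v x) else 0) else 0)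
            + D.B c i • D.Bi m x • A m j (v x)) := by
        intro m x
        split_ifs <;> module
      simp only [h1, ← Finset.smul_sum, Finset.sum_add_distrib, D.contr_apply]
      simp
    have h2 : ∀ m, (D.TH z ε N).map (upHom n N) m j = up (D.TT z N ε m j) := by
      intro m
      rw [← Datum.TH_eq ε N m j]
      rfl
    have h3 := h (D.TT z N ε)
    refine Eq.trans (Finset.sum_congr rfl fun m _ => ?_) h3
    rw [h2]
    exact congrArg (· * _) (siteH_last _ N)

theorem Datum.toEnd_T (ε : Sgn) (N : ℕ) (i j : Fin n) :
    toEnd n N (D.T z N ε i j) = D.TT z N ε i j := by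
  rw [← D.TH_eq, ← D.T_map_toEnd]; rfl

/-- The operator `X` on two factors of the model. -/
def Datum.twoH (N : ℕ) (l m : Fin N) : Module.End ℂ (HH n N) :=
  ∑ c, ∑ d, ∑ x, ∑ y, D.X (c, d) (x, y) •
    (siteH (Matrix.single c x 1) N l * siteH (Matrix.single d y 1) N m)

theorem Datum.toEnd_twoSite {N : ℕ} (l m : Fin N) :
    toEnd n N (twoSite l m D.X) = D.twoH N l m := by
  simp only [twoSite, map_sum, map_smul, map_mul, toEnd_site]
  rfl

theorem Datum.twoH_castSucc {N : ℕ} (l m : Fin N) :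
    D.twoH (N + 1) l.castSucc m.castSucc = up (D.twoH N l m) := by
  have : up (D.twoH N l m) = upHom n N (D.twoH N l m) := rfl
  rw [this]
  simp only [Datum.twoH, map_sum, map_smul, map_mul, siteH_castSucc]
  rfl

theorem Datum.twoH_last (N : ℕ) :
    D.twoH (N + 2) (Fin.last N).castSucc (Fin.last (N + 1)) = D.lastX N := by
  have h : ∑ c, ∑ d, ∑ x, ∑ y, D.X (c, d) (x, y) •
      (amp n (matAct (M := HH n N) (Matrix.single c x 1)) *
        matAct (M := Fin n → HH n N) (Matrix.single d y 1)) = D.cup (HH n N) ∘ₗ D.cap (HH n N) := by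
    refine LinearMap.ext fun v => funext fun d => funext fun c => ?_
    have h1 : ∀ a b x y, (D.X (a, b) (x, y) •
      (amp n (matAct (M := HH n N) (Matrix.single a x 1)) *
        matAct (M := Fin n → HH n N) (Matrix.single b y 1))) v d c =
        if a = c then (if b = d then (D.B c d * D.Bi x y) • v y x else 0) else 0 := by
      intro a b x y
      simp only [LinearMap.smul_apply, Module.End.mul_apply, Pi.smul_apply, amp_apply,
        matAct_apply, Matrix.single_apply, Finset.sum_apply, Datum.X, Matrix.of_apply]
      by_cases ha : a = c <;> by_cases hb : b = d <;> simp [ha, hb]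
    simp only [LinearMap.sum_apply, Finset.sum_apply, h1]
    rw [Finset.sum_eq_single c (by intro b _ hb; simp [hb]) (by simp),
      Finset.sum_eq_single d (by intro b _ hb; simp [hb]) (by simp)]
    simp [D.cap_apply, Finset.smul_sum, smul_smul]
  refine Eq.trans ?_ h
  simp only [Datum.twoH, siteH_castSucc, siteH_last]
  rfl

theorem Datum.twoH_eq : ∀ (N j : ℕ) (h : j + 1 < N),
    D.twoH N ⟨j, by omega⟩ ⟨j + 1, h⟩ = D.XX N j
  | 0, _, h => by omega
  | 1, _, h => by omega
  | N + 2, j, h => by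
    rw [Datum.XX]
    split_ifs with hj
    · subst hj
      exact D.twoH_last j
    · rw [← Datum.twoH_eq (N + 1) j (by omega), ← D.twoH_castSucc]
      rfl

theorem Datum.toEnd_tlX {N : ℕ} (j : Fin (N - 1)) :
    toEnd n N (D.tlX N j) = D.XX N j := by
  rw [Datum.tlX, D.toEnd_twoSite, D.twoH_eq]

end Compare

/-! ### The images of the two algebras are each other's centralizers -/

section Generation

variable {n : ℕ} {D : Datum n}

theorem Uq.induction {P : Uq D → Prop} (algebraMap : ∀ r, P (algebraMap ℂ (Uq D) r))
    (gen : ∀ ε i j, P (Uq.L D ε i j)) (mul : ∀ a b, P a → P b → P (a * b))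
    (add : ∀ a b, P a → P b → P (a + b)) (u : Uq D) : P u := by
  obtain ⟨a, rfl⟩ := RingQuot.mkAlgHom_surjective ℂ (UqRel D) u
  induction a using FreeAlgebra.induction with
  | grade0 r => rw [AlgHom.commutes]; exact algebraMap r
  | grade1 x => exact gen x.1 x.2.1 x.2.2
  | mul a b ha hb => rw [map_mul]; exact mul _ _ ha hb
  | add a b ha hb => rw [map_add]; exact add _ _ ha hb

theorem TL.induction {N : ℕ} {q : ℂˣ} {P : TL N q → Prop}
    (algebraMap : ∀ r, P (algebraMap ℂ (TL N q) r))
    (gen : ∀ j, P (TL.gen j)) (mul : ∀ a b, P a → P b → P (a * b))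
    (add : ∀ a b, P a → P b → P (a + b)) (t : TL N q) : P t := by
  obtain ⟨a, rfl⟩ := RingQuot.mkAlgHom_surjective ℂ (TLRel N q) t
  induction a using FreeAlgebra.induction with
  | grade0 r => rw [AlgHom.commutes]; exact algebraMap r
  | grade1 x => exact gen x
  | mul a b ha hb => rw [map_mul]; exact mul _ _ ha hb
  | add a b ha hb => rw [map_add]; exact add _ _ ha hb

variable (D) (z : ℂˣ) (N : ℕ)

theorem tlRep_gen (j : Fin (N - 1)) : tlRep D N (TL.gen j) = D.tlX N j := by
  simp [tlRep, TL.gen]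

theorem rho_L (ε : Sgn) (i j : Fin n) : rho D z N (Uq.L D ε i j) = D.T z N ε i j :=
  Uq.lift_L _ _ _ _ _ _

/-- The action of the quantum algebra on the model. -/
def rhoH : Uq D →ₐ[ℂ] Module.End ℂ (HH n N) := (toEnd n N).toAlgHom.comp (rho D z N)

theorem rhoH_L (ε : Sgn) (i j : Fin n) : rhoH D z N (Uq.L D ε i j) = D.TT z N ε i j := by
  rw [← D.toEnd_T, ← rho_L]; rfl

theorem Uq.twist_L (c : ℂˣ) (ε : Sgn) (i j : Fin n) :
    Uq.twist D c (Uq.L D ε i j) = Sgn.pow c ε • Uq.L D ε i j :=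
  Uq.lift_L _ _ _ _ _ _

variable {D z N}

theorem Intertw.rhoH {N k : ℕ} {c : ℂˣ} {f : HH n k →ₗ[ℂ] HH n N}
    (hf : Intertw c (D.TT z k) (D.TT z N) f) (u : Uq D) (m : HH n k) :
    rhoH D z N u (f m) = f (rhoH D z k (Uq.twist D c u) m) := by
  induction u using Uq.induction generalizing m with
  | algebraMap r => simp [Algebra.algebraMap_eq_smul_one]
  | gen ε i j => rw [rhoH_L, hf, Uq.twist_L, map_smul, rhoH_L]; simp
  | mul a b ha hb => simp only [map_mul, Module.End.mul_apply, ha, hb]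
  | add a b ha hb => simp only [map_add, LinearMap.add_apply, ha, hb]

theorem Uq.twist_one (u : Uq D) : Uq.twist D 1 u = u := by
  induction u using Uq.induction with
  | algebraMap r => exact AlgHom.commutes _ r
  | gen ε i j => rw [Uq.twist_L, Sgn.pow_one, one_smul]
  | mul a b ha hb => rw [map_mul, ha, hb]
  | add a b ha hb => rw [map_add, ha, hb]

theorem intertw_of_forall_commute {f : Module.End ℂ (HH n N)}
    (hf : ∀ u, Commute (rhoH D z N u) f) : Intertw 1 (D.TT z N) (D.TT z N) f := by
  intro ε i j m
  have := LinearMap.congr_fun (hf (Uq.L D ε i j)).eq m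
  rw [rhoH_L] at this
  rw [Sgn.pow_one, one_smul]
  exact this

theorem Intertw.commute {f : Module.End ℂ (HH n N)}
    (hf : Intertw 1 (D.TT z N) (D.TT z N) f) (u : Uq D) : Commute (TLDuality.rhoH D z N u) f := by
  refine LinearMap.ext fun m => ?_
  have := hf.rhoH u m
  rwa [Uq.twist_one] at this

theorem Inv.rhoH {S : Submodule ℂ (HH n N)} (hS : Inv (D.TT z N) S) (u : Uq D) {m : HH n N}
    (hm : m ∈ S) : TLDuality.rhoH D z N u m ∈ S := by
  induction u using Uq.induction generalizing m with
  | algebraMap r =>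
    rw [AlgHom.commutes, Algebra.algebraMap_eq_smul_one]
    exact S.smul_mem r hm
  | gen ε i j => rw [rhoH_L]; exact hS ε i j m hm
  | mul a b ha hb => rw [map_mul]; exact ha (hb hm)
  | add a b ha hb => rw [map_add]; exact S.add_mem (ha hm) (hb hm)

variable (D N) in
/-- The action of the Temperley–Lieb algebra on the model. -/
def tlH : TL N D.q →ₐ[ℂ] Module.End ℂ (HH n N) := (toEnd n N).toAlgHom.comp (tlRep D N)

variable (D N) in
theorem tlH_range : (tlH D N).range = D.TLA N := by
  refine le_antisymm ?_ (Algebra.adjoin_le ?_)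
  · rintro _ ⟨t, rfl⟩
    show tlH D N t ∈ D.TLA N
    induction t using TL.induction with
    | algebraMap r => rw [AlgHom.commutes]; exact Subalgebra.algebraMap_mem _ r
    | gen j =>
      have : tlH D N (TL.gen j) = D.XX N j := by rw [← D.toEnd_tlX, ← tlRep_gen]; rfl
      rw [this]
      exact Algebra.subset_adjoin ⟨j, rfl⟩
    | mul a b ha hb => rw [map_mul]; exact mul_mem ha hb
    | add a b ha hb => rw [map_add]; exact add_mem ha hb
  · rintro _ ⟨j, rfl⟩
    by_cases hj : N ≤ j + 1
    · rw [D.XX_eq_zero hj]; exact zero_mem _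
    · refine ⟨TL.gen ⟨j, by omega⟩, ?_⟩
      have := D.toEnd_tlX (N := N) ⟨j, by omega⟩
      rw [← tlRep_gen] at this
      exact this

theorem Datum.Generic.mem_tlH_range (hD : D.Generic) (hn : 2 ≤ n) {f : Module.End ℂ (HH n N)} :
    f ∈ (tlH D N).range ↔ ∀ u, Commute (rhoH D z N u) f := by
  rw [tlH_range]
  exact ⟨fun h => (D.intertw_of_mem z h).commute,
    fun h => hD.mem_TLA hn (intertw_of_forall_commute h)⟩

theorem mem_of_forall_commute {M : Type*} [AddCommGroup M] [Module ℂ M] [Module.Finite ℂ M]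
    (R : Subalgebra ℂ (Module.End ℂ M)) [IsSemisimpleModule R M] {f : Module.End ℂ M}
    (hf : ∀ g, (∀ r ∈ R, Commute r g) → Commute g f) : f ∈ R := by
  have hlin : ∀ (g : Module.End R M) (m : M), f (g m) = g (f m) := by
    intro g m
    refine (LinearMap.congr_fun (hf (g.restrictScalars ℂ) fun r hr => ?_).eq m).symm
    exact LinearMap.ext fun x => (g.map_smul (⟨r, hr⟩ : R) x).symm
  let F : Module.End (Module.End R M) M :=
    { toFun := f, map_add' := f.map_add, map_smul' := hlin }
  obtain ⟨s, hs⟩ := Module.Finite.fg_top (R := ℂ) (M := M)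
  obtain ⟨r, hr⟩ := jacobson_density F s
  have : f = r := by
    refine LinearMap.ext_on_range (v := fun x : s => (x : M)) ?_ fun x => hr x x.2
    simpa using hs
  rw [this]
  exact r.2

/-- The submodule spanned by the image of `V_k` along a path. -/
def Datum.Generic.pathSubmodule (hD : D.Generic) (z : ℂˣ) (N k : ℕ) (i : Fin (mult N k)) :
    Submodule (rhoH D z N).range (HH n N) where
  carrier := (D.VV k).map (D.inc N k i)
  add_mem' := Submodule.add_mem _
  zero_mem' := Submodule.zero_mem _
  smul_mem' := by
    rintro ⟨_, u, rfl⟩ _ ⟨v, hv, rfl⟩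
    obtain ⟨j, hj⟩ := Fin.exists_of_mult i
    exact ⟨_, (hD.inv_VV k).rhoH _ hv, ((D.intertw_inc z N k i j hj).rhoH u v).symm⟩

theorem Datum.Generic.isSemisimple_pathSubmodule (hD : D.Generic) (z : ℂˣ) (N k : ℕ)
    (i : Fin (mult N k)) :
    IsSemisimpleModule (rhoH D z N).range (hD.pathSubmodule z N k i) := by
  obtain ⟨j, hj⟩ := Fin.exists_of_mult i
  have hint := D.intertw_inc z N k i j hj
  by_cases h0 : hD.pathSubmodule z N k i = ⊥
  · have : Subsingleton (hD.pathSubmodule z N k i) := Submodule.subsingleton_iff_eq_bot.2 h0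
    exact (isSemisimpleModule_iff _ _).2 Subsingleton.instComplementedLattice
  · have hs : IsSimpleModule (rhoH D z N).range (hD.pathSubmodule z N k i) := by
      rw [isSimpleModule_iff_isAtom]
      refine ⟨h0, fun S hS => ?_⟩
      by_contra hne
      refine hS.not_ge ?_
      have hinv : Inv (D.TT z k) (D.VV k ⊓ (S.restrictScalars ℂ).comap (D.inc N k i)) := by
        intro ε a b v hv
        refine ⟨hD.inv_VV k ε a b v hv.1, ?_⟩
        have h1 : D.TT z N ε a b (D.inc N k i v) ∈ S.restrictScalars ℂ :=
          S.smul_mem (⟨D.TT z N ε a b, Uq.L D ε a b, rhoH_L D z N ε a b⟩ : (rhoH D z N).range) hv.2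
        rw [hint] at h1
        exact ((S.restrictScalars ℂ).smul_mem_iff (Sgn.pow_ne_zero _ ε)).1 h1
      have htop := hD.eq_top_of_inv hinv inf_le_left (by
        intro hbot
        apply hne
        rw [eq_bot_iff]
        intro x hx
        obtain ⟨v, hv, rfl⟩ := hS.le hx
        have : v ∈ D.VV k ⊓ (S.restrictScalars ℂ).comap (D.inc N k i) := ⟨hv, hx⟩
        rw [hbot, Submodule.mem_bot] at this
        rw [this, map_zero]
        exact Submodule.zero_mem _)
      rintro _ ⟨v, hv, rfl⟩
      have hv' : v ∈ D.VV k := hv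
      rw [← htop] at hv'
      exact hv'.2
    infer_instance

theorem Datum.Generic.isSemisimple (hD : D.Generic) (z : ℂˣ) (N : ℕ) :
    IsSemisimpleModule (rhoH D z N).range (HH n N) := by
  refine isSemisimpleModule_of_isSemisimpleModule_submodule'
    (p := fun x : Σ k : ℕ, Fin (mult N k) => hD.pathSubmodule z N x.1 x.2)
    (fun x => hD.isSemisimple_pathSubmodule z N x.1 x.2) ?_
  rw [eq_top_iff]
  intro v _
  have h := LinearMap.congr_fun (hD.sum_inc_prj N) v
  rw [LinearMap.id_apply] at h
  rw [← h]
  simp only [LinearMap.sum_apply, LinearMap.comp_apply]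
  refine Submodule.sum_mem _ fun k _ => Submodule.sum_mem _ fun i _ => ?_
  exact Submodule.mem_iSup_of_mem (p := fun x : Σ k : ℕ, Fin (mult N k) =>
    hD.pathSubmodule z N x.1 x.2) ⟨k, i⟩ ⟨_, hD.mem_VV.2 (hD.jw_prj N k i v), rfl⟩

theorem Datum.Generic.mem_rhoH_range (hD : D.Generic) (hn : 2 ≤ n) {f : Module.End ℂ (HH n N)} :
    f ∈ (rhoH D z N).range ↔ ∀ t, Commute (tlH D N t) f := by
  constructor
  · rintro ⟨u, rfl⟩ t
    exact ((hD.mem_tlH_range hn).1 ⟨t, rfl⟩ u).symm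
  · intro h
    have := hD.isSemisimple z N
    refine mem_of_forall_commute _ fun g hg => ?_
    obtain ⟨t, rfl⟩ := (hD.mem_tlH_range (z := z) hn).2 fun u => hg _ ⟨u, rfl⟩
    exact h t

theorem mem_range_comp_toEnd {A : Type*} [Semiring A] [Algebra ℂ A]
    (σ : A →ₐ[ℂ] Module.End ℂ (H n N)) (f : Module.End ℂ (H n N)) :
    f ∈ σ.range ↔ toEnd n N f ∈ ((toEnd n N).toAlgHom.comp σ).range := by
  constructor
  · rintro ⟨a, rfl⟩
    exact ⟨a, rfl⟩
  · rintro ⟨a, ha⟩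
    exact ⟨a, (toEnd n N).injective ha⟩

theorem centralizer_range_eq {A A' : Type*} [Semiring A] [Algebra ℂ A] [Semiring A']
    [Algebra ℂ A'] (σ : A →ₐ[ℂ] Module.End ℂ (H n N)) (τ : A' →ₐ[ℂ] Module.End ℂ (H n N))
    (h : ∀ f, f ∈ ((toEnd n N).toAlgHom.comp τ).range ↔
      ∀ a, Commute ((toEnd n N).toAlgHom.comp σ a) f) :
    Subalgebra.centralizer ℂ (σ.range : Set (Module.End ℂ (H n N))) = τ.range := by
  ext f
  rw [mem_range_comp_toEnd, h, Subalgebra.mem_centralizer_iff]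
  constructor
  · intro hf a
    have := congrArg (toEnd n N) (hf _ ⟨a, rfl⟩)
    rw [map_mul, map_mul] at this
    exact this
  · rintro hf _ ⟨a, rfl⟩
    apply (toEnd n N).injective
    rw [map_mul, map_mul]
    exact hf a

theorem Datum.Generic.centralizer_rho (hD : D.Generic) (hn : 2 ≤ n) (z : ℂˣ) (N : ℕ) :
    Subalgebra.centralizer ℂ ((rho D z N).range : Set (Module.End ℂ (H n N))) =
      (tlRep D N).range :=
  centralizer_range_eq _ _ fun _ => hD.mem_tlH_range hn

theorem Datum.Generic.centralizer_tlRep (hD : D.Generic) (hn : 2 ≤ n) (z : ℂˣ) (N : ℕ) :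
    Subalgebra.centralizer ℂ ((tlRep D N).range : Set (Module.End ℂ (H n N))) =
      (rho D z N).range :=
  centralizer_range_eq _ _ fun _ => hD.mem_rhoH_range hn

end Generation

/-! ### The irreducible modules of the quantum algebra -/

section Irreps

variable {n : ℕ} (D : Datum n) (z : ℂˣ)

/-- The inclusion of `V_k`, in coordinates. -/
def Datum.incl (k : ℕ) : (Fin (D.vdim k) → ℂ) →ₗ[ℂ] HH n k :=
  (D.VV k).subtype ∘ₗ (Module.finBasis ℂ (D.VV k)).equivFun.symm.toLinearMap

/-- The projection to `V_k`, in coordinates. -/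
def Datum.coord (k : ℕ) : HH n k →ₗ[ℂ] (Fin (D.vdim k) → ℂ) :=
  (Module.finBasis ℂ (D.VV k)).equivFun.toLinearMap ∘ₗ (D.jw k).rangeRestrict

theorem Datum.incl_mem (k : ℕ) (v : Fin (D.vdim k) → ℂ) : D.incl k v ∈ D.VV k :=
  Subtype.prop _

theorem Datum.incl_coord (k : ℕ) (v : HH n k) : D.incl k (D.coord k v) = D.jw k v :=
  congrArg Subtype.val ((Module.finBasis ℂ (D.VV k)).equivFun.symm_apply_apply
    ((D.jw k).rangeRestrict v))

theorem Datum.incl_injective (k : ℕ) : Function.Injective (D.incl k) :=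
  (D.VV k).injective_subtype.comp (LinearEquiv.injective _)

variable {D} (hD : D.Generic)
include hD

theorem Datum.Generic.jw_incl (k : ℕ) (v : Fin (D.vdim k) → ℂ) :
    D.jw k (D.incl k v) = D.incl k v := hD.mem_VV.1 (D.incl_mem k v)

theorem Datum.Generic.coord_incl (k : ℕ) (v : Fin (D.vdim k) → ℂ) :
    D.coord k (D.incl k v) = v := by
  apply D.incl_injective
  rw [D.incl_coord, hD.jw_incl]

/-- The action of the quantum algebra on `V_k`, in coordinates. -/
def Datum.Generic.repV (k : ℕ) : Uq D →ₐ[ℂ] Module.End ℂ (Fin (D.vdim k) → ℂ) :=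
  AlgHom.ofLinearMap
    { toFun := fun u => D.coord k ∘ₗ rhoH D z k u ∘ₗ D.incl k
      map_add' := fun a b => LinearMap.ext fun v => by simp
      map_smul' := fun a b => LinearMap.ext fun v => by simp }
    (LinearMap.ext fun v => by simpa using hD.coord_incl k v)
    (fun a b => LinearMap.ext fun v => by
      simp only [LinearMap.coe_mk, AddHom.coe_mk, LinearMap.comp_apply, Module.End.mul_apply,
        map_mul]
      rw [D.incl_coord, hD.mem_VV.1 ((hD.inv_VV k).rhoH b (D.incl_mem k v))])

theorem Datum.Generic.incl_repV (k : ℕ) (u : Uq D) (v : Fin (D.vdim k) → ℂ) :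
    D.incl k (hD.repV z k u v) = rhoH D z k u (D.incl k v) :=
  (D.incl_coord k _).trans (hD.mem_VV.1 ((hD.inv_VV k).rhoH u (D.incl_mem k v)))

theorem Datum.Generic.isIrrep_repV (hn : 2 ≤ n) (k : ℕ) : IsIrrep (hD.repV z k) := by
  refine ⟨?_, fun S hS => ?_⟩
  · have : Nonempty (Fin (D.vdim k)) := ⟨⟨0, hD.vdim_pos hn k⟩⟩
    infer_instance
  · by_cases h0 : S.map (D.incl k) = ⊥
    · left
      rw [eq_bot_iff]
      intro v hv
      have hv' := Submodule.mem_map_of_mem (f := D.incl k) hv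
      rw [h0, Submodule.mem_bot] at hv'
      exact (Submodule.mem_bot ℂ).2 (D.incl_injective k (hv'.trans (map_zero _).symm))
    · right
      have h := hD.eq_top_of_inv (z := z) (S := S.map (D.incl k)) ?_ ?_ h0
      · rw [eq_top_iff]
        intro v _
        have hv := D.incl_mem k v
        rw [← h] at hv
        obtain ⟨w, hw, hwv⟩ := hv
        rwa [← D.incl_injective k hwv]
      · rintro ε i j _ ⟨v, hv, rfl⟩
        rw [← rhoH_L, ← hD.incl_repV]
        exact ⟨_, hS _ v hv, rfl⟩
      · rintro _ ⟨v, _, rfl⟩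
        exact D.incl_mem k v

theorem Datum.Generic.not_repIso_repV (hn : 2 ≤ n) {k k' : ℕ} (h : k ≠ k') :
    ¬ RepIso (hD.repV z k) (hD.repV z k') := by
  rintro ⟨e, _⟩
  have := e.finrank_eq
  simp only [Module.finrank_fin_fun] at this
  exact h ((hD.vdim_strictMono hn).injective this)

end Irreps

/-! ### The decomposition -/

section Decomposition

instance (N : ℕ) : Finite (TwoRow N) :=
  Finite.of_injective (fun l : TwoRow N => (⟨l.row2, by have := l.sum_eq; omega⟩ : Fin (N + 1)))
    fun l l' h => by
      have h1 : l.row2 = l'.row2 := congrArg Fin.val h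
      have h2 := l.sum_eq
      have h3 := l'.sum_eq
      exact TwoRow.ext (by omega) h1

instance (N : ℕ) : Fintype (TwoRow N) := Fintype.ofFinite _

instance (N : ℕ) : DecidableEq (TwoRow N) := Classical.decEq _

theorem TwoRow.eq_k_add {N : ℕ} (l : TwoRow N) : N = l.k + 2 * l.row2 := by
  have h1 := l.le
  have h2 := l.sum_eq
  unfold TwoRow.k
  omega

theorem TwoRow.k_injective (N : ℕ) : Function.Injective (TwoRow.k (N := N)) := by
  intro l l' h
  have h1 := l.eq_k_add
  have h2 := l'.eq_k_add
  have h3 := l.sum_eq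
  have h4 := l'.sum_eq
  exact TwoRow.ext (by omega) (by omega)

theorem TwoRow.exists_k {N k j : ℕ} (h : N = k + 2 * j) : ∃ l : TwoRow N, l.k = k :=
  ⟨⟨k + j, j, by omega, by omega⟩, by simp [TwoRow.k]⟩

variable {n : ℕ} (D : Datum n) (z : ℂˣ) (N : ℕ)

/-- The summands of the decomposition. -/
abbrev Datum.Summand (l : TwoRow N) : Type :=
  (Fin (mult N l.k) → ℂ) ⊗[ℂ] (Fin (D.vdim l.k) → ℂ)

/-- The embedding of a summand. -/
def Datum.summandMap (k : ℕ) :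
    (Fin (mult N k) → ℂ) ⊗[ℂ] (Fin (D.vdim k) → ℂ) →ₗ[ℂ] HH n N :=
  TensorProduct.lift (∑ i, (LinearMap.proj (R := ℂ) (φ := fun _ : Fin (mult N k) => ℂ) i).smulRight
    (D.inc N k i ∘ₗ D.incl k))

theorem Datum.summandMap_tmul (k : ℕ) (w : Fin (mult N k) → ℂ) (v : Fin (D.vdim k) → ℂ) :
    D.summandMap N k (w ⊗ₜ v) = ∑ i, w i • D.inc N k i (D.incl k v) := by
  simp [Datum.summandMap, LinearMap.sum_apply]

/-- The sum of the embeddings of the summands. -/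
def Datum.assemble : (⨁ l : TwoRow N, D.Summand N l) →ₗ[ℂ] HH n N :=
  DirectSum.toModule ℂ (TwoRow N) (HH n N) fun l => D.summandMap N l.k

theorem Datum.assemble_lof (l : TwoRow N) (x : D.Summand N l) :
    D.assemble N (DirectSum.lof ℂ _ _ l x) = D.summandMap N l.k x :=
  DirectSum.toModule_lof _ _ _

variable {D N} (hD : D.Generic)
include hD

theorem Datum.Generic.assemble_surjective : Function.Surjective (D.assemble N) := by
  rw [← LinearMap.range_eq_top, eq_top_iff]
  intro v _
  have h := LinearMap.congr_fun (hD.sum_inc_prj N) v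
  rw [LinearMap.id_apply] at h
  rw [← h]
  simp only [LinearMap.sum_apply, LinearMap.comp_apply]
  refine Submodule.sum_mem _ fun k _ => Submodule.sum_mem _ fun i _ => ?_
  obtain ⟨j, hj⟩ := Fin.exists_of_mult i
  obtain ⟨l, rfl⟩ := TwoRow.exists_k hj
  refine ⟨DirectSum.lof ℂ _ _ l (Pi.single i 1 ⊗ₜ D.coord l.k (D.prj N l.k i v)), ?_⟩
  rw [D.assemble_lof, D.summandMap_tmul, Finset.sum_eq_single i, D.incl_coord, hD.inc_jw]
  · simp
  · intro b _ hb; simp [hb]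
  · simp

theorem Datum.Generic.finrank_summands :
    Module.finrank ℂ (⨁ l : TwoRow N, D.Summand N l) = n ^ N := by
  rw [Module.finrank_directSum, ← hD.sum_mult_vdim N]
  refine Finset.sum_of_injOn TwoRow.k (TwoRow.k_injective N).injOn ?_ ?_ ?_
  · intro l _
    have := l.eq_k_add
    simp only [Finset.coe_range, Set.mem_Iio]
    omega
  · intro k _ hk
    by_cases h : mult N k = 0
    · rw [h, zero_mul]
    · obtain ⟨j, hj⟩ := exists_of_mult_ne_zero h
      obtain ⟨l, rfl⟩ := TwoRow.exists_k hj
      exact absurd ⟨l, by simp, rfl⟩ hk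
  · intro l _
    simp

omit hD in
theorem DirectSum.injective_of_surjective_of_finrank_eq {ι : Type} [Fintype ι] {M : ι → Type}
    {W : Type} [∀ i, AddCommGroup (M i)] [∀ i, Module ℂ (M i)] [∀ i, Module.Finite ℂ (M i)]
    [AddCommGroup W] [Module ℂ W] [Module.Finite ℂ W] (f : (⨁ i, M i) →ₗ[ℂ] W)
    (h : Module.finrank ℂ (⨁ i, M i) = Module.finrank ℂ W) (hf : Function.Surjective f) :
    Function.Injective f :=
  (LinearMap.injective_iff_surjective_of_finrank_eq_finrank h).2 hf

theorem Datum.Generic.assemble_injective : Function.Injective (D.assemble N) :=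
  DirectSum.injective_of_surjective_of_finrank_eq (M := D.Summand N) (D.assemble N)
    (hD.finrank_summands.trans (HH.finrank n N).symm) hD.assemble_surjective

variable (N) in
/-- The decomposition of the model. -/
def Datum.Generic.decomp : (⨁ l : TwoRow N, D.Summand N l) ≃ₗ[ℂ] HH n N :=
  LinearEquiv.ofBijective (D.assemble N) ⟨hD.assemble_injective, hD.assemble_surjective⟩

theorem Datum.Generic.decomp_lof (l : TwoRow N) (x : D.Summand N l) :
    hD.decomp N (DirectSum.lof ℂ _ _ l x) = D.summandMap N l.k x := D.assemble_lof N l x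

theorem Datum.Generic.decomp_symm_eq {g : Module.End ℂ (⨁ l : TwoRow N, D.Summand N l)}
    {f : Module.End ℂ (HH n N)}
    (h : ∀ (l : TwoRow N) w v, hD.decomp N (g (DirectSum.lof ℂ _ _ l (w ⊗ₜ v))) =
      f (D.summandMap N l.k (w ⊗ₜ v))) (x : HH n N) :
    (hD.decomp N).symm (f x) = g ((hD.decomp N).symm x) := by
  obtain ⟨y, rfl⟩ := (hD.decomp N).surjective x
  rw [LinearEquiv.symm_apply_apply, LinearEquiv.symm_apply_eq]
  suffices e : f ∘ₗ (hD.decomp N).toLinearMap = (hD.decomp N).toLinearMap ∘ₗ g from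
    LinearMap.congr_fun e y
  refine DirectSum.linearMap_ext ℂ fun l => TensorProduct.ext' fun w v => ?_
  simp only [LinearMap.comp_apply, LinearEquiv.coe_coe]
  rw [hD.decomp_lof, h]

theorem Datum.Generic.decomp_symm_rhoH (u : Uq D) (x : HH n N) (l : TwoRow N) :
    (hD.decomp N).symm (rhoH D z N u x) l = TensorProduct.map LinearMap.id
      (hD.repV z l.k (Uq.twist D ((z ^ 2 * D.q) ^ l.row2) u)) ((hD.decomp N).symm x l) := by
  have := hD.decomp_symm_eq (N := N) (f := rhoH D z N u)
    (g := DirectSum.lmap fun l : TwoRow N => TensorProduct.map LinearMap.id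
      (hD.repV z l.k (Uq.twist D ((z ^ 2 * D.q) ^ l.row2) u))) ?_ x
  · rw [this, DirectSum.lmap_apply]
  · intro l w v
    rw [DirectSum.lmap_lof, hD.decomp_lof, TensorProduct.map_tmul, D.summandMap_tmul,
      D.summandMap_tmul, map_sum]
    refine Finset.sum_congr rfl fun i _ => ?_
    rw [map_smul, hD.incl_repV, (D.intertw_inc z N l.k i l.row2 l.eq_k_add).rhoH]
    rfl

variable (N) in
/-- Operators on the model acting on the multiplicity spaces. -/
def Datum.Generic.multHom :
    (∀ l : TwoRow N, Module.End ℂ (Fin (mult N l.k) → ℂ)) →ₐ[ℂ] Module.End ℂ (HH n N) :=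
  ((hD.decomp N).conjAlgEquiv ℂ).toAlgHom.comp (AlgHom.ofLinearMap
    { toFun := fun g => DirectSum.lmap fun l : TwoRow N =>
        (TensorProduct.map (g l) LinearMap.id : Module.End ℂ (D.Summand N l))
      map_add' := fun g g' => LinearMap.ext fun x => by
        refine DFinsupp.ext fun l => ?_
        simp [DirectSum.lmap_apply, TensorProduct.map_add_left]
      map_smul' := fun a g => LinearMap.ext fun x => by
        refine DFinsupp.ext fun l => ?_
        rw [RingHom.id_apply, LinearMap.smul_apply, DirectSum.smul_apply]
        simp [DirectSum.lmap_apply, TensorProduct.map_smul_left] }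
    (LinearMap.ext fun x => DFinsupp.ext fun l => by
      simp [Module.End.one_eq_id])
    (fun g g' => LinearMap.ext fun x => DFinsupp.ext fun l => by
      simp [DirectSum.lmap_apply, Module.End.mul_eq_comp, TensorProduct.map_map]))

theorem Datum.Generic.decomp_symm_multHom
    (g : ∀ l : TwoRow N, Module.End ℂ (Fin (mult N l.k) → ℂ)) (x : HH n N) (l : TwoRow N) :
    (hD.decomp N).symm (hD.multHom N g x) l =
      TensorProduct.map (g l) LinearMap.id ((hD.decomp N).symm x l) := by
  simp [Datum.Generic.multHom, LinearEquiv.conjAlgEquiv_apply_apply]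

theorem Datum.Generic.multHom_injective (hn : 2 ≤ n) : Function.Injective (hD.multHom N) := by
  rw [injective_iff_map_eq_zero]
  intro g hg
  funext l
  refine LinearMap.ext fun w => ?_
  obtain ⟨i⟩ : Nonempty (Fin (D.vdim l.k)) := ⟨⟨0, hD.vdim_pos hn l.k⟩⟩
  have h := hD.decomp_symm_multHom g
    (hD.decomp N (DirectSum.lof ℂ _ _ l (w ⊗ₜ Pi.single i 1))) l
  rw [hg, LinearMap.zero_apply, map_zero, LinearEquiv.symm_apply_apply,
    DirectSum.lof_apply, TensorProduct.map_tmul] at h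
  have h2 := congrArg (TensorProduct.lid ℂ _ ∘ TensorProduct.comm ℂ _ ℂ ∘
    TensorProduct.map LinearMap.id (LinearMap.proj i)) h.symm
  simpa using h2

theorem Datum.Generic.multHom_range (z : ℂˣ) (hn : 2 ≤ n) :
    (hD.multHom N).range = (tlH D N).range := by
  ext f
  rw [hD.mem_tlH_range (z := z) hn]
  constructor
  · rintro ⟨g, rfl⟩ u
    refine LinearMap.ext fun x => (hD.decomp N).symm.injective (DFinsupp.ext fun l => ?_)
    show (hD.decomp N).symm (rhoH D z N u (hD.multHom N g x)) l =
      (hD.decomp N).symm (hD.multHom N g (rhoH D z N u x)) l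
    rw [hD.decomp_symm_rhoH, hD.decomp_symm_multHom, hD.decomp_symm_multHom,
      hD.decomp_symm_rhoH, TensorProduct.map_map, TensorProduct.map_map]
    simp
  · intro hf
    have hint := intertw_of_forall_commute hf
    have hex : ∀ (l : TwoRow N) (i j : Fin (mult N l.k)), ∃ a : ℂ, ∀ v,
        D.prj N l.k i (f (D.inc N l.k j (D.jw l.k v))) = a • D.jw l.k v := by
      intro l i j
      have h := (D.intertw_prj z N l.k i _ l.eq_k_add).comp
        (hint.comp (D.intertw_inc z N l.k j _ l.eq_k_add))
      rw [one_mul, ← mul_pow, inv_mul_cancel, one_pow] at h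
      exact hD.schur_scalar hn h fun v => hD.jw_prj N l.k i _
    choose a ha using hex
    have hsum : ∀ (l : TwoRow N) (j : Fin (mult N l.k)) v, D.jw l.k v = v →
        f (D.inc N l.k j v) = ∑ i, a l i j • D.inc N l.k i v := by
      intro l j v hv
      have h := LinearMap.congr_fun (hD.sum_inc_prj N) (f (D.inc N l.k j v))
      rw [LinearMap.id_apply] at h
      rw [← h]
      simp only [LinearMap.sum_apply, LinearMap.comp_apply]
      have hl := l.eq_k_add
      rw [Finset.sum_eq_single l.k]
      · refine Finset.sum_congr rfl fun i _ => ?_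
        have := ha l i j v
        rw [hv] at this
        rw [this, map_smul]
      · intro k _ hk
        refine Finset.sum_eq_zero fun i _ => ?_
        obtain ⟨m, hm⟩ := Fin.exists_of_mult i
        have := hD.schur_zero hn (Ne.symm hk) ((D.intertw_prj z N k i m hm).comp
          (hint.comp (D.intertw_inc z N l.k j _ hl))) (fun v => hD.jw_prj N k i _) v
        rw [hv] at this
        rw [LinearMap.comp_apply, LinearMap.comp_apply] at this
        rw [this, map_zero]
      · intro h
        exact absurd (Finset.mem_range.2 (by omega)) h
    refine ⟨fun l => Matrix.toLin' (Matrix.of (a l)), LinearMap.ext fun x =>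
      (hD.decomp N).symm.injective (DFinsupp.ext fun l => ?_)⟩
    have := hD.decomp_symm_eq (N := N) (f := f)
      (g := DirectSum.lmap fun l : TwoRow N =>
        TensorProduct.map (Matrix.toLin' (Matrix.of (a l))) LinearMap.id) ?_ x
    · rw [this, DirectSum.lmap_apply]
      exact hD.decomp_symm_multHom _ x l
    · intro l w v
      rw [DirectSum.lmap_lof, hD.decomp_lof, TensorProduct.map_tmul, D.summandMap_tmul,
        D.summandMap_tmul, map_sum]
      simp only [map_smul, hsum l _ _ (hD.jw_incl l.k v), Matrix.toLin'_apply, Matrix.mulVec,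
        dotProduct, Matrix.of_apply, LinearMap.id_apply, Finset.sum_smul, Finset.smul_sum]
      rw [Finset.sum_comm]
      exact Finset.sum_congr rfl fun i _ => Finset.sum_congr rfl fun j _ => by
        rw [smul_smul, mul_comm]

variable (N) in
/-- The Temperley–Lieb algebra acts on the multiplicity spaces. -/
def Datum.Generic.repProd (hn : 2 ≤ n) :
    TL N D.q →ₐ[ℂ] (∀ l : TwoRow N, Module.End ℂ (Fin (mult N l.k) → ℂ)) :=
  (AlgEquiv.ofInjective (hD.multHom N) (hD.multHom_injective hn)).symm.toAlgHom.comp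
    ((tlH D N).codRestrict (hD.multHom N).range fun t => by
      rw [hD.multHom_range 1 hn]; exact ⟨t, rfl⟩)

theorem Datum.Generic.multHom_repProd (hn : 2 ≤ n) (t : TL N D.q) :
    hD.multHom N (hD.repProd N hn t) = tlH D N t :=
  congrArg Subtype.val ((AlgEquiv.ofInjective (hD.multHom N)
    (hD.multHom_injective hn)).apply_symm_apply _)

theorem Datum.Generic.repProd_surjective (hn : 2 ≤ n) :
    Function.Surjective (hD.repProd N hn) := by
  intro g
  have h : hD.multHom N g ∈ (tlH D N).range := by
    rw [← hD.multHom_range 1 hn]; exact ⟨g, rfl⟩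
  obtain ⟨t, ht⟩ := h
  refine ⟨t, hD.multHom_injective hn ?_⟩
  rw [hD.multHom_repProd]
  exact ht

/-- The action of the Temperley–Lieb algebra on `W_k(N)`. -/
def Datum.Generic.repW (hn : 2 ≤ n) (N : ℕ) (l : TwoRow N) :
    TL N D.q →ₐ[ℂ] Module.End ℂ (Fin (mult N l.k) → ℂ) :=
  (Pi.evalAlgHom ℂ _ l).comp (hD.repProd N hn)

omit hD in
theorem TwoRow.nontrivial {N : ℕ} (l : TwoRow N) : Nontrivial (Fin (mult N l.k) → ℂ) := by
  have : Nonempty (Fin (mult N l.k)) := ⟨⟨0, mult_pos N l.k l.row2 l.eq_k_add⟩⟩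
  infer_instance

theorem Datum.Generic.isIrrep_repW (hn : 2 ≤ n) (N : ℕ) (l : TwoRow N) :
    IsIrrep (hD.repW hn N l) := by
  refine ⟨l.nontrivial, fun S hS => ?_⟩
  by_cases h0 : S = ⊥
  · exact Or.inl h0
  · right
    obtain ⟨s, hs, hs0⟩ := S.exists_mem_ne_zero_of_ne_bot h0
    obtain ⟨i, hi⟩ := Function.ne_iff.1 hs0
    rw [eq_top_iff]
    intro v _
    obtain ⟨t, ht⟩ := hD.repProd_surjective hn (Pi.single l
      ((LinearMap.proj (R := ℂ) (φ := fun _ : Fin (mult N l.k) => ℂ) i).smulRight ((s i)⁻¹ • v)))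
    have h1 := hS t s hs
    have h2 : hD.repW hn N l t s = v := by
      show hD.repProd N hn t l s = v
      rw [ht, Pi.single_eq_same]
      simp only [LinearMap.smulRight_apply, LinearMap.proj_apply]
      rw [smul_smul, mul_inv_cancel₀ hi, one_smul]
    rwa [h2] at h1

theorem Datum.Generic.not_repIso_repW (hn : 2 ≤ n) (N : ℕ) {l l' : TwoRow N} (h : l ≠ l') :
    ¬ RepIso (hD.repW hn N l) (hD.repW hn N l') := by
  rintro ⟨e, he⟩
  obtain ⟨t, ht⟩ := hD.repProd_surjective hn (Pi.single l 1)
  have := l.nontrivial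
  obtain ⟨w, hw⟩ := exists_ne (0 : Fin (mult N l.k) → ℂ)
  have h1 := he t w
  have h2 : hD.repW hn N l t = 1 := by
    show hD.repProd N hn t l = 1
    rw [ht, Pi.single_eq_same]
  have h3 : hD.repW hn N l' t = 0 := by
    show hD.repProd N hn t l' = 0
    rw [ht, Pi.single_eq_of_ne (Ne.symm h)]
  rw [h2, h3, Module.End.one_apply, LinearMap.zero_apply] at h1
  exact hw (e.map_eq_zero_iff.1 h1)

end Decomposition

end TLDuality

end

open TLDuality in
theorem mainTheorem1 (n : ℕ) (hn : 2 ≤ n) (D : Datum n)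
    (hq : ∀ m : ℕ, 0 < m → (D.q : ℂ) ^ m ≠ 1) (z : ℂˣ) :
    (∀ N : ℕ,
      Subalgebra.centralizer ℂ ((rho D z N).range : Set (Module.End ℂ (H n N))) =
        (tlRep D N).range ∧
      Subalgebra.centralizer ℂ ((tlRep D N).range : Set (Module.End ℂ (H n N))) =
        (rho D z N).range) ∧
    ∃ (p : ℕ → ℕ) (ν : ℕ → ℕ → ℕ)
      (V : ∀ k : ℕ, Uq D →ₐ[ℂ] Module.End ℂ (Fin (p k) → ℂ))
      (W : ∀ (N : ℕ) (l : TwoRow N), TL N D.q →ₐ[ℂ] Module.End ℂ (Fin (ν l.k N) → ℂ)),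
      (∀ k, IsIrrep (V k)) ∧
      (∀ k k', k ≠ k' → ¬ RepIso (V k) (V k')) ∧
      (∀ N (l : TwoRow N), IsIrrep (W N l)) ∧
      (∀ N (l l' : TwoRow N), l ≠ l' → ¬ RepIso (W N l) (W N l')) ∧
      (p 0 = 1 ∧ p 1 = n ∧ ∀ k, n * p (k + 1) = p (k + 2) + p k) ∧
      (ν 0 0 = 1 ∧ (∀ k, ν (k + 1) 0 = 0) ∧ (∀ N, ν 0 (N + 1) = ν 1 N) ∧
        ∀ N k, ν (k + 1) (N + 1) = ν (k + 2) N + ν k N) ∧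
      ∀ N : ℕ, ∃ e : H n N ≃ₗ[ℂ]
          ⨁ l : TwoRow N, ((Fin (ν l.k N) → ℂ) ⊗[ℂ] (Fin (p l.k) → ℂ)),
        (∀ (t : TL N D.q) (h : H n N) (l : TwoRow N),
          e (tlRep D N t h) l =
            TensorProduct.map (W N l t) LinearMap.id (e h l)) ∧
        (∀ (u : Uq D) (h : H n N) (l : TwoRow N),
          e (rho D z N u h) l =
            TensorProduct.map LinearMap.id
              (V l.k (Uq.twist D ((z ^ 2 * D.q) ^ l.row2) u)) (e h l)) := by
  have hD : D.Generic := hq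
  refine ⟨fun N => ⟨hD.centralizer_rho hn z N, hD.centralizer_tlRep hn z N⟩, D.vdim,
    fun k N => mult N k, hD.repV z, hD.repW hn, hD.isIrrep_repV z hn,
    fun _ _ h => hD.not_repIso_repV z hn h, hD.isIrrep_repW hn,
    fun N _ _ h => hD.not_repIso_repW hn N h, ⟨D.vdim_zero, D.vdim_one, hD.vdim_rec⟩,
    ⟨rfl, fun _ => rfl, fun _ => rfl, fun _ _ => rfl⟩, fun N =>
    ⟨(toHH n N).trans (hD.decomp N).symm, fun t h l => ?_, fun u h l => ?_⟩⟩
  · have h1 : toHH n N (tlRep D N t h) = hD.multHom N (hD.repProd N hn t) (toHH n N h) := by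
      rw [hD.multHom_repProd, ← toEnd_apply]; rfl
    rw [LinearEquiv.trans_apply, h1]
    exact hD.decomp_symm_multHom _ _ l
  · have h1 : toHH n N (rho D z N u h) = rhoH D z N u (toHH n N h) := by
      rw [← toEnd_apply]; rfl
    rw [LinearEquiv.trans_apply, h1]
    exact hD.decomp_symm_rhoH z u _ l
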